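/- Let $\frac12<\alpha<\frac32$. There is a constant $C_\alpha$, depending only on $\alpha$, such that the following holds. Let $n\ge 2$ and $1\le p\le \frac{2n+2}{n+1+4\alpha}$. Then there is a constant $K=K(n,\alpha,p)$ such that for all $f\in L^p(\mathbb{R}^n)$ and all $\varepsilon>0$, $$\bigg|\int_{\frac12<|\xi|<\frac32}\frac{|\hat f(\xi)|^2}{\big((1-|\xi|^2)^2+\varepsilon^2\big)^{\alpha}}\,d\xi-\frac{C_\alpha}{\varepsilon^{2\alpha-1}}\,\|\hat f\|_{L^2(S^{n-1})}^2\bigg|\le K\,\|f\|_{L^p(\mathbb{R}^n)}^2 ,$$ where the integral is finite. Here $\hat f(\xi)=\int_{\mathbb{R}^n}e^{-i\xi\cdot x}f(x)\,dx$ for Schwartz $f$; for general $f\in L^p(\mathbb{R}^n)$, $\hat f$ is the function that represents the Fourier transform of $f$ as a tempered distribution. $S^{n-1}$ is the unit sphere with its surface measure, and the restriction $\hat f|_{S^{n-1}}\in L^2(S^{n-1})$ is obtained by continuous extension from Schwartz functions: it is the limit in $L^2(S^{n-1})$ of $\hat\varphi_k|_{S^{n-1}}$ for Schwartz functions $\varphi_k\to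 f$ in $L^p(\mathbb{R}^n)$. Both $\hat f$ and $\hat f|_{S^{n-1}}$ exist for every $f \in L^p(\mathbb{R}^n)$ with $p$ in the stated range. -/

import Mathlib

open MeasureTheory Filter Topology

noncomputable section

/-- The Fourier integral with the convention `∫ e^{-i ξ·x} f(x) dx` (no `2π` in the exponent). -/
def fourierHat {n : ℕ} (f : EuclideanSpace ℝ (Fin n) → ℂ) (ξ : EuclideanSpace ℝ (Fin n)) : ℂ :=
  ∫ x, Complex.exp (-(Complex.I * ((inner ℝ ξ x : ℝ) : ℂ))) * f x

/-- The function `g` is the Fourier transform of `f` in the sense of tempered distributions: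
`⟨g, φ⟩ = ⟨f, φ̂⟩` for every Schwartz function `φ`. This determines `g` almost everywhere. -/
def IsFourierTransform {n : ℕ} (f g : EuclideanSpace ℝ (Fin n) → ℂ) : Prop :=
  ∀ φ : SchwartzMap (EuclideanSpace ℝ (Fin n)) ℂ,
    Integrable (fun ξ => g ξ * φ ξ) ∧ ∫ ξ, g ξ * φ ξ = ∫ x, f x * fourierHat (⇑φ) x

/-- Surface measure on the unit sphere of `ℝⁿ` (total mass `n · vol(B)`). -/
def surfaceMeasure (n : ℕ) : Measure (Metric.sphere (0 : EuclideanSpace ℝ (Fin n)) 1) :=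
  (volume : Measure (EuclideanSpace ℝ (Fin n))).toSphere

/-- The function `h ∈ L²(S^{n-1})` is the restriction of `f̂` to the unit sphere, for `f ∈ L^p`:
the restriction map `φ ↦ φ̂|_{S^{n-1}}` on Schwartz functions is extended by continuity
from the `L^p` norm to the `L²(S^{n-1})` norm. -/
def IsSphereRestriction {n : ℕ} (p : ℝ) (f : EuclideanSpace ℝ (Fin n) → ℂ)
    (h : Metric.sphere (0 : EuclideanSpace ℝ (Fin n)) 1 → ℂ) : Prop :=
  MemLp h 2 (surfaceMeasure n) ∧
  ∃ φ : ℕ → SchwartzMap (EuclideanSpace ℝ (Fin n)) ℂ,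
    Tendsto (fun k => eLpNorm (fun x => φ k x - f x) (ENNReal.ofReal p) volume) atTop (𝓝 0) ∧
    Tendsto (fun k => eLpNorm (fun ω : Metric.sphere (0 : EuclideanSpace ℝ (Fin n)) 1 =>
      fourierHat (⇑(φ k)) ω - h ω) 2 (surfaceMeasure n)) atTop (𝓝 0)

/-- The annulus `1/2 < |ξ| < 3/2`. -/
def annulus (n : ℕ) : Set (EuclideanSpace ℝ (Fin n)) :=
  {ξ | 1 / 2 < ‖ξ‖ ∧ ‖ξ‖ < 3 / 2}

end

/-
Let `w(u) = (ε² + u²)^{-α}`, with cosine transform `ŵ(s) = ∫ w(u) cos(su) du`. Up to a factor,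
`∫ |f̂(ξ)|² w(1 - |ξ|²) dξ` is the integral of `ŵ(s) Re B(s)` over `s > 0`, where
`B(s) = ∫ e^{is(1 - |ξ|²)} |f̂(ξ)|² dξ` is a quadratic form of the Schrödinger propagator. Write
`ŵ(s) = ŵ(0) - D(s)`. By Abel summation the constant `ŵ(0)` contributes exactly the sphere term:
`ŵ(0)` is a multiple of `ε^{1 - 2α}`, and `∫ Re B` is a multiple of the density of `|f̂|²` on
`|ξ| = 1`. By scaling `D(s) = s^{2α - 1} A(εs)` with `A` bounded and decreasing, and this is where
`1/2 < α < 3/2` is needed. By the second mean value theorem the monotone factor is harmless, so what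
remains is a bound for `∫₁^∞ s^{z - 1} B(s) ds` at `z = 2α`, uniform in the truncation. Stein
interpolation gives it at `p = 2(n + 1) / (n + 1 + 4α)`, between an `L²` bound on `re z = 0`, which
rests on `∫ s^{-1 + iτ} e^{ils} ds`, and an `L¹ → L^∞` bound on `re z = (n + 1) / 2`, where the
dispersive decay `s^{-n/2}` of the kernel leaves `∫ s^{-1/2 + iτ} e^{i(s + ρ²/s)} ds`. Smaller `p`
reduce to this exponent by cutting off high frequencies.
-/

open scoped FourierTransform

section SecondMeanValue

open Set

variable {E : Type*} [NormedAddCommGroup E] [NormedSpace ℝ E] [CompleteSpace E]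

lemma exists_superlevel_ae_eq_Ioc_of_antitoneOn {φ : ℝ → ℝ} {x₀ t : ℝ} (hφ : AntitoneOn φ (Ici x₀))
    (hlim : Tendsto φ atTop (𝓝 0)) (ht : 0 < t) :
    ∃ R, x₀ ≤ R ∧ (Ioi x₀ ∩ {s | t < φ s} : Set ℝ) =ᵐ[volume] Ioc x₀ R := by
  set S := Ioi x₀ ∩ {s | t < φ s}
  rcases S.eq_empty_or_nonempty with hS | hS
  · exact ⟨x₀, le_rfl, by simp [hS]⟩
  have hbdd : BddAbove S := by
    obtain ⟨N, hN⟩ := eventually_atTop.1 (hlim.eventually (gt_mem_nhds ht))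
    exact ⟨N, fun s hs => not_lt.1 fun hNs => lt_asymm hs.2 (hN s hNs.le)⟩
  have Ioo_subset : Ioo x₀ (sSup S) ⊆ S := fun s hs => by
    obtain ⟨r, hr, hsr⟩ := exists_lt_of_lt_csSup hS hs.2
    exact ⟨hs.1, hr.2.trans_le (hφ (mem_Ici_of_Ioi hs.1) (mem_Ici_of_Ioi hr.1) hsr.le)⟩
  have subset_Ioc : S ⊆ Ioc x₀ (sSup S) := fun s hs => ⟨hs.1, le_csSup hbdd hs⟩
  obtain ⟨s, hs⟩ := hS
  exact ⟨sSup S, (le_of_lt hs.1).trans (le_csSup hbdd hs), subset_Ioc.eventuallyLE.antisymm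
    (Ioo_ae_eq_Ioc.symm.le.trans Ioo_subset.eventuallyLE)⟩

lemma setIntegral_Ioc_indicator_Iio_const {y b : ℝ} (hy : 0 ≤ y) (hyb : y ≤ b) (v : E) :
    ∫ t in Ioc 0 b, (Iio y).indicator (fun _ => v) t = y • v := by
  have hset : Ioc 0 b ∩ Iio y = Ioo 0 y := by
    ext t
    exact ⟨fun h => ⟨h.1.1, h.2⟩, fun h => ⟨⟨h.1, h.2.le.trans hyb⟩, h.2⟩⟩
  rw [setIntegral_indicator measurableSet_Iio, hset]
  simp [hy]

/- Bonnet's form of the second mean value theorem, as an inequality: by the layer cake formula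
`φ • k` is an average of truncations of `k` to the superlevel sets of `φ`, which are intervals. -/
lemma norm_setIntegral_Ioi_smul_le_of_antitoneOn {φ : ℝ → ℝ} {k : ℝ → E} {x₀ M : ℝ}
    (hφ : AntitoneOn φ (Ici x₀)) (hlim : Tendsto φ atTop (𝓝 0))
    (hk : AEStronglyMeasurable k (volume.restrict (Ioi x₀)))
    (hφk : IntegrableOn (fun s => φ s • k s) (Ioi x₀))
    (hM : ∀ R, x₀ ≤ R → ‖∫ s in x₀..R, k s‖ ≤ M) :
    ‖∫ s in Ioi x₀, φ s • k s‖ ≤ M * φ x₀ := by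
  have hφ_nonneg : ∀ s ∈ Ici x₀, 0 ≤ φ s := fun s hs =>
    le_of_tendsto hlim ((eventually_ge_atTop s).mono fun r hr => hφ hs (le_trans hs hr) hr)
  have hφ_le : ∀ s ∈ Ici x₀, φ s ≤ φ x₀ := fun s hs => hφ self_mem_Ici hs hs
  have hφ_meas : AEMeasurable φ (volume.restrict (Ioi x₀)) :=
    aemeasurable_restrict_of_antitoneOn measurableSet_Ioi (hφ.mono Ioi_subset_Ici_self)
  have hsuper : NullMeasurableSet {q : ℝ × ℝ | q.2 < φ q.1}
      ((volume.restrict (Ioi x₀)).prod (volume.restrict (Ioc 0 (φ x₀)))) :=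
    nullMeasurableSet_lt measurable_snd.aemeasurable hφ_meas.comp_fst
  let F : ℝ → ℝ → E := fun s => (Iio (φ s)).indicator fun _ => k s
  have layer_cake : ∀ s ∈ Ioi x₀, φ s • k s = ∫ t in Ioc 0 (φ x₀), F s t := fun s hs =>
    (setIntegral_Ioc_indicator_Iio_const (hφ_nonneg s (mem_Ici_of_Ioi hs))
      (hφ_le s (mem_Ici_of_Ioi hs)) _).symm
  have hF : Integrable (Function.uncurry F)
      ((volume.restrict (Ioi x₀)).prod (volume.restrict (Ioc 0 (φ x₀)))) := by
    refine (integrable_prod_iff (hk.comp_fst.indicator₀ hsuper)).2 ⟨.of_forall fun s =>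
      (integrable_const (k s)).indicator (measurableSet_Iio (a := φ s)), hφk.norm.congr ?_⟩
    filter_upwards [ae_restrict_mem measurableSet_Ioi] with s hs
    have hs0 := hφ_nonneg s (mem_Ici_of_Ioi hs)
    rw [norm_smul, Real.norm_of_nonneg hs0, ← smul_eq_mul,
      ← setIntegral_Ioc_indicator_Iio_const hs0 (hφ_le s (mem_Ici_of_Ioi hs))]
    simp only [norm_indicator_eq_indicator_norm]
    rfl
  have slice_le : ∀ t ∈ Ioc 0 (φ x₀), ‖∫ s in Ioi x₀, F s t‖ ≤ M := fun t ht => by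
    obtain ⟨R, hR, hae⟩ := exists_superlevel_ae_eq_Ioc_of_antitoneOn hφ hlim ht.1
    have : ∫ s in Ioi x₀, F s t = ∫ s in Ioi x₀, {s | t < φ s}.indicator k s := rfl
    have hlevel : NullMeasurableSet {s | t < φ s} (volume.restrict (Ioi x₀)) :=
      nullMeasurableSet_lt aemeasurable_const hφ_meas
    rw [this, integral_indicator₀ hlevel, Measure.restrict_restrict₀ hlevel, inter_comm,
      setIntegral_congr_set hae, ← intervalIntegral.integral_of_le hR]
    exact hM R hR
  rw [setIntegral_congr_fun measurableSet_Ioi layer_cake, integral_integral_swap hF]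
  simpa [hφ_nonneg x₀ self_mem_Ici] using
    norm_setIntegral_le_of_norm_le_const (μ := volume) measure_Ioc_lt_top slice_le

end SecondMeanValue

section OscillatoryIntegrals

open Set Complex

/- Integration by parts: a bounded primitive `v` of the oscillating factor is played off against
an amplitude `u` whose variation is controlled by the increment of `g`. -/
lemma norm_integral_mul_deriv_le {A : Type*} [NormedRing A] [NormedAlgebra ℝ A] [CompleteSpace A]
    {u u' v v' : ℝ → A} {g g' : ℝ → ℝ} {a b M : ℝ} (hab : a ≤ b)
    (hu : ∀ x ∈ Icc a b, HasDerivAt u (u' x) x) (hv : ∀ x ∈ Icc a b, HasDerivAt v (v' x) x)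
    (hg : ∀ x ∈ Icc a b, HasDerivAt g (g' x) x) (hu' : ContinuousOn u' (Icc a b))
    (hv' : ContinuousOn v' (Icc a b)) (hg' : ContinuousOn g' (Icc a b))
    (hvM : ∀ x ∈ Icc a b, ‖v x‖ ≤ M) (hu'g : ∀ x ∈ Icc a b, ‖u' x‖ ≤ g' x) :
    ‖∫ x in a..b, u x * v' x‖ ≤ M * (‖u a‖ + ‖u b‖ + (g b - g a)) := by
  have haI : a ∈ Icc a b := left_mem_Icc.2 hab
  have hbI : b ∈ Icc a b := right_mem_Icc.2 hab
  rw [← uIcc_of_le hab] at hu hv hg hu' hv' hg'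
  have : 0 ≤ M := (norm_nonneg _).trans (hvM a haI)
  have boundary : ∀ x ∈ Icc a b, ‖u x * v x‖ ≤ M * ‖u x‖ := fun x hx =>
    (norm_mul_le _ _).trans ((mul_comm _ _).trans_le
      (mul_le_mul_of_nonneg_right (hvM x hx) (norm_nonneg _)))
  have remainder : ‖∫ x in a..b, u' x * v x‖ ≤ M * (g b - g a) := by
    rw [← intervalIntegral.integral_eq_sub_of_hasDerivAt hg hg'.intervalIntegrable,
      ← intervalIntegral.integral_const_mul]
    refine intervalIntegral.norm_integral_le_of_norm_le hab (.of_forall fun x hx => ?_)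
      (hg'.intervalIntegrable.const_mul M)
    have hxI := Ioc_subset_Icc_self hx
    calc ‖u' x * v x‖ ≤ ‖u' x‖ * ‖v x‖ := norm_mul_le _ _
      _ ≤ g' x * M := mul_le_mul (hu'g x hxI) (hvM x hxI) (norm_nonneg _)
          ((norm_nonneg _).trans (hu'g x hxI))
      _ = M * g' x := mul_comm _ _
  rw [intervalIntegral.integral_mul_deriv_eq_deriv_mul hu hv hu'.intervalIntegrable
    hv'.intervalIntegrable]
  calc _ ≤ ‖u b * v b‖ + ‖u a * v a‖ + ‖∫ x in a..b, u' x * v x‖ :=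
        (norm_sub_le _ _).trans (add_le_add_left (norm_sub_le _ _) _)
    _ ≤ M * ‖u b‖ + M * ‖u a‖ + M * (g b - g a) := by
        gcongr <;> solve_by_elim
    _ = M * (‖u a‖ + ‖u b‖ + (g b - g a)) := by ring

lemma hasDerivAt_ofReal_cpow_of_pos {s : ℝ} (hs : 0 < s) (c : ℂ) :
    HasDerivAt (fun x : ℝ => (x : ℂ) ^ c) (c * (s : ℂ) ^ (c - 1)) s := by
  rcases eq_or_ne c 0 with rfl | hc
  · simpa using hasDerivAt_const s (1 : ℂ)
  · exact hasDerivAt_ofReal_cpow_const hs.ne' hc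

lemma continuousOn_ofReal_cpow_of_pos {S : Set ℝ} (hS : ∀ s ∈ S, 0 < s) (c : ℂ) :
    ContinuousOn (fun x : ℝ => (x : ℂ) ^ c) S := fun s hs =>
  (continuousAt_ofReal_cpow_const s c (.inr (hS s hs).ne')).continuousWithinAt

lemma norm_ofReal_cpow_mul_I {s : ℝ} (hs : 0 < s) (τ : ℝ) : ‖(s : ℂ) ^ (τ * I)‖ = 1 := by
  simp [norm_cpow_eq_rpow_re_of_pos hs]

lemma norm_ofReal_cpow_mul_I_sub_one {s : ℝ} (hs : 0 < s) (τ : ℝ) :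
    ‖(s : ℂ) ^ (τ * I - 1)‖ = s⁻¹ := by
  simp [norm_cpow_eq_rpow_re_of_pos hs, Real.rpow_neg_one]

lemma norm_cexp_I_mul_mul (l s : ℝ) : ‖exp (I * l * s)‖ = 1 := by
  rw [mul_assoc, ← ofReal_mul, norm_exp_I_mul_ofReal]

lemma hasDerivAt_cexp_I_mul_mul (l s : ℝ) :
    HasDerivAt (fun x : ℝ => exp (I * l * x)) (I * l * exp (I * l * s)) s := by
  simpa [mul_comm] using (((hasDerivAt_id (s : ℂ)).const_mul (I * l)).cexp).comp_ofReal

lemma norm_mul_integral_cpow_mul_cexp_le_add {a b : ℝ} (ha : 0 < a) (hab : a ≤ b) (τ l : ℝ) :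
    ‖(τ : ℂ) * ∫ s in a..b, (s : ℂ) ^ (τ * I - 1) * exp (I * l * s)‖ ≤ 2 + |l| * (b - a) := by
  have hpos : ∀ x ∈ Icc a b, 0 < x := fun x hx => ha.trans_le hx.1
  have hparts := norm_integral_mul_deriv_le (u := fun s : ℝ => exp (I * l * s))
    (v := fun s : ℝ => (s : ℂ) ^ (τ * I)) (g := fun s => |l| * s) (M := 1) hab
    (fun x _ => hasDerivAt_cexp_I_mul_mul l x)
    (fun x hx => hasDerivAt_ofReal_cpow_of_pos (hpos x hx) _)
    (fun x _ => (hasDerivAt_id x).const_mul |l|) (by fun_prop)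
    (continuousOn_const.mul (continuousOn_ofReal_cpow_of_pos hpos _)) continuousOn_const
    (fun x hx => (norm_ofReal_cpow_mul_I (hpos x hx) τ).le)
    (fun x _ => by simp [norm_cexp_I_mul_mul])
  have pull_out : ∫ s in a..b, exp (I * l * s) * (τ * I * (s : ℂ) ^ (τ * I - 1))
      = I * (τ * ∫ s in a..b, (s : ℂ) ^ (τ * I - 1) * exp (I * l * s)) := by
    rw [← mul_assoc, ← intervalIntegral.integral_const_mul]
    exact intervalIntegral.integral_congr fun s _ => by ring
  rw [pull_out, norm_mul, norm_I, one_mul, norm_cexp_I_mul_mul, norm_cexp_I_mul_mul] at hparts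
  linarith

lemma norm_integral_cpow_mul_cexp_le_div {a b : ℝ} (ha : 0 < a) (hab : a ≤ b) (τ : ℝ) {l : ℝ}
    (hl : l ≠ 0) :
    ‖∫ s in a..b, (s : ℂ) ^ (τ * I - 1) * exp (I * l * s)‖ ≤ (3 + |τ|) / (|l| * a) := by
  have hpos : ∀ x ∈ Icc a b, 0 < x := fun x hx => ha.trans_le hx.1
  have hIl : (I * l : ℂ) ≠ 0 := mul_ne_zero I_ne_zero (ofReal_ne_zero.2 hl)
  have hτ : ‖(τ * I - 1 : ℂ)‖ ≤ 1 + |τ| := (norm_sub_le _ _).trans (by simp [add_comm])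
  have hparts := norm_integral_mul_deriv_le (u := fun s : ℝ => (s : ℂ) ^ (τ * I - 1))
    (v := fun s : ℝ => exp (I * l * s) / (I * l)) (v' := fun s : ℝ => exp (I * l * s))
    (g := fun s => (1 + |τ|) * -s⁻¹) (M := |l|⁻¹) hab
    (fun x hx => hasDerivAt_ofReal_cpow_of_pos (hpos x hx) _)
    (fun x _ => by
      simpa only [mul_div_cancel_left₀ _ hIl] using
        (hasDerivAt_cexp_I_mul_mul l x).div_const (I * l))
    (fun x hx => ((hasDerivAt_inv (hpos x hx).ne').neg).const_mul (1 + |τ|))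
    (continuousOn_const.mul (continuousOn_ofReal_cpow_of_pos hpos _)) (by fun_prop)
    (continuousOn_const.mul ((continuousOn_inv₀.comp (continuousOn_pow 2) fun x hx =>
      pow_ne_zero 2 (hpos x hx).ne').neg.neg))
    (fun x _ => by simp [norm_cexp_I_mul_mul])
    (fun x hx => by
      have hnorm : ‖(x : ℂ) ^ (τ * I - 1 - 1)‖ = (x ^ 2)⁻¹ := by
        rw [norm_cpow_eq_rpow_re_of_pos (hpos x hx), ← Real.rpow_natCast,
          ← Real.rpow_neg (hpos x hx).le]
        norm_num
      rw [norm_mul, hnorm, neg_neg]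
      exact mul_le_mul_of_nonneg_right hτ (by positivity))
  have hb : 0 < b := ha.trans_le hab
  rw [norm_ofReal_cpow_mul_I_sub_one ha, norm_ofReal_cpow_mul_I_sub_one hb] at hparts
  calc _ ≤ |l|⁻¹ * (a⁻¹ + b⁻¹ + ((1 + |τ|) * -b⁻¹ - (1 + |τ|) * -a⁻¹)) := hparts
    _ ≤ |l|⁻¹ * ((3 + |τ|) * a⁻¹) := by
        have hba : b⁻¹ ≤ a⁻¹ := inv_anti₀ ha hab
        have : 0 ≤ (1 + |τ|) * b⁻¹ := by positivity
        gcongr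
        linarith
    _ = (3 + |τ|) / (|l| * a) := by field_simp

/- Uniformity in the frequency `l` comes from cutting the interval at `|l|⁻¹`: the phase is
essentially constant before the cut and oscillates after it. -/
lemma norm_mul_integral_cpow_mul_cexp_le (τ l : ℝ) {R : ℝ} (hR : 1 ≤ R) :
    ‖(τ : ℂ) * ∫ s in (1 : ℝ)..R, (s : ℂ) ^ (τ * I - 1) * exp (I * l * s)‖
      ≤ 3 + |τ| * (3 + |τ|) := by
  have hτ : 0 ≤ |τ| * (3 + |τ|) := by positivity
  rcases eq_or_ne l 0 with rfl | hl
  · refine (norm_mul_integral_cpow_mul_cexp_le_add one_pos hR τ 0).trans ?_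
    rw [abs_zero]
    linarith
  have hl0 : 0 < |l| := abs_pos.2 hl
  have hcut : |l| * |l|⁻¹ = 1 := mul_inv_cancel₀ hl0.ne'
  have oscillating : ∀ a, 0 < a → a ≤ R → 1 ≤ |l| * a →
      ‖(τ : ℂ) * ∫ s in a..R, (s : ℂ) ^ (τ * I - 1) * exp (I * l * s)‖ ≤ |τ| * (3 + |τ|) := by
    intro a ha haR hla
    rw [norm_mul, norm_real, Real.norm_eq_abs]
    gcongr
    exact (norm_integral_cpow_mul_cexp_le_div ha haR τ hl).trans
      (div_le_self (by positivity) hla)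
  rcases le_total R |l|⁻¹ with hRl | hlR
  · have : |l| * R ≤ 1 := hcut ▸ mul_le_mul_of_nonneg_left hRl hl0.le
    linarith [norm_mul_integral_cpow_mul_cexp_le_add one_pos hR τ l]
  rcases le_total |l|⁻¹ 1 with hl1 | hl1
  · have : 1 ≤ |l| * 1 := ((inv_le_one₀ hl0).1 hl1).trans_eq (mul_one _).symm
    linarith [oscillating 1 one_pos hR this]
  have hint : ∀ a b : ℝ, 0 < a → 0 < b →
      IntervalIntegrable (fun s : ℝ => (s : ℂ) ^ (τ * I - 1) * exp (I * l * s)) volume a b :=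
    fun a b ha hb => ((continuousOn_ofReal_cpow_of_pos
      (fun s hs => (lt_min ha hb).trans_le hs.1) _).mul (by fun_prop)).intervalIntegrable
  rw [← intervalIntegral.integral_add_adjacent_intervals (hint 1 |l|⁻¹ one_pos (by positivity))
    (hint |l|⁻¹ R (by positivity) (by positivity)), mul_add]
  refine (norm_add_le _ _).trans (add_le_add ?_ (oscillating _ (by positivity) hlR hcut.ge))
  refine (norm_mul_integral_cpow_mul_cexp_le_add one_pos hl1 τ l).trans ?_
  rw [mul_sub, hcut]
  linarith

/-- The phase `u² + c⁴ / u²`, whose critical point on the positive axis is `u = c`. The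
substitution `s = u²` turns the phase `s + c⁴ / s` of the Schrödinger kernel into it, with second
derivative bounded below uniformly in `c`. -/
noncomputable def saddlePhase (c u : ℝ) : ℝ := u ^ 2 + c ^ 4 / u ^ 2

/-- The derivative of `saddlePhase c`. -/
noncomputable def saddleSpeed (c u : ℝ) : ℝ := 2 * u - 2 * c ^ 4 / u ^ 3

lemma hasDerivAt_saddlePhase (c : ℝ) {u : ℝ} (hu : u ≠ 0) :
    HasDerivAt (saddlePhase c) (saddleSpeed c u) u := by
  refine ((hasDerivAt_pow 2 u).add ((hasDerivAt_const u (c ^ 4)).div (hasDerivAt_pow 2 u)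
    (pow_ne_zero 2 hu))).congr_deriv ?_
  rw [saddleSpeed]
  field_simp
  push_cast
  ring

lemma hasDerivAt_saddleSpeed (c : ℝ) {u : ℝ} (hu : u ≠ 0) :
    HasDerivAt (saddleSpeed c) (2 + 6 * c ^ 4 / u ^ 4) u := by
  refine (((hasDerivAt_id u).const_mul 2).sub ((hasDerivAt_const u (2 * c ^ 4)).div
    (hasDerivAt_pow 3 u) (pow_ne_zero 3 hu))).congr_deriv ?_
  field_simp
  push_cast
  ring

lemma two_mul_abs_sub_le_abs_saddleSpeed {c u : ℝ} (hc : 0 ≤ c) (hu : 0 < u) :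
    2 * |u - c| ≤ |saddleSpeed c u| := by
  have factor : saddleSpeed c u = 2 * (u - c) * ((u + c) * (u ^ 2 + c ^ 2) / u ^ 3) := by
    rw [saddleSpeed]
    field_simp
    ring
  rw [factor, abs_mul, abs_mul, abs_two]
  refine le_mul_of_one_le_right (by positivity) ?_
  rw [abs_of_nonneg (by positivity), one_le_div₀ (by positivity)]
  have : 0 ≤ u * c ^ 2 + c * u ^ 2 + c ^ 3 := by positivity
  linarith [show (u + c) * (u ^ 2 + c ^ 2) = u ^ 3 + (u * c ^ 2 + c * u ^ 2 + c ^ 3) by ring]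

lemma continuousOn_saddlePhase (c : ℝ) {S : Set ℝ} (hS : ∀ u ∈ S, 0 < u) :
    ContinuousOn (saddlePhase c) S := fun u hu =>
  (hasDerivAt_saddlePhase c (hS u hu).ne').continuousAt.continuousWithinAt

lemma continuousOn_saddleSpeed (c : ℝ) {S : Set ℝ} (hS : ∀ u ∈ S, 0 < u) :
    ContinuousOn (saddleSpeed c) S := fun u hu =>
  (hasDerivAt_saddleSpeed c (hS u hu).ne').continuousAt.continuousWithinAt

/- The cross term `|τ| / (u |φ'(u)|)` is split by AM-GM, so that each summand has an explicit
primitive. -/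
lemma norm_deriv_cpow_div_saddleSpeed_le {c u : ℝ} (hc : 0 ≤ c) (hu : 0 < u) (huc : u ≠ c)
    (τ : ℝ) :
    ‖(τ * I * (u : ℂ) ^ (τ * I - 1) * saddleSpeed c u -
        (u : ℂ) ^ (τ * I) * (2 + 6 * c ^ 4 / u ^ 4 : ℝ)) / (saddleSpeed c u : ℂ) ^ 2‖ ≤
      |τ| / 4 * ((u ^ 2)⁻¹ + ((u - c) ^ 2)⁻¹) + (2 + 6 * c ^ 4 / u ^ 4) / saddleSpeed c u ^ 2 := by
  have hdist : 0 < |u - c| := abs_pos.2 (sub_ne_zero.2 huc)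
  have hspeed := two_mul_abs_sub_le_abs_saddleSpeed hc hu
  have hD : 0 < |saddleSpeed c u| := by linarith
  have hinv : |saddleSpeed c u|⁻¹ ≤ |u - c|⁻¹ / 2 := by
    rw [div_eq_inv_mul, ← mul_inv]
    exact inv_anti₀ (by positivity) hspeed
  have am_gm : u⁻¹ * (|u - c|⁻¹ / 2) ≤ ((u ^ 2)⁻¹ + ((u - c) ^ 2)⁻¹) / 4 := by
    rw [← sq_abs (u - c), ← inv_pow, ← inv_pow]
    linarith [two_mul_le_add_sq u⁻¹ |u - c|⁻¹]
  have numerator : ‖τ * I * (u : ℂ) ^ (τ * I - 1) * saddleSpeed c u -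
      (u : ℂ) ^ (τ * I) * (2 + 6 * c ^ 4 / u ^ 4 : ℝ)‖ ≤
      |τ| * u⁻¹ * |saddleSpeed c u| + (2 + 6 * c ^ 4 / u ^ 4) := by
    refine (norm_sub_le _ _).trans_eq ?_
    rw [norm_mul, norm_mul, norm_mul, norm_mul, norm_ofReal_cpow_mul_I hu,
      norm_ofReal_cpow_mul_I_sub_one hu, norm_I, norm_real, norm_real, norm_real,
      Real.norm_eq_abs, Real.norm_eq_abs, Real.norm_of_nonneg (by positivity), mul_one, one_mul]
  rw [norm_div, norm_pow, norm_real, Real.norm_eq_abs, sq_abs]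
  calc _ ≤ (|τ| * u⁻¹ * |saddleSpeed c u| + (2 + 6 * c ^ 4 / u ^ 4)) / saddleSpeed c u ^ 2 := by
        gcongr
    _ = |τ| * (u⁻¹ * |saddleSpeed c u|⁻¹) + (2 + 6 * c ^ 4 / u ^ 4) / saddleSpeed c u ^ 2 := by
        rw [add_div, ← sq_abs (saddleSpeed c u)]
        congr 1
        field_simp
    _ ≤ |τ| * (((u ^ 2)⁻¹ + ((u - c) ^ 2)⁻¹) / 4) +
          (2 + 6 * c ^ 4 / u ^ 4) / saddleSpeed c u ^ 2 := by
        gcongr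
        exact (mul_le_mul_of_nonneg_left hinv (by positivity)).trans am_gm
    _ = _ := by ring

lemma saddleSpeed_ne_zero {c u : ℝ} (hc : 0 ≤ c) (hu : 0 < u) (huc : u ≠ c) :
    saddleSpeed c u ≠ 0 :=
  abs_pos.1 <| (mul_pos two_pos (abs_pos.2 (sub_ne_zero.2 huc))).trans_le
    (two_mul_abs_sub_le_abs_saddleSpeed hc hu)

lemma hasDerivAt_mul_neg_inv_add_neg_inv_saddleSpeed {c u : ℝ} (hc : 0 ≤ c) (hu : 0 < u)
    (huc : u ≠ c) (t : ℝ) :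
    HasDerivAt (fun x => t * (-x⁻¹ + -(x - c)⁻¹) + -(saddleSpeed c x)⁻¹)
      (t * ((u ^ 2)⁻¹ + ((u - c) ^ 2)⁻¹) + (2 + 6 * c ^ 4 / u ^ 4) / saddleSpeed c u ^ 2) u :=
  ((((hasDerivAt_inv hu.ne').neg.add
    (((hasDerivAt_id u).sub_const c).inv (sub_ne_zero.2 huc)).neg).const_mul t).add
    ((hasDerivAt_saddleSpeed c hu.ne').inv (saddleSpeed_ne_zero hc hu huc)).neg).congr_deriv
    (by simp only [id, neg_neg, neg_div, one_div])

lemma integral_cpow_div_saddleSpeed_mul_deriv_cexp {a b c : ℝ} (τ : ℝ)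
    (hspeed : ∀ x ∈ uIcc a b, saddleSpeed c x ≠ 0) :
    ∫ x in a..b, (x : ℂ) ^ (τ * I) / saddleSpeed c x *
        (exp (I * saddlePhase c x) * (I * saddleSpeed c x)) =
      I * ∫ u in a..b, (u : ℂ) ^ (τ * I) * exp (I * saddlePhase c u) := by
  rw [← intervalIntegral.integral_const_mul]
  refine intervalIntegral.integral_congr fun x hx => ?_
  have := ofReal_ne_zero.2 (hspeed x hx)
  field_simp

lemma norm_integral_cpow_mul_cexp_saddlePhase_le {a b c : ℝ} (hc : 0 ≤ c) (ha : 0 < a)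
    (hab : a ≤ b) (hcrit : ∀ x ∈ Icc a b, x ≠ c) (τ : ℝ) :
    ‖∫ u in a..b, (u : ℂ) ^ (τ * I) * exp (I * saddlePhase c u)‖ ≤
      |saddleSpeed c a|⁻¹ + |saddleSpeed c b|⁻¹ +
        (|τ| / 4 * (a⁻¹ - b⁻¹ + ((a - c)⁻¹ - (b - c)⁻¹)) +
          ((saddleSpeed c a)⁻¹ - (saddleSpeed c b)⁻¹)) := by
  have hpos : ∀ x ∈ Icc a b, 0 < x := fun x hx => ha.trans_le hx.1
  have hne : ∀ x ∈ Icc a b, x - c ≠ 0 := fun x hx => sub_ne_zero.2 (hcrit x hx)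
  have hspeed : ∀ x ∈ Icc a b, saddleSpeed c x ≠ 0 := fun x hx =>
    saddleSpeed_ne_zero hc (hpos x hx) (hcrit x hx)
  have hphasec := continuous_ofReal.comp_continuousOn (continuousOn_saddlePhase c hpos)
  have hspeedc := continuous_ofReal.comp_continuousOn (continuousOn_saddleSpeed c hpos)
  have haccelc : ContinuousOn (fun x : ℝ => 2 + 6 * c ^ 4 / x ^ 4) (Icc a b) :=
    continuousOn_const.add (continuousOn_const.div (continuousOn_pow 4) fun x hx =>
      pow_ne_zero 4 (hpos x hx).ne')
  have hparts := norm_integral_mul_deriv_le (M := 1)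
    (u := fun x : ℝ => (x : ℂ) ^ (τ * I) / saddleSpeed c x)
    (v := fun x : ℝ => exp (I * saddlePhase c x))
    (g := fun x => |τ| / 4 * (-x⁻¹ + -(x - c)⁻¹) + -(saddleSpeed c x)⁻¹)
    (g' := fun x => |τ| / 4 * ((x ^ 2)⁻¹ + ((x - c) ^ 2)⁻¹) +
      (2 + 6 * c ^ 4 / x ^ 4) / saddleSpeed c x ^ 2) hab
    (fun x hx => (hasDerivAt_ofReal_cpow_of_pos (hpos x hx) _).div
      (hasDerivAt_saddleSpeed c (hpos x hx).ne').ofReal_comp (ofReal_ne_zero.2 (hspeed x hx)))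
    (fun x hx => ((hasDerivAt_saddlePhase c (hpos x hx).ne').ofReal_comp.const_mul I).cexp)
    (fun x hx => hasDerivAt_mul_neg_inv_add_neg_inv_saddleSpeed hc (hpos x hx) (hcrit x hx) _)
    ((((continuousOn_const.mul (continuousOn_ofReal_cpow_of_pos hpos _)).mul hspeedc).sub
      ((continuousOn_ofReal_cpow_of_pos hpos _).mul
        (continuous_ofReal.comp_continuousOn haccelc))).div (hspeedc.pow 2) fun x hx =>
      pow_ne_zero 2 (ofReal_ne_zero.2 (hspeed x hx)))
    ((continuousOn_const.mul hphasec).cexp.mul (continuousOn_const.mul hspeedc))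
    ((continuousOn_const.mul (((continuousOn_pow 2).inv₀ fun x hx =>
      pow_ne_zero 2 (hpos x hx).ne').add (((continuousOn_id.sub continuousOn_const).pow 2).inv₀
      fun x hx => pow_ne_zero 2 (hne x hx)))).add
      (haccelc.div ((continuousOn_saddleSpeed c hpos).pow 2) fun x hx =>
        pow_ne_zero 2 (hspeed x hx)))
    (fun x _ => (norm_exp_I_mul_ofReal _).le)
    (fun x hx => norm_deriv_cpow_div_saddleSpeed_le hc (hpos x hx) (hcrit x hx) τ)
  have pull_out := integral_cpow_div_saddleSpeed_mul_deriv_cexp τ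
    (by rwa [uIcc_of_le hab] : ∀ x ∈ uIcc a b, saddleSpeed c x ≠ 0)
  simp only [pull_out, norm_mul, norm_I, one_mul, norm_div, norm_real, Real.norm_eq_abs,
    norm_ofReal_cpow_mul_I ha, norm_ofReal_cpow_mul_I (ha.trans_le hab), one_div] at hparts
  linarith

lemma norm_integral_cpow_mul_cexp_saddlePhase_le_of_far {a b c : ℝ} (hc : 0 ≤ c) (ha : 1 ≤ a)
    (hab : a ≤ b) (hfar : ∀ x ∈ Icc a b, 1 ≤ |x - c|) (τ : ℝ) :
    ‖∫ u in a..b, (u : ℂ) ^ (τ * I) * exp (I * saddlePhase c u)‖ ≤ 2 + |τ| := by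
  have ha0 : 0 < a := one_pos.trans_le ha
  have hspeed : ∀ x ∈ Icc a b, |saddleSpeed c x|⁻¹ ≤ 1 / 2 := fun x hx => by
    rw [one_div]
    refine inv_anti₀ two_pos ?_
    linarith [hfar x hx, two_mul_abs_sub_le_abs_saddleSpeed hc (ha0.trans_le hx.1)]
  have hdist : ∀ x ∈ Icc a b, |(x - c)⁻¹| ≤ 1 := fun x hx =>
    (abs_inv _).trans_le (inv_le_one_of_one_le₀ (hfar x hx))
  have haI : a ∈ Icc a b := left_mem_Icc.2 hab
  have hbI : b ∈ Icc a b := right_mem_Icc.2 hab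
  have variation : a⁻¹ - b⁻¹ + ((a - c)⁻¹ - (b - c)⁻¹) ≤ 4 := by
    have : a⁻¹ ≤ 1 := inv_le_one_of_one_le₀ ha
    have : 0 ≤ b⁻¹ := inv_nonneg.2 (ha0.trans_le hab).le
    linarith [le_of_abs_le (hdist a haI), neg_le_of_abs_le (hdist b hbI)]
  have hτ := mul_le_mul_of_nonneg_left variation (show 0 ≤ |τ| / 4 by positivity)
  have hsa := hspeed a haI
  have hsb := hspeed b hbI
  have hsa' := le_of_abs_le ((abs_inv (saddleSpeed c a)).trans_le hsa)
  have hsb' := neg_le_of_abs_le ((abs_inv (saddleSpeed c b)).trans_le hsb)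
  have hne : ∀ x ∈ Icc a b, x ≠ c := fun x hx =>
    sub_ne_zero.1 (abs_pos.1 (one_pos.trans_le (hfar x hx)))
  linarith [norm_integral_cpow_mul_cexp_saddlePhase_le hc ha0 hab hne τ]

lemma intervalIntegrable_cpow_mul_cexp_saddlePhase (c τ : ℝ) {a b : ℝ} (ha : 0 < a) (hb : 0 < b) :
    IntervalIntegrable (fun u : ℝ => (u : ℂ) ^ (τ * I) * exp (I * saddlePhase c u))
      volume a b := by
  have hpos : ∀ u ∈ uIcc a b, 0 < u := fun u hu => (lt_min ha hb).trans_le hu.1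
  exact ((continuousOn_ofReal_cpow_of_pos hpos _).mul
    (continuousOn_const.mul (continuous_ofReal.comp_continuousOn
      (continuousOn_saddlePhase c hpos))).cexp).intervalIntegrable

/- The unit neighbourhood of the critical point `c` is removed; on it the integrand is bounded. -/
lemma norm_integral_one_cpow_mul_cexp_saddlePhase_le {c R : ℝ} (hc : 0 ≤ c) (hR : 1 ≤ R) (τ : ℝ) :
    ‖∫ u in (1 : ℝ)..R, (u : ℂ) ^ (τ * I) * exp (I * saddlePhase c u)‖ ≤ 6 + 2 * |τ| := by
  set A := max 1 (min R (c - 1))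
  set B := max 1 (min R (c + 1))
  have h1A : 1 ≤ A := le_max_left _ _
  have hAB : A ≤ B := max_le_max le_rfl (min_le_min le_rfl (by linarith))
  have hBR : B ≤ R := max_le hR (min_le_left _ _)
  have hBA : B - A ≤ 2 := by
    simp only [A, B, max_def, min_def]
    split_ifs <;> linarith
  have hA0 : 0 < A := one_pos.trans_le h1A
  have hB0 : 0 < B := hA0.trans_le hAB
  have hint := fun a b (ha : 0 < a) (hb : 0 < b) =>
    intervalIntegrable_cpow_mul_cexp_saddlePhase c τ ha hb
  have before : ‖∫ u in (1 : ℝ)..A, (u : ℂ) ^ (τ * I) * exp (I * saddlePhase c u)‖ ≤ 2 + |τ| := by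
    rcases h1A.eq_or_lt with h | h
    · rw [← h, intervalIntegral.integral_same, norm_zero]
      positivity
    · have hAc : A ≤ c - 1 := by
        rcases max_cases 1 (min R (c - 1)) with h' | h'
        · exact absurd h'.1 h.ne'
        · exact h'.1.trans_le (min_le_right _ _)
      refine norm_integral_cpow_mul_cexp_saddlePhase_le_of_far hc le_rfl h1A (fun x hx => ?_) τ
      exact le_abs.2 (.inr (by linarith [hx.2]))
  have after : ‖∫ u in B..R, (u : ℂ) ^ (τ * I) * exp (I * saddlePhase c u)‖ ≤ 2 + |τ| := by
    rcases hBR.eq_or_lt with h | h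
    · rw [h, intervalIntegral.integral_same, norm_zero]
      positivity
    · have hcB : c + 1 ≤ B := by
        rcases le_total R (c + 1) with h' | h'
        · exact absurd ((le_min le_rfl h').trans (le_max_right 1 _)) h.not_ge
        · exact (le_min h' le_rfl).trans (le_max_right 1 _)
      refine norm_integral_cpow_mul_cexp_saddlePhase_le_of_far hc (h1A.trans hAB) hBR
        (fun x hx => ?_) τ
      exact le_abs.2 (.inl (by linarith [hx.1]))
  have near : ‖∫ u in A..B, (u : ℂ) ^ (τ * I) * exp (I * saddlePhase c u)‖ ≤ 2 := by
    refine (intervalIntegral.norm_integral_le_of_norm_le_const (C := 1) fun x hx => ?_).trans ?_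
    · rw [uIoc_of_le hAB] at hx
      rw [norm_mul, norm_ofReal_cpow_mul_I (hA0.trans hx.1), norm_exp_I_mul_ofReal, one_mul]
    · rwa [abs_of_nonneg (sub_nonneg.2 hAB), one_mul]
  rw [← intervalIntegral.integral_add_adjacent_intervals (hint 1 B one_pos hB0)
      (hint B R hB0 (hB0.trans_le hBR)),
    ← intervalIntegral.integral_add_adjacent_intervals (hint 1 A one_pos hA0) (hint A B hA0 hB0)]
  refine (norm_add₃_le).trans ?_
  linarith

lemma ofReal_sq_cpow_neg_half_add_mul_I {x : ℝ} (hx : 0 < x) (τ : ℝ) :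
    ((x ^ 2 : ℝ) : ℂ) ^ ((-1 / 2 : ℝ) + τ * I) = (x : ℂ)⁻¹ * (x : ℂ) ^ ((2 * τ : ℝ) * I) := by
  have hx0 : (x : ℂ) ≠ 0 := ofReal_ne_zero.2 hx.ne'
  rw [← cpow_neg_one, ← cpow_add _ _ hx0, sq, ofReal_mul,
    mul_cpow_ofReal_nonneg hx.le hx.le, ← cpow_add _ _ hx0]
  congr 1
  push_cast
  ring

lemma norm_integral_cpow_mul_cexp_add_sq_div_le (τ : ℝ) {ρ R : ℝ} (hρ : 0 ≤ ρ) (hR : 1 ≤ R) :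
    ‖∫ s in (1 : ℝ)..R, (s : ℂ) ^ ((-1 / 2 : ℝ) + τ * I) * exp (I * (s + ρ ^ 2 / s : ℝ))‖
      ≤ 12 + 8 * |τ| := by
  have hsR : 1 ≤ √R := Real.one_le_sqrt.2 hR
  have hpos : ∀ x ∈ uIcc 1 √R, 0 < x := fun x hx =>
    one_pos.trans_le (uIcc_of_le hsR ▸ hx).1
  have hpos_sq : ∀ s ∈ (fun u : ℝ => u ^ 2) '' uIcc 1 √R, 0 < s := by
    rintro _ ⟨x, hx, rfl⟩
    exact pow_pos (hpos x hx) 2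
  have hphase : ContinuousOn (fun s : ℝ => exp (I * (s + ρ ^ 2 / s : ℝ)))
      ((fun u : ℝ => u ^ 2) '' uIcc 1 √R) :=
    (continuousOn_const.mul (continuous_ofReal.comp_continuousOn (continuousOn_id.add
      (continuousOn_const.div continuousOn_id fun x hx => (hpos_sq x hx).ne')))).cexp
  have hsubst := intervalIntegral.integral_deriv_smul_comp'' (a := 1) (b := √R)
    (f := fun u : ℝ => u ^ 2) (f' := fun u : ℝ => 2 * u)
    (g := fun s : ℝ => (s : ℂ) ^ ((-1 / 2 : ℝ) + τ * I) * exp (I * (s + ρ ^ 2 / s : ℝ)))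
    (by fun_prop) (fun x _ => by simpa using (hasDerivAt_pow 2 x).hasDerivWithinAt) (by fun_prop)
    ((continuousOn_ofReal_cpow_of_pos hpos_sq _).mul hphase)
  simp only [one_pow, Real.sq_sqrt (zero_le_one.trans hR)] at hsubst
  have integrand : ∀ x ∈ uIcc 1 √R,
      (2 * x) • ((fun s : ℝ => (s : ℂ) ^ ((-1 / 2 : ℝ) + τ * I) *
        exp (I * (s + ρ ^ 2 / s : ℝ))) ∘ fun u : ℝ => u ^ 2) x =
      2 * ((x : ℂ) ^ ((2 * τ : ℝ) * I) * exp (I * saddlePhase √ρ x)) := fun x hx => by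
    have hx0 : (x : ℂ) ≠ 0 := ofReal_ne_zero.2 (hpos x hx).ne'
    have hρ4 : √ρ ^ 4 = ρ ^ 2 := by rw [show 4 = 2 * 2 from rfl, pow_mul, Real.sq_sqrt hρ]
    simp only [Function.comp, ofReal_sq_cpow_neg_half_add_mul_I (hpos x hx), saddlePhase, hρ4,
      real_smul]
    push_cast
    field_simp
  rw [← hsubst, intervalIntegral.integral_congr integrand, intervalIntegral.integral_const_mul,
    norm_mul, norm_ofNat]
  have hsaddle := norm_integral_one_cpow_mul_cexp_saddlePhase_le (Real.sqrt_nonneg ρ) hsR (2 * τ)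
  rw [abs_mul, abs_two] at hsaddle
  linarith

end OscillatoryIntegrals

section FourierL2

open Complex
open scoped Real ComplexConjugate

variable {V : Type*} [NormedAddCommGroup V] [InnerProductSpace ℝ V] [FiniteDimensional ℝ V]
  [MeasurableSpace V] [BorelSpace V]

lemma continuous_fourier_of_integrable {f : V → ℂ} (hf : Integrable f) : Continuous (𝓕 f) :=
  VectorFourier.fourierIntegral_continuous Real.continuous_fourierChar
    (by exact continuous_inner) hf

lemma norm_fourier_le_integral_norm (f : V → ℂ) (v : V) : ‖𝓕 f v‖ ≤ ∫ x, ‖f x‖ :=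
  VectorFourier.norm_fourierIntegral_le_integral_norm _ _ _ _ _

lemma integral_fourier_mul_eq {f g : V → ℂ} (hf : Integrable f) (hg : Integrable g) :
    ∫ v, 𝓕 f v * g v = ∫ x, f x * 𝓕 g x := by
  simpa using! VectorFourier.integral_bilin_fourierIntegral_eq_flip (ContinuousLinearMap.mul ℂ ℂ)
    (L := innerₗ V) Real.continuous_fourierChar continuous_inner hf hg

lemma fourier_ae_eq_fourier_toLp {f : V → ℂ} (hf : Integrable f) (hf2 : MemLp f 2) :
    𝓕 f =ᵐ[volume] (𝓕 (hf2.toLp f) : Lp ℂ 2 (volume : Measure V)) := by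
  refine ae_eq_of_integral_contDiff_smul_eq
    (continuous_fourier_of_integrable hf).locallyIntegrable
    ((Lp.memLp _).locallyIntegrable (by norm_num)) fun g hg hgc => ?_
  let φ : SchwartzMap V ℂ := (hgc.comp_left (g := ((↑) : ℝ → ℂ)) rfl).toSchwartzMap
    (ofRealCLM.contDiff.comp hg)
  have hφ : ∀ x, φ x = (g x : ℂ) := fun _ => rfl
  have distributional := congrArg (fun T => T φ) (Lp.fourier_toTemperedDistribution_eq (hf2.toLp f))
  simp only [TemperedDistribution.fourier_apply, Lp.toTemperedDistribution_apply, hφ,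
    smul_eq_mul] at distributional
  simp only [real_smul]
  calc ∫ x, (g x : ℂ) * 𝓕 f x = ∫ v, 𝓕 f v * φ v := by simp only [hφ, mul_comm]
    _ = ∫ x, f x * 𝓕 (φ : V → ℂ) x := integral_fourier_mul_eq hf φ.integrable
    _ = ∫ x, (𝓕 φ) x * hf2.toLp f x := by
      refine integral_congr_ae ?_
      filter_upwards [hf2.coeFn_toLp] with x hx
      rw [hx, mul_comm]
      rfl
    _ = _ := distributional

lemma memLp_fourier {f : V → ℂ} (hf : Integrable f) (hf2 : MemLp f 2) : MemLp (𝓕 f) 2 :=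
  (memLp_congr_ae (fourier_ae_eq_fourier_toLp hf hf2)).2 (Lp.memLp _)

lemma toLp_fourier_eq {f : V → ℂ} (hf : Integrable f) (hf2 : MemLp f 2) :
    (memLp_fourier hf hf2).toLp (𝓕 f) = 𝓕 (hf2.toLp f) :=
  Lp.ext ((MemLp.coeFn_toLp _).trans (fourier_ae_eq_fourier_toLp hf hf2))

lemma integral_norm_sq_eq_norm_toLp_sq {X : Type*} [MeasurableSpace X] {μ : Measure X}
    {f : X → ℂ} (hf : MemLp f 2 μ) : ∫ x, ‖f x‖ ^ 2 ∂μ = ‖hf.toLp f‖ ^ 2 := by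
  have inner_self : ((‖hf.toLp f‖ : ℝ) : ℂ) ^ 2 = inner ℂ (hf.toLp f) (hf.toLp f) :=
    (inner_self_eq_norm_sq_to_K (𝕜 := ℂ) (hf.toLp f)).symm
  rw [← ofReal_inj, ofReal_pow, inner_self, L2.inner_def, ← integral_complex_ofReal]
  refine integral_congr_ae ?_
  filter_upwards [hf.coeFn_toLp] with x hx
  rw [hx, inner_self_eq_norm_sq_to_K]
  simp

lemma integral_norm_sq_fourier {f : V → ℂ} (hf : Integrable f) (hf2 : MemLp f 2) :
    ∫ v, ‖𝓕 f v‖ ^ 2 = ∫ x, ‖f x‖ ^ 2 := by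
  rw [integral_norm_sq_eq_norm_toLp_sq (memLp_fourier hf hf2), toLp_fourier_eq hf hf2,
    Lp.norm_fourier_eq, integral_norm_sq_eq_norm_toLp_sq hf2]

lemma integrable_fourier_mul_conj {f g : V → ℂ} (hf : Integrable f) (hf2 : MemLp f 2)
    (hg : Integrable g) (hg2 : MemLp g 2) : Integrable fun v => 𝓕 f v * conj (𝓕 g v) :=
  (memLp_fourier hf hf2).integrable_mul (memLp_fourier hg hg2).star

lemma integral_norm_fourier_mul_conj_le {f g : V → ℂ} (hf : Integrable f) (hf2 : MemLp f 2)
    (hg : Integrable g) (hg2 : MemLp g 2) :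
    ∫ v, ‖𝓕 f v * conj (𝓕 g v)‖ ≤ ((∫ x, ‖f x‖ ^ 2) + ∫ x, ‖g x‖ ^ 2) / 2 := by
  have hf_sq := (memLp_fourier hf hf2).integrable_norm_pow two_ne_zero
  have hg_sq := (memLp_fourier hg hg2).integrable_norm_pow two_ne_zero
  rw [← integral_norm_sq_fourier hf hf2, ← integral_norm_sq_fourier hg hg2,
    ← integral_add hf_sq hg_sq, ← integral_div]
  refine integral_mono (integrable_fourier_mul_conj hf hf2 hg hg2).norm
    ((hf_sq.add hg_sq).div_const 2) fun v => ?_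
  simp only [norm_mul, RCLike.norm_conj]
  linarith [two_mul_le_add_sq ‖𝓕 f v‖ ‖𝓕 g v‖]

end FourierL2

section GaussianPairing

open Complex
open scoped Real ComplexConjugate

lemma integrable_mul_conj_prod {X Y : Type*} [MeasurableSpace X] [MeasurableSpace Y]
    {μ : Measure X} {ν : Measure Y} [SFinite μ] [SFinite ν] {f : X → ℂ} {g : Y → ℂ}
    (hf : Integrable f μ) (hg : Integrable g ν) :
    Integrable (fun q : X × Y => f q.1 * conj (g q.2)) (μ.prod ν) :=
  hf.mul_prod ((LinearIsometryEquiv.integrable_comp_iff (conjLIE : ℂ ≃ₗᵢ[ℝ] ℂ)).2 hg)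

lemma norm_cexp_neg_mul_sq_le_one {b : ℂ} (hb : 0 ≤ b.re) (r : ℝ) :
    ‖exp (-b * r ^ 2)‖ ≤ 1 := by
  rw [norm_exp, Real.exp_le_one_iff, ← ofReal_pow, re_mul_ofReal, neg_re]
  exact mul_nonpos_of_nonpos_of_nonneg (neg_nonpos.2 hb) (sq_nonneg r)

lemma norm_cexp_neg_pi_sq_mul_sq_div_le_one {b : ℂ} (hb : 0 ≤ b.re) (r : ℝ) :
    ‖exp (-π ^ 2 * r ^ 2 / b)‖ ≤ 1 := by
  have hb' : 0 ≤ b⁻¹.re := inv_re b ▸ div_nonneg hb (normSq_nonneg b)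
  convert norm_cexp_neg_mul_sq_le_one hb' (π * r) using 3
  push_cast
  ring

variable {V : Type*} [NormedAddCommGroup V] [InnerProductSpace ℝ V] [FiniteDimensional ℝ V]
  [MeasurableSpace V] [BorelSpace V]

lemma integral_fourier_mul_cexp_gaussian {f : V → ℂ} (hf : Integrable f) {b : ℂ} (hb : 0 < b.re)
    (x : V) :
    ∫ v, 𝓕 f v * exp (-b * ‖v‖ ^ 2 + 2 * π * I * (inner ℝ x v : ℝ)) =
      (π / b) ^ (Module.finrank ℝ V / 2 : ℂ) * ∫ y, f y * exp (-π ^ 2 * ‖x - y‖ ^ 2 / b) := by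
  rw [integral_fourier_mul_eq hf (GaussianFourier.integrable_cexp_neg_mul_sq_norm_add hb _ x)]
  simp only [fourier_gaussian_innerProductSpace' hb]
  rw [← integral_const_mul]
  exact integral_congr_ae (.of_forall fun y => mul_left_comm _ _ _)

lemma integral_fourier_mul_conj_gaussian {f g : V → ℂ} (hf : Integrable f) (hg : Integrable g)
    {b : ℂ} (hb : 0 < b.re) :
    ∫ v, 𝓕 f v * conj (𝓕 g v) * exp (-b * ‖v‖ ^ 2) =
      (π / b) ^ (Module.finrank ℝ V / 2 : ℂ) *
        ∫ q : V × V, f q.1 * conj (g q.2) * exp (-π ^ 2 * ‖q.2 - q.1‖ ^ 2 / b) := by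
  have hgauss : Integrable fun v : V => 𝓕 f v * exp (-b * ‖v‖ ^ 2) := by
    refine Integrable.bdd_mul ?_ (continuous_fourier_of_integrable hf).aestronglyMeasurable
      (.of_forall (norm_fourier_le_integral_norm f))
    simpa using GaussianFourier.integrable_cexp_neg_mul_sq_norm_add hb 0 (0 : V)
  have inverse_fourier : ∀ x : V,
      VectorFourier.fourierIntegral Real.fourierChar volume (-(innerₗ V).flip)
        (fun v => 𝓕 f v * exp (-b * ‖v‖ ^ 2)) x = (π / b) ^ (Module.finrank ℝ V / 2 : ℂ) *
          ∫ y, f y * exp (-π ^ 2 * ‖x - y‖ ^ 2 / b) := fun x => by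
    rw [VectorFourier.fourierIntegral, ← integral_fourier_mul_cexp_gaussian hf hb]
    refine integral_congr_ae (.of_forall fun v => ?_)
    simp only [LinearMap.neg_apply, LinearMap.flip_apply, innerₗ_apply_apply, neg_neg,
      Circle.smul_def, Real.fourierChar_apply, smul_eq_mul, exp_add]
    push_cast
    ring_nf
  have parseval := VectorFourier.integral_sesq_fourierIntegral_eq_neg_flip (innerSL ℂ (E := ℂ))
    (L := innerₗ V) Real.continuous_fourierChar continuous_inner hg hgauss
  simp only [inverse_fourier, innerSL_apply_apply, RCLike.inner_apply] at parseval
  have hkernel : Integrable (fun q : V × V => f q.1 * conj (g q.2) *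
      exp (-π ^ 2 * ‖q.2 - q.1‖ ^ 2 / b)) (volume.prod volume) :=
    (integrable_mul_conj_prod hf hg).mul_bdd (c := 1) (by fun_prop)
      (.of_forall fun q => norm_cexp_neg_pi_sq_mul_sq_div_le_one hb.le _)
  calc _ = ∫ v, 𝓕 f v * exp (-b * ‖v‖ ^ 2) * conj (𝓕 g v) := by
        simp only [mul_right_comm]
    _ = _ := parseval
    _ = _ := by
      rw [Measure.volume_eq_prod, integral_prod_symm _ hkernel, ← integral_const_mul]
      refine integral_congr_ae (.of_forall fun x => ?_)
      simp only
      rw [mul_assoc, ← integral_mul_const]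
      simp only [mul_right_comm]

lemma div_mem_slitPlane_of_re_nonneg {r : ℝ} (hr : 0 < r) {b : ℂ} (hb : 0 ≤ b.re) (hb0 : b ≠ 0) :
    (r / b : ℂ) ∈ slitPlane := by
  rw [mem_slitPlane_iff, div_re, div_im]
  have hsq := normSq_pos.2 hb0
  rcases hb.lt_or_eq with h | h
  · left
    simp only [ofReal_re, ofReal_im, zero_mul, zero_div, add_zero]
    positivity
  · right
    have him : b.im ≠ 0 := fun h' => hb0 (ext h.symm h')
    simp [hr.ne', him, hb0]

/- The boundary case `0 = b.re` is reached from `b + η`, `η ↓ 0`; this turns the heat kernel into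
the Schrödinger kernel. -/
lemma integral_fourier_mul_conj_gaussian_of_re_nonneg {f g : V → ℂ} (hf : Integrable f)
    (hf2 : MemLp f 2) (hg : Integrable g) (hg2 : MemLp g 2) {b : ℂ} (hb : 0 ≤ b.re) (hb0 : b ≠ 0) :
    ∫ v, 𝓕 f v * conj (𝓕 g v) * exp (-b * ‖v‖ ^ 2) =
      (π / b) ^ (Module.finrank ℝ V / 2 : ℂ) *
        ∫ q : V × V, f q.1 * conj (g q.2) * exp (-π ^ 2 * ‖q.2 - q.1‖ ^ 2 / b) := by
  have hfg := integrable_fourier_mul_conj hf hf2 hg hg2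
  have hfg' := integrable_mul_conj_prod hf hg
  have hshift : Tendsto (fun η : ℝ => b + η) (𝓝[>] 0) (𝓝 b) := by
    have : Continuous fun η : ℝ => b + η := by fun_prop
    simpa using (this.tendsto 0).mono_left nhdsWithin_le_nhds
  have hre : ∀ η ∈ Set.Ioi (0 : ℝ), 0 < (b + η).re := fun η hη => by
    simpa using add_pos_of_nonneg_of_pos hb hη
  have hdiv : ∀ c : ℂ, Tendsto (fun η : ℝ => c / (b + η)) (𝓝[>] 0) (𝓝 (c / b)) := fun c =>
    tendsto_const_nhds.div hshift hb0
  have frequency_side : Tendsto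
      (fun η : ℝ => ∫ v, 𝓕 f v * conj (𝓕 g v) * exp (-(b + η) * ‖v‖ ^ 2)) (𝓝[>] 0)
      (𝓝 (∫ v, 𝓕 f v * conj (𝓕 g v) * exp (-b * ‖v‖ ^ 2))) := by
    refine tendsto_integral_filter_of_dominated_convergence
      (fun v => ‖𝓕 f v * conj (𝓕 g v)‖)
      (.of_forall fun η => hfg.aestronglyMeasurable.mul (by fun_prop)) ?_ hfg.norm
      (.of_forall fun v => ((hshift.neg.mul_const _).cexp).const_mul _)
    filter_upwards [self_mem_nhdsWithin] with η hη
    refine .of_forall fun v => ?_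
    rw [norm_mul _ (exp _)]
    exact mul_le_of_le_one_right (norm_nonneg _) (norm_cexp_neg_mul_sq_le_one (hre η hη).le _)
  have space_side : Tendsto
      (fun η : ℝ => ∫ q : V × V, f q.1 * conj (g q.2) * exp (-π ^ 2 * ‖q.2 - q.1‖ ^ 2 / (b + η)))
      (𝓝[>] 0) (𝓝 (∫ q : V × V, f q.1 * conj (g q.2) * exp (-π ^ 2 * ‖q.2 - q.1‖ ^ 2 / b))) := by
    refine tendsto_integral_filter_of_dominated_convergence
      (fun q => ‖f q.1 * conj (g q.2)‖)
      (.of_forall fun η => hfg'.aestronglyMeasurable.mul (by fun_prop)) ?_ hfg'.norm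
      (.of_forall fun q => ((hdiv _).cexp).const_mul _)
    filter_upwards [self_mem_nhdsWithin] with η hη
    refine .of_forall fun q => ?_
    rw [norm_mul _ (exp _)]
    exact mul_le_of_le_one_right (norm_nonneg _)
      (norm_cexp_neg_pi_sq_mul_sq_div_le_one (hre η hη).le _)
  have hslit := div_mem_slitPlane_of_re_nonneg Real.pi_pos hb hb0
  refine tendsto_nhds_unique (frequency_side.congr' ?_)
    (((continuousAt_cpow_const hslit).tendsto.comp (hdiv π)).mul space_side)
  filter_upwards [self_mem_nhdsWithin] with η hη
  exact integral_fourier_mul_conj_gaussian hf hg (hre η hη)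

end GaussianPairing

section SchrodingerForm

open Complex
open scoped Real ComplexConjugate

variable {V : Type*} [NormedAddCommGroup V] [InnerProductSpace ℝ V] [FiniteDimensional ℝ V]
  [MeasurableSpace V] [BorelSpace V]

/-- The sesquilinear form `⟨e^{is(1+Δ)} f, g⟩` of the Schrödinger propagator, written on the
frequency side; `4π²` comes from the normalisation `e^{-2πi⟨x, v⟩}` of `𝓕`. -/
noncomputable def schrodingerForm (s : ℝ) (f g : V → ℂ) : ℂ :=
  ∫ v, 𝓕 f v * conj (𝓕 g v) * exp (I * (1 - 4 * π ^ 2 * ‖v‖ ^ 2 : ℝ) * s)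

/-- The constant `(4πi)^{-N/2}` of the free Schrödinger kernel in dimension `N`. -/
noncomputable def dispersiveConst (N : ℕ) : ℂ :=
  (1 / (4 * π * I)) ^ (N / 2 : ℂ)

lemma norm_dispersiveConst_le_one (N : ℕ) : ‖dispersiveConst N‖ ≤ 1 := by
  rw [dispersiveConst, show (N / 2 : ℂ) = (N / 2 : ℝ) by push_cast; rfl, norm_cpow_real]
  refine Real.rpow_le_one (norm_nonneg _) ?_ (by positivity)
  simp only [norm_div, norm_one, norm_mul, norm_I, norm_real, norm_ofNat, mul_one,
    Real.norm_of_nonneg Real.pi_pos.le]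
  rw [div_le_one (by positivity)]
  linarith [Real.pi_gt_three]

lemma cpow_inv_ofReal_mul {s : ℝ} (hs : 0 < s) {z : ℂ} (hz : z ≠ 0) (c : ℂ) :
    ((s : ℂ)⁻¹ * z) ^ c = (s : ℂ) ^ (-c) * z ^ c := by
  have hs' : (s : ℂ) ≠ 0 := ofReal_ne_zero.2 hs.ne'
  rw [← ofReal_inv, cpow_def_of_ne_zero (mul_ne_zero (by simpa using hs') hz),
    cpow_def_of_ne_zero hs', cpow_def_of_ne_zero hz, ← exp_add,
    log_ofReal_mul (inv_pos.2 hs) hz, Real.log_inv, ← ofReal_log hs.le]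
  congr 1
  push_cast
  ring

lemma schrodingerForm_eq_kernel {f g : V → ℂ} (hf : Integrable f) (hf2 : MemLp f 2)
    (hg : Integrable g) (hg2 : MemLp g 2) {s : ℝ} (hs : 0 < s) :
    schrodingerForm s f g = dispersiveConst (Module.finrank ℝ V) *
      (s : ℂ) ^ (-(Module.finrank ℝ V / 2 : ℂ)) *
        ∫ q : V × V, f q.1 * conj (g q.2) * exp (I * (s + (‖q.2 - q.1‖ / 2) ^ 2 / s : ℝ)) := by
  have hs0 : (s : ℂ) ≠ 0 := ofReal_ne_zero.2 hs.ne'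
  have hπ0 : (π : ℂ) ≠ 0 := ofReal_ne_zero.2 Real.pi_ne_zero
  set b : ℂ := 4 * π ^ 2 * s * I with hb
  have hb_eq : b = ((4 * π ^ 2 * s : ℝ) : ℂ) * I := by rw [hb]; push_cast; ring
  have hb0 : b ≠ 0 := by rw [hb]; simp [hs0, hπ0]
  have hb_re : b.re = 0 := by rw [hb_eq, re_ofReal_mul, I_re, mul_zero]
  have pi_div : (π / b : ℂ) = (s : ℂ)⁻¹ * (1 / (4 * π * I)) := by rw [hb]; field_simp
  have frequency_side : schrodingerForm s f g =
      exp (I * s) * ∫ v, 𝓕 f v * conj (𝓕 g v) * exp (-b * ‖v‖ ^ 2) := by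
    rw [schrodingerForm, ← integral_const_mul]
    refine integral_congr_ae (.of_forall fun v => ?_)
    simp only [hb]
    rw [mul_left_comm, ← exp_add]
    congr 2
    push_cast
    ring
  rw [frequency_side, integral_fourier_mul_conj_gaussian_of_re_nonneg hf hf2 hg hg2 hb_re.ge hb0,
    pi_div, cpow_inv_ofReal_mul hs (by simp [hπ0]), ← dispersiveConst, mul_left_comm,
    mul_comm (dispersiveConst _), ← integral_const_mul]
  congr 1
  refine integral_congr_ae (.of_forall fun q => ?_)
  simp only [hb]
  rw [mul_left_comm, ← exp_add]
  congr 2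
  push_cast
  field_simp
  linear_combination (-4 * ‖q.2 - q.1‖ ^ 2 : ℂ) * I_sq

lemma norm_mul_cexp_I_mul_mul (w : ℂ) (l s : ℝ) : ‖w * exp (I * l * s)‖ = ‖w‖ := by
  rw [norm_mul, norm_cexp_I_mul_mul, mul_one]

lemma continuous_schrodingerForm {f g : V → ℂ} (hf : Integrable f) (hf2 : MemLp f 2)
    (hg : Integrable g) (hg2 : MemLp g 2) : Continuous fun s => schrodingerForm s f g := by
  have hfg := integrable_fourier_mul_conj hf hf2 hg hg2
  exact continuous_of_dominated (fun s => hfg.aestronglyMeasurable.mul (by fun_prop))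
    (fun s => .of_forall fun v => (norm_mul_cexp_I_mul_mul _ _ _).le) hfg.norm
    (.of_forall fun v => by fun_prop)

lemma norm_schrodingerForm_le {f g : V → ℂ} (hf : Integrable f) (hf2 : MemLp f 2)
    (hg : Integrable g) (hg2 : MemLp g 2) (s : ℝ) :
    ‖schrodingerForm s f g‖ ≤ ((∫ x, ‖f x‖ ^ 2) + ∫ x, ‖g x‖ ^ 2) / 2 := by
  refine (norm_integral_le_integral_norm _).trans ?_
  simp only [norm_mul_cexp_I_mul_mul]
  exact integral_norm_fourier_mul_conj_le hf hf2 hg hg2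

end SchrodingerForm

section Amplitude

open Set Asymptotics Complex

/-- Cutoffs of oscillatory integrals over `[1, ∞)`: decreasing from at most `1`, with exponential
decay at infinity (so that all integrals against powers converge absolutely). -/
structure IsAmplitude (a : ℝ → ℝ) : Prop where
  antitoneOn : AntitoneOn a (Ici 1)
  le_one : a 1 ≤ 1
  decay : ∃ δ > 0, a =O[atTop] fun s => Real.exp (-δ * s)

namespace IsAmplitude

variable {a : ℝ → ℝ}

lemma tendsto_zero (ha : IsAmplitude a) : Tendsto a atTop (𝓝 0) := by
  obtain ⟨δ, hδ, h⟩ := ha.decay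
  exact h.trans_tendsto
    (Real.tendsto_exp_atBot.comp (tendsto_id.const_mul_atTop_of_neg (neg_lt_zero.2 hδ)))

lemma nonneg (ha : IsAmplitude a) {s : ℝ} (hs : 1 ≤ s) : 0 ≤ a s := by
  refine le_of_tendsto ha.tendsto_zero ?_
  filter_upwards [eventually_ge_atTop s] with t ht
  exact ha.antitoneOn hs (hs.trans ht) ht

lemma norm_le_one (ha : IsAmplitude a) {s : ℝ} (hs : 1 ≤ s) : ‖a s‖ ≤ 1 := by
  rw [Real.norm_of_nonneg (ha.nonneg hs)]
  exact (ha.antitoneOn self_mem_Ici hs hs).trans ha.le_one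

lemma aestronglyMeasurable (ha : IsAmplitude a) :
    AEStronglyMeasurable a (volume.restrict (Ioi 1)) :=
  (aemeasurable_restrict_of_antitoneOn measurableSet_Ioi
    (ha.antitoneOn.mono Ioi_subset_Ici_self)).aestronglyMeasurable

variable {b : ℝ → ℂ} {C : ℝ}

lemma locallyIntegrable_indicator_smul (ha : IsAmplitude a)
    (hb : AEStronglyMeasurable b (volume.restrict (Ioi 1))) (hC : ∀ s, 1 < s → ‖b s‖ ≤ C) :
    LocallyIntegrable ((Ioi 1).indicator fun s => a s • b s) := by
  refine (locallyIntegrable_const C).mono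
    ((aestronglyMeasurable_indicator_iff measurableSet_Ioi).2 (ha.aestronglyMeasurable.smul hb))
    (.of_forall fun s => ?_)
  have hC0 : 0 ≤ C := (norm_nonneg _).trans (hC 2 one_lt_two)
  rw [Real.norm_of_nonneg hC0, norm_indicator_eq_indicator_norm]
  refine indicator_le' (fun s hs => ?_) (fun _ _ => hC0) s
  rw [norm_smul]
  exact (mul_le_of_le_one_left (norm_nonneg _) (ha.norm_le_one (le_of_lt hs))).trans (hC s hs)

lemma isBigO_indicator_smul (ha : IsAmplitude a) (hC : ∀ s, 1 < s → ‖b s‖ ≤ C) :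
    ∃ δ > 0, ((Ioi 1).indicator fun s => a s • b s) =O[atTop] fun s => Real.exp (-δ * s) := by
  obtain ⟨δ, hδ, decay⟩ := ha.decay
  have hb : b =O[atTop] fun _ => (1 : ℝ) :=
    .of_bound C <| (eventually_gt_atTop 1).mono fun s hs => by simpa using hC s hs
  refine ⟨δ, hδ, ((decay.smul hb).congr' ?_ (.of_forall fun s => mul_one _))⟩
  filter_upwards [Ioi_mem_atTop 1] with s hs
  rw [indicator_of_mem hs]

lemma indicator_smul_isBigO_nhdsGT_zero (r : ℝ) :
    ((Ioi 1).indicator fun s => a s • b s) =O[𝓝[>] 0] fun s => s ^ r := by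
  refine .of_bound 0 ?_
  filter_upwards [mem_nhdsWithin_of_mem_nhds (Iio_mem_nhds (zero_lt_one' ℝ))] with s hs
  simp [le_of_lt (mem_Iio.1 hs)]

lemma mellinConvergent_indicator_smul (ha : IsAmplitude a)
    (hb : AEStronglyMeasurable b (volume.restrict (Ioi 1))) (hC : ∀ s, 1 < s → ‖b s‖ ≤ C) (z : ℂ) :
    MellinConvergent ((Ioi 1).indicator fun s => a s • b s) z := by
  obtain ⟨δ, hδ, decay⟩ := ha.isBigO_indicator_smul hC
  exact mellinConvergent_of_isBigO_rpow_exp hδ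
    ((ha.locallyIntegrable_indicator_smul hb hC).locallyIntegrableOn _) decay
    (indicator_smul_isBigO_nhdsGT_zero _) (sub_one_lt z.re)

lemma differentiable_mellin_indicator_smul (ha : IsAmplitude a)
    (hb : AEStronglyMeasurable b (volume.restrict (Ioi 1))) (hC : ∀ s, 1 < s → ‖b s‖ ≤ C) :
    Differentiable ℂ (mellin ((Ioi 1).indicator fun s => a s • b s)) := fun z => by
  obtain ⟨δ, hδ, decay⟩ := ha.isBigO_indicator_smul hC
  exact mellin_differentiableAt_of_isBigO_rpow_exp hδ
    ((ha.locallyIntegrable_indicator_smul hb hC).locallyIntegrableOn _) decay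
    (indicator_smul_isBigO_nhdsGT_zero _) (sub_one_lt z.re)

lemma cpow_smul_indicator_smul (a : ℝ → ℝ) (b : ℝ → ℂ) (z : ℂ) :
    (fun s : ℝ => (s : ℂ) ^ z • (Ioi 1).indicator (fun s => a s • b s) s) =
      (Ioi 1).indicator fun s : ℝ => a s • ((s : ℂ) ^ z * b s) := by
  ext s
  by_cases hs : s ∈ Ioi (1 : ℝ) <;> simp [hs, mul_left_comm]

lemma integrableOn_smul_cpow_mul (ha : IsAmplitude a)
    (hb : AEStronglyMeasurable b (volume.restrict (Ioi 1))) (hC : ∀ s, 1 < s → ‖b s‖ ≤ C) (z : ℂ) :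
    IntegrableOn (fun s : ℝ => a s • ((s : ℂ) ^ z * b s)) (Ioi 1) := by
  have h := ha.mellinConvergent_indicator_smul hb hC (z + 1)
  rw [MellinConvergent, add_sub_cancel_right, cpow_smul_indicator_smul] at h
  rwa [integrableOn_indicator_iff measurableSet_Ioi,
    inter_eq_left.2 (Ioi_subset_Ioi zero_le_one)] at h

lemma integrableOn_smul_cpow (ha : IsAmplitude a) (z : ℂ) :
    IntegrableOn (fun s : ℝ => a s • (s : ℂ) ^ z) (Ioi 1) := by
  simpa using ha.integrableOn_smul_cpow_mul (b := fun _ => 1) aestronglyMeasurable_const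
    (fun _ _ => norm_one.le) z

lemma mellin_indicator_smul (a : ℝ → ℝ) (b : ℝ → ℂ) (z : ℂ) :
    mellin ((Ioi 1).indicator fun s => a s • b s) z =
      ∫ s in Ioi 1, a s • ((s : ℂ) ^ (z - 1) * b s) := by
  rw [mellin, cpow_smul_indicator_smul, setIntegral_indicator measurableSet_Ioi,
    inter_eq_right.2 (Ioi_subset_Ioi zero_le_one)]

lemma norm_setIntegral_smul_cpow_mul_integral_le (ha : IsAmplitude a) {X : Type*}
    [MeasurableSpace X] {μ : Measure X} [SFinite μ] {F : X → ℂ} (hF : Integrable F μ)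
    {e : ℝ → X → ℂ} (he : Measurable (Function.uncurry e)) (he1 : ∀ s x, ‖e s x‖ ≤ 1)
    {w : ℂ} {M : ℝ} (hM : ∀ x R, 1 ≤ R → ‖∫ s : ℝ in 1..R, (s : ℂ) ^ w * e s x‖ ≤ M) :
    ‖∫ s in Ioi 1, a s • ((s : ℂ) ^ w * ∫ x, F x * e s x ∂μ)‖ ≤ M * ∫ x, ‖F x‖ ∂μ := by
  have hprod : Integrable (Function.uncurry fun (s : ℝ) x => a s • (s : ℂ) ^ w * F x * e s x)
      ((volume.restrict (Ioi 1)).prod μ) :=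
    ((ha.integrableOn_smul_cpow w).mul_prod hF).mul_bdd (c := 1) he.aestronglyMeasurable
      (.of_forall fun q => he1 _ _)
  have fubini : ∫ s in Ioi 1, a s • ((s : ℂ) ^ w * ∫ x, F x * e s x ∂μ) =
      ∫ x, F x * (∫ s in Ioi 1, a s • ((s : ℂ) ^ w * e s x)) ∂μ := by
    calc _ = ∫ s : ℝ in Ioi 1, ∫ x, a s • (s : ℂ) ^ w * F x * e s x ∂μ := by
          simp only [mul_assoc, integral_const_mul, smul_mul_assoc, integral_smul]
      _ = ∫ x, (∫ s : ℝ in Ioi 1, a s • (s : ℂ) ^ w * F x * e s x) ∂μ :=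
          integral_integral_swap hprod
      _ = _ := by
          simp only [← integral_const_mul, mul_assoc, smul_mul_assoc, mul_smul_comm,
            mul_left_comm]
  have inner_bound : ∀ x, ‖∫ s in Ioi 1, a s • ((s : ℂ) ^ w * e s x)‖ ≤ M := fun x => by
    have he_x : Measurable fun s => e s x := he.comp measurable_prodMk_right
    have hk : AEStronglyMeasurable (fun s : ℝ => (s : ℂ) ^ w * e s x) (volume.restrict (Ioi 1)) :=
      (by fun_prop : Measurable _).aestronglyMeasurable
    have hM0 : 0 ≤ M := (norm_nonneg _).trans (hM x 1 le_rfl)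
    exact (norm_setIntegral_Ioi_smul_le_of_antitoneOn ha.antitoneOn ha.tendsto_zero hk
      (ha.integrableOn_smul_cpow_mul he_x.aestronglyMeasurable (fun s _ => he1 s x) w)
      (hM x)).trans (mul_le_of_le_one_right hM0 ha.le_one)
  rw [fubini, mul_comm, ← integral_mul_const]
  refine norm_integral_le_of_norm_le (hF.norm.mul_const _) (.of_forall fun x => ?_)
  rw [norm_mul]
  gcongr
  exact inner_bound x

end IsAmplitude

end Amplitude

section AmplitudeForm

open Set Complex
open scoped Real ComplexConjugate

variable {V : Type*} [NormedAddCommGroup V] [InnerProductSpace ℝ V] [FiniteDimensional ℝ V]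
  [MeasurableSpace V] [BorelSpace V] {a : ℝ → ℝ} {f g : V → ℂ}

/-- The Mellin transform `z ↦ ∫₁^∞ a(s) s^{z-1} ⟨e^{is(1+Δ)} f, g⟩ ds`: the analytic family of
sesquilinear forms to which Stein interpolation is applied. -/
noncomputable def amplitudeForm (a : ℝ → ℝ) (z : ℂ) (f g : V → ℂ) : ℂ :=
  ∫ s in Ioi 1, a s • ((s : ℂ) ^ (z - 1) * schrodingerForm s f g)

lemma integrableOn_smul_cpow_mul_schrodingerForm (ha : IsAmplitude a) (hf : Integrable f)
    (hf2 : MemLp f 2) (hg : Integrable g) (hg2 : MemLp g 2) (z : ℂ) :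
    IntegrableOn (fun s : ℝ => a s • ((s : ℂ) ^ z * schrodingerForm s f g)) (Ioi 1) :=
  ha.integrableOn_smul_cpow_mul
    (continuous_schrodingerForm hf hf2 hg hg2).aestronglyMeasurable
    (fun s _ => norm_schrodingerForm_le hf hf2 hg hg2 s) z

lemma differentiable_amplitudeForm (ha : IsAmplitude a) (hf : Integrable f) (hf2 : MemLp f 2)
    (hg : Integrable g) (hg2 : MemLp g 2) : Differentiable ℂ fun z => amplitudeForm a z f g := by
  simp only [amplitudeForm, ← IsAmplitude.mellin_indicator_smul]
  exact ha.differentiable_mellin_indicator_smul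
    (continuous_schrodingerForm hf hf2 hg hg2).aestronglyMeasurable
    fun s _ => norm_schrodingerForm_le hf hf2 hg hg2 s

/- The `L²` endpoint: the factor `|τ|` compensates the singularity of `∫₁^∞ s^{-1+iτ} ds`. -/
lemma abs_mul_norm_amplitudeForm_mul_I_le (ha : IsAmplitude a) (hf : Integrable f)
    (hf2 : MemLp f 2) (hg : Integrable g) (hg2 : MemLp g 2) (τ : ℝ) :
    |τ| * ‖amplitudeForm a (τ * I) f g‖ ≤
      (3 + |τ| * (3 + |τ|)) * (((∫ x, ‖f x‖ ^ 2) + ∫ x, ‖g x‖ ^ 2) / 2) := by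
  rcases eq_or_ne τ 0 with rfl | hτ
  · rw [abs_zero, zero_mul]
    positivity
  have hτ' : 0 < |τ| := abs_pos.2 hτ
  have oscillation : ∀ (v : V) (R : ℝ), 1 ≤ R → ‖∫ s : ℝ in 1..R, (s : ℂ) ^ (τ * I - 1) *
      exp (I * (1 - 4 * π ^ 2 * ‖v‖ ^ 2 : ℝ) * s)‖ ≤ (3 + |τ| * (3 + |τ|)) / |τ| := by
    intro v R hR
    rw [le_div_iff₀' hτ', ← Real.norm_eq_abs, ← norm_real, ← norm_mul, norm_real,
      Real.norm_eq_abs]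
    exact norm_mul_integral_cpow_mul_cexp_le τ _ hR
  calc |τ| * ‖amplitudeForm a (τ * I) f g‖
      ≤ |τ| * ((3 + |τ| * (3 + |τ|)) / |τ| * ∫ v, ‖𝓕 f v * conj (𝓕 g v)‖) := by
        gcongr
        exact ha.norm_setIntegral_smul_cpow_mul_integral_le
          (e := fun s v => exp (I * (1 - 4 * π ^ 2 * ‖v‖ ^ 2 : ℝ) * s))
          (integrable_fourier_mul_conj hf hf2 hg hg2) (by unfold Function.uncurry; fun_prop)
          (fun s v => (norm_cexp_I_mul_mul _ _).le) oscillation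
    _ = (3 + |τ| * (3 + |τ|)) * ∫ v, ‖𝓕 f v * conj (𝓕 g v)‖ := by field_simp
    _ ≤ _ := by
        gcongr
        exact integral_norm_fourier_mul_conj_le hf hf2 hg hg2

/- The `L¹ → L^∞` endpoint: `s^{(N+1)/2-1}` compensates the decay `s^{-N/2}` of the Schrödinger
kernel up to `s^{-1/2}`, and the oscillation of the kernel does the rest. -/
lemma norm_amplitudeForm_le_integral_norm_mul (ha : IsAmplitude a) (hf : Integrable f)
    (hf2 : MemLp f 2) (hg : Integrable g) (hg2 : MemLp g 2) (τ : ℝ) :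
    ‖amplitudeForm a ((Module.finrank ℝ V + 1) / 2 + τ * I) f g‖ ≤
      (12 + 8 * |τ|) * ((∫ x, ‖f x‖) * ∫ x, ‖g x‖) := by
  set N := Module.finrank ℝ V
  have kernel_form : amplitudeForm a ((N + 1) / 2 + τ * I) f g = dispersiveConst N *
      ∫ s : ℝ in Ioi 1, a s • ((s : ℂ) ^ (((-1 / 2 : ℝ) : ℂ) + τ * I) *
        ∫ q : V × V, f q.1 * conj (g q.2) * exp (I * (s + (‖q.2 - q.1‖ / 2) ^ 2 / s : ℝ))) := by
    rw [amplitudeForm, ← integral_const_mul]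
    refine setIntegral_congr_fun measurableSet_Ioi fun s hs => ?_
    have hs0 : 0 < s := zero_lt_one.trans hs
    have exponents : (s : ℂ) ^ (((-1 / 2 : ℝ) : ℂ) + τ * I) =
        (s : ℂ) ^ ((N + 1) / 2 + τ * I - 1) * (s : ℂ) ^ (-(N / 2 : ℂ)) := by
      rw [← cpow_add _ _ (ofReal_ne_zero.2 hs0.ne')]
      congr 1
      push_cast
      ring
    simp only [schrodingerForm_eq_kernel hf hf2 hg hg2 hs0, exponents, real_smul]
    ring
  have hfg := integrable_mul_conj_prod (μ := volume) (ν := volume) hf hg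
  have oscillatory_bound := ha.norm_setIntegral_smul_cpow_mul_integral_le
    (e := fun s q => exp (I * (s + (‖q.2 - q.1‖ / 2) ^ 2 / s : ℝ))) hfg
    (by unfold Function.uncurry; fun_prop)
    (fun s q => (norm_exp_I_mul_ofReal _).le)
    fun q R hR => norm_integral_cpow_mul_cexp_add_sq_div_le τ (by positivity) hR
  rw [kernel_form, norm_mul]
  refine (mul_le_of_le_one_left (norm_nonneg _) (norm_dispersiveConst_le_one N)).trans
    (oscillatory_bound.trans_eq ?_)
  simp only [norm_mul, RCLike.norm_conj]
  rw [integral_prod_mul (fun x => ‖f x‖) fun x => ‖g x‖]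

end AmplitudeForm

section ThreeLines

open Complex HadamardThreeLines Asymptotics Set

lemma norm_le_norm_add_two {ζ : ℂ} (hζ : 0 ≤ ζ.re) : ‖ζ‖ ≤ ‖ζ + 2‖ := by
  rw [norm_def, norm_def]
  refine Real.sqrt_le_sqrt ?_
  simp only [normSq_apply, add_re, re_ofNat, add_im, im_ofNat, add_zero]
  linarith

lemma two_le_norm_add_two {ζ : ℂ} (hζ : 0 ≤ ζ.re) : 2 ≤ ‖ζ + 2‖ := by
  refine le_trans ?_ (re_le_norm (ζ + 2))
  simpa using hζ

lemma add_two_ne_zero {ζ : ℂ} (hζ : 0 ≤ ζ.re) : ζ + 2 ≠ 0 :=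
  norm_pos_iff.1 (two_pos.trans_le (two_le_norm_add_two hζ))

variable {E : Type*} [NormedAddCommGroup E] [NormedSpace ℂ E] {Ψ : ℂ → E}

lemma diffContOnCl_div_add_two_sq_smul (hΨ : Differentiable ℂ Ψ) :
    DiffContOnCl ℂ (fun ζ => (ζ / (ζ + 2) ^ 2) • Ψ ζ) (verticalStrip 0 1) := by
  refine DifferentiableOn.diffContOnCl fun ζ hζ => ?_
  have hre : 0 ≤ ζ.re := closure_minimal (t := {ζ : ℂ | 0 ≤ ζ.re})
    (fun ζ hζ => le_of_lt (show 0 < ζ.re from hζ.1)) (isClosed_le continuous_const continuous_re) hζ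
  have hfactor : DifferentiableAt ℂ (fun ζ : ℂ => ζ / (ζ + 2) ^ 2) ζ :=
    .fun_div (by fun_prop) (by fun_prop) (pow_ne_zero 2 (add_two_ne_zero hre))
  exact (hfactor.smul (hΨ ζ)).differentiableWithinAt

lemma norm_div_add_two_sq_smul (ζ : ℂ) (v : E) :
    ‖(ζ / (ζ + 2) ^ 2) • v‖ = ‖ζ‖ * ‖v‖ / ‖ζ + 2‖ ^ 2 := by
  rw [norm_smul, norm_div, norm_pow, div_mul_eq_mul_div]

lemma bddAbove_norm_div_add_two_sq_smul
    (hΨ : Ψ =O[𝓟 (verticalClosedStrip 0 1)] fun _ => (1 : ℝ)) :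
    BddAbove ((norm ∘ fun ζ => (ζ / (ζ + 2) ^ 2) • Ψ ζ) '' verticalClosedStrip 0 1) := by
  obtain ⟨C, hC⟩ := isBigO_principal.1 hΨ
  refine ⟨C, ?_⟩
  rintro _ ⟨ζ, hζ, rfl⟩
  have hre : 0 ≤ ζ.re := hζ.1
  have h2 := two_le_norm_add_two hre
  have hΨζ : ‖Ψ ζ‖ ≤ C := by simpa using hC ζ hζ
  have hC0 : 0 ≤ C := (norm_nonneg _).trans hΨζ
  have hζ2 : ‖ζ‖ ≤ ‖ζ + 2‖ ^ 2 := (norm_le_norm_add_two hre).trans (by nlinarith)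
  rw [Function.comp_apply, norm_div_add_two_sq_smul, div_le_iff₀ (by positivity), mul_comm]
  gcongr

lemma norm_div_add_two_sq_smul_le {ζ : ℂ} {v : E} {D : ℝ} (hre : 0 ≤ ζ.re)
    (h : ‖ζ‖ * ‖v‖ ≤ D * ‖ζ + 2‖ ^ 2) : ‖(ζ / (ζ + 2) ^ 2) • v‖ ≤ D := by
  rwa [norm_div_add_two_sq_smul, div_le_iff₀ (pow_pos (norm_pos_iff.2 (add_two_ne_zero hre)) 2)]

/- The factor `ζ / (ζ + 2)²` absorbs both a simple singularity at `0` and quadratic growth along the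
boundary lines. -/
lemma norm_le_of_norm_mul_le_on_strip_boundary (hΨ : Differentiable ℂ Ψ)
    (hΨ_bdd : Ψ =O[𝓟 (verticalClosedStrip 0 1)] fun _ => (1 : ℝ)) {A B : ℝ}
    (hA : ∀ ζ : ℂ, ζ.re = 0 → ‖ζ‖ * ‖Ψ ζ‖ ≤ A * ‖ζ + 2‖ ^ 2)
    (hB : ∀ ζ : ℂ, ζ.re = 1 → ‖ζ‖ * ‖Ψ ζ‖ ≤ B * ‖ζ + 2‖ ^ 2) {θ : ℝ} (hθ0 : 0 < θ) (hθ1 : θ ≤ 1) :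
    ‖Ψ θ‖ ≤ 9 / θ * (A ^ (1 - θ) * B ^ θ) := by
  have three_lines := norm_le_interp_of_mem_verticalClosedStrip₀₁' _ (z := θ)
    ⟨by simpa using hθ0.le, by simpa using hθ1⟩ (diffContOnCl_div_add_two_sq_smul hΨ)
    (bddAbove_norm_div_add_two_sq_smul hΨ_bdd)
    (fun ζ (hζ : ζ.re = 0) => norm_div_add_two_sq_smul_le hζ.ge (hA ζ hζ))
    (fun ζ (hζ : ζ.re = 1) => norm_div_add_two_sq_smul_le (hζ ▸ zero_le_one) (hB ζ hζ))
  have norm_add_two : ‖(θ : ℂ) + 2‖ = θ + 2 := by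
    rw [← ofReal_ofNat, ← ofReal_add, norm_real, Real.norm_of_nonneg (by positivity)]
  rw [norm_div_add_two_sq_smul, norm_add_two, ofReal_re, norm_real, Real.norm_of_nonneg hθ0.le,
    div_le_iff₀ (by positivity), mul_comm θ] at three_lines
  have interp_nonneg : 0 ≤ A ^ (1 - θ) * B ^ θ :=
    nonneg_of_mul_nonneg_left ((by positivity : 0 ≤ ‖Ψ θ‖ * θ).trans three_lines)
      (by positivity : 0 < (θ + 2) ^ 2)
  rw [div_mul_eq_mul_div, le_div_iff₀ hθ0, mul_comm 9]
  refine three_lines.trans ?_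
  gcongr
  nlinarith

end ThreeLines

section PhasePow

open Complex Asymptotics
open scoped ComplexConjugate

/-- The power `|c|^{w-1} c` with complex exponent `w`, which keeps the phase of `c`; it builds the
analytic families of simple functions used for interpolation. -/
noncomputable def phasePow (w c : ℂ) : ℂ := c / ‖c‖ * (‖c‖ : ℂ) ^ w

lemma phasePow_zero (w : ℂ) : phasePow w 0 = 0 := by simp [phasePow]

lemma phasePow_one (c : ℂ) : phasePow 1 c = c := by
  rcases eq_or_ne c 0 with rfl | hc
  · exact phasePow_zero 1
  · rw [phasePow, cpow_one, div_mul_cancel₀ _ (ofReal_ne_zero.2 (norm_ne_zero_iff.2 hc))]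

lemma norm_phasePow {w : ℂ} (hw : 0 < w.re) (c : ℂ) : ‖phasePow w c‖ = ‖c‖ ^ w.re := by
  rcases eq_or_ne c 0 with rfl | hc
  · rw [phasePow_zero, norm_zero, Real.zero_rpow hw.ne']
  · have hc0 : 0 < ‖c‖ := norm_pos_iff.2 hc
    rw [phasePow, norm_mul, norm_cpow_eq_rpow_re_of_pos hc0, norm_div, norm_real, norm_norm,
      div_self hc0.ne', one_mul]

lemma differentiable_phasePow {c : ℂ} (hc : c ≠ 0) : Differentiable ℂ fun w => phasePow w c :=
  fun _ => (differentiableAt_id.const_cpow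
    (Or.inl (ofReal_ne_zero.2 (norm_ne_zero_iff.2 hc)))).const_mul _

lemma conj_phasePow_conj (w c : ℂ) : conj (phasePow (conj w) c) = phasePow w (conj c) := by
  have harg : arg (‖c‖ : ℂ) ≠ Real.pi := by
    rw [arg_ofReal_of_nonneg (norm_nonneg c)]
    exact Real.pi_ne_zero.symm
  rw [phasePow, phasePow, map_mul, map_div₀, conj_ofReal, RCLike.norm_conj, cpow_conj _ _ harg,
    conj_ofReal, conj_conj]

lemma norm_phasePow_le {w : ℂ} (hw : 0 < w.re) {r : ℝ} (hr : w.re ≤ r) (c : ℂ) :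
    ‖phasePow w c‖ ≤ max 1 (‖c‖ ^ r) := by
  rw [norm_phasePow hw]
  rcases le_total ‖c‖ 1 with hc | hc
  · exact (Real.rpow_le_one (norm_nonneg _) hc hw.le).trans (le_max_left _ _)
  · exact (Real.rpow_le_rpow_of_exponent_le hc hr).trans (le_max_right _ _)

end PhasePow

section Sesquilinear

open Complex
open scoped Real ComplexConjugate

variable {V : Type*} [NormedAddCommGroup V] [InnerProductSpace ℝ V] [FiniteDimensional ℝ V]
  [MeasurableSpace V] [BorelSpace V] {ι : Type*} (S : Finset ι) (c d : ι → ℂ) {u : ι → V → ℂ}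

lemma fourier_finset_sum (hu : ∀ i ∈ S, Integrable (u i)) (v : V) :
    𝓕 (fun x => ∑ i ∈ S, c i * u i x) v = ∑ i ∈ S, c i * 𝓕 (u i) v := by
  simp only [Real.fourier_eq, Finset.smul_sum]
  rw [integral_finsetSum _ fun i hi =>
    (Real.fourierIntegral_convergent_iff v).2 ((hu i hi).const_mul _)]
  refine Finset.sum_congr rfl fun i _ => ?_
  simp only [← integral_const_mul, Circle.smul_def, smul_eq_mul, mul_left_comm]

lemma schrodingerForm_finset_sum (hu : ∀ i ∈ S, Integrable (u i)) (hu2 : ∀ i ∈ S, MemLp (u i) 2)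
    (s : ℝ) :
    schrodingerForm s (fun x => ∑ i ∈ S, c i * u i x) (fun x => ∑ i ∈ S, d i * u i x) =
      ∑ q ∈ S ×ˢ S, c q.1 * conj (d q.2) * schrodingerForm s (u q.1) (u q.2) := by
  simp only [schrodingerForm, fourier_finset_sum S _ hu, ← integral_const_mul]
  rw [← integral_finsetSum]
  · refine integral_congr_ae (.of_forall fun v => ?_)
    simp only [map_sum, map_mul]
    rw [Finset.sum_mul_sum, ← Finset.sum_product', Finset.sum_mul]
    exact Finset.sum_congr rfl fun q _ => by ring
  · intro q hq
    obtain ⟨hi, hj⟩ := Finset.mem_product.1 hq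
    exact ((integrable_fourier_mul_conj (hu _ hi) (hu2 _ hi) (hu _ hj) (hu2 _ hj)).mul_bdd (c := 1)
      (by fun_prop) (.of_forall fun v => (norm_cexp_I_mul_mul _ _).le)).const_mul _

lemma amplitudeForm_finset_sum {a : ℝ → ℝ} (ha : IsAmplitude a) (hu : ∀ i ∈ S, Integrable (u i))
    (hu2 : ∀ i ∈ S, MemLp (u i) 2) (z : ℂ) :
    amplitudeForm a z (fun x => ∑ i ∈ S, c i * u i x) (fun x => ∑ i ∈ S, d i * u i x) =
      ∑ q ∈ S ×ˢ S, c q.1 * conj (d q.2) * amplitudeForm a z (u q.1) (u q.2) := by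
  simp only [amplitudeForm, schrodingerForm_finset_sum S c d hu hu2, ← integral_const_mul]
  rw [← integral_finsetSum]
  · simp only [Finset.mul_sum, Finset.smul_sum, mul_smul_comm, mul_left_comm]
  · intro q hq
    obtain ⟨hi, hj⟩ := Finset.mem_product.1 hq
    exact (integrableOn_smul_cpow_mul_schrodingerForm ha (hu _ hi) (hu2 _ hi) (hu _ hj) (hu2 _ hj)
      (z - 1)).const_mul _

lemma exists_norm_amplitudeForm_le {a : ℝ → ℝ} (ha : IsAmplitude a) {f g : V → ℂ}
    (hf : Integrable f) (hf2 : MemLp f 2) (hg : Integrable g) (hg2 : MemLp g 2) (r : ℝ) :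
    ∃ B, ∀ z : ℂ, z.re ≤ r → ‖amplitudeForm a z f g‖ ≤ B := by
  have dominating := (integrableOn_smul_cpow_mul_schrodingerForm ha hf hf2 hg hg2 (r - 1 : ℝ)).norm
  refine ⟨_, fun z hz => norm_integral_le_of_norm_le dominating ?_⟩
  filter_upwards [ae_restrict_mem measurableSet_Ioi] with s (hs : 1 < s)
  have hs0 : 0 < s := zero_lt_one.trans hs
  simp only [norm_smul, norm_mul, norm_cpow_eq_rpow_re_of_pos hs0, sub_re, one_re, ofReal_re]
  gcongr
  exact hs.le

end Sesquilinear

section SteinFamily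

open Complex Asymptotics HadamardThreeLines
open scoped ComplexConjugate

lemma simpleFunc_comp_eq_sum_indicator {X α R : Type*} [MeasurableSpace X] [Zero α]
    [DecidableEq α] [NonAssocSemiring R] (f : SimpleFunc X α) {K : α → R} (hK : K 0 = 0) (x : X) :
    K (f x) = ∑ c ∈ f.range with c ≠ 0, K c * (f ⁻¹' {c}).indicator (fun _ => (1 : R)) x := by
  rw [Finset.sum_eq_single (f x)]
  · rw [Set.indicator_of_mem (Set.mem_preimage.2 (Set.mem_singleton _)), mul_one]
  · intro c _ hc
    rw [Set.indicator_of_notMem (Set.mem_preimage.not.2 (Set.mem_singleton_iff.not.2 hc.symm)),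
      mul_zero]
  · intro hx
    have hfx : f x = 0 := by_contra fun h0 =>
      hx (Finset.mem_filter.2 ⟨f.mem_range_self x, h0⟩)
    rw [hfx, hK, zero_mul]

section AnalyticFamily

variable {X : Type*} [MeasurableSpace X] {μ : Measure X} {p : ℝ} {f : SimpleFunc X ℂ}

/-- The family `|f|^{p(1+ζ)/2 - 1} f` through the simple function `f`. Its `L²` norm on `re ζ = 0`
and its `L¹` norm on `re ζ = 1` are both governed by `∫ |f|^p`. -/
noncomputable def analyticFamily (p : ℝ) (f : SimpleFunc X ℂ) (ζ : ℂ) : SimpleFunc X ℂ :=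
  f.map (phasePow (p * ((1 + ζ) / 2)))

lemma re_ofReal_mul_one_add_div_two (p : ℝ) (ζ : ℂ) :
    ((p : ℂ) * ((1 + ζ) / 2)).re = p * ((1 + ζ.re) / 2) := by
  rw [re_ofReal_mul, div_ofNat_re, add_re, one_re]

lemma norm_analyticFamily (hp : 0 < p) {ζ : ℂ} (hζ : 0 ≤ ζ.re) (x : X) :
    ‖analyticFamily p f ζ x‖ = ‖f x‖ ^ (p * ((1 + ζ.re) / 2)) := by
  rw [analyticFamily, SimpleFunc.map_apply, norm_phasePow, re_ofReal_mul_one_add_div_two]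
  rw [re_ofReal_mul_one_add_div_two]
  positivity

lemma integrable_analyticFamily (hf : Integrable f μ) (ζ : ℂ) :
    Integrable (analyticFamily p f ζ) μ :=
  SimpleFunc.integrable_iff_finMeasSupp.2
    ((SimpleFunc.integrable_iff_finMeasSupp.1 hf).map (phasePow_zero _))

lemma memLp_two_analyticFamily (hf : Integrable f μ) (ζ : ℂ) :
    MemLp (analyticFamily p f ζ) 2 μ :=
  (SimpleFunc.memLp_iff_integrable two_ne_zero ENNReal.ofNat_ne_top).2
    (integrable_analyticFamily hf ζ)

lemma integral_norm_sq_analyticFamily (hp : 0 < p) {ζ : ℂ} (hζ : ζ.re = 0) :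
    ∫ x, ‖analyticFamily p f ζ x‖ ^ 2 ∂μ = ∫ x, ‖f x‖ ^ p ∂μ := by
  refine integral_congr_ae (.of_forall fun x => ?_)
  simp only [norm_analyticFamily hp hζ.ge, hζ, ← Real.rpow_mul_natCast (norm_nonneg _)]
  congr 1
  ring

lemma integral_norm_analyticFamily (hp : 0 < p) {ζ : ℂ} (hζ : ζ.re = 1) :
    ∫ x, ‖analyticFamily p f ζ x‖ ∂μ = ∫ x, ‖f x‖ ^ p ∂μ := by
  refine integral_congr_ae (.of_forall fun x => ?_)
  simp only [norm_analyticFamily hp (hζ ▸ zero_le_one), hζ, add_self_div_two, mul_one]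

lemma analyticFamily_eq_self {θ : ℝ} (hp : p * (1 + θ) = 2) : analyticFamily p f θ = f := by
  ext x
  have exponent_eq : (p : ℂ) * ((1 + θ) / 2) = 1 := by
    rw [← mul_div_assoc]
    exact_mod_cast (div_eq_one_iff_eq two_ne_zero).2 (congrArg ((↑) : ℝ → ℂ) hp)
  rw [analyticFamily, SimpleFunc.map_apply, exponent_eq, phasePow_one]

lemma integrable_indicator_preimage (hf : Integrable f μ) {c : ℂ} (hc : c ≠ 0) :
    Integrable ((f ⁻¹' {c}).indicator fun _ => (1 : ℂ)) μ :=
  (integrable_indicator_iff (f.measurableSet_preimage {c})).2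
    (integrableOn_const (f.measure_preimage_lt_top_of_integrable hf hc).ne)

lemma memLp_two_indicator_preimage (hf : Integrable f μ) {c : ℂ} (hc : c ≠ 0) :
    MemLp ((f ⁻¹' {c}).indicator fun _ => (1 : ℂ)) 2 μ :=
  memLp_indicator_const 2 (f.measurableSet_preimage {c}) 1
    (Or.inr (f.measure_preimage_lt_top_of_integrable hf hc).ne)

end AnalyticFamily

variable {V : Type*} [NormedAddCommGroup V] [InnerProductSpace ℝ V] [FiniteDimensional ℝ V]
  [MeasurableSpace V] [BorelSpace V] {a : ℝ → ℝ} {p : ℝ} {f : SimpleFunc V ℂ}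

/-- The analytic function to which the three lines theorem is applied. The second argument of the
form is evaluated at `conj ζ`, which undoes the conjugate linearity of the form. -/
noncomputable def steinFamily (a : ℝ → ℝ) (p : ℝ) (f : SimpleFunc V ℂ) (ζ : ℂ) : ℂ :=
  amplitudeForm a (ζ * ((Module.finrank ℝ V + 1) / 2 : ℝ)) (analyticFamily p f ζ)
    (analyticFamily p f (conj ζ))

lemma steinFamily_eq_sum (ha : IsAmplitude a) (hf : Integrable f) (ζ : ℂ) :
    steinFamily a p f ζ =
      ∑ q ∈ (f.range.filter (· ≠ 0)) ×ˢ (f.range.filter (· ≠ 0)),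
        phasePow (p * ((1 + ζ) / 2)) q.1 * phasePow (p * ((1 + ζ) / 2)) (conj q.2) *
          amplitudeForm a (ζ * ((Module.finrank ℝ V + 1) / 2 : ℝ))
            ((f ⁻¹' {q.1}).indicator fun _ => (1 : ℂ))
            ((f ⁻¹' {q.2}).indicator fun _ => (1 : ℂ)) := by
  have family_eq_sum : ∀ ζ, (analyticFamily p f ζ : V → ℂ) = fun x => ∑ c ∈ f.range with c ≠ 0,
      phasePow (p * ((1 + ζ) / 2)) c * (f ⁻¹' {c}).indicator (fun _ => (1 : ℂ)) x := fun ζ =>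
    funext (simpleFunc_comp_eq_sum_indicator f (phasePow_zero _))
  have exponent_conj : (p : ℂ) * ((1 + conj ζ) / 2) = conj ((p : ℂ) * ((1 + ζ) / 2)) := by
    simp only [map_mul, map_div₀, map_add, map_one, conj_ofReal, map_ofNat]
  rw [steinFamily, family_eq_sum, family_eq_sum, exponent_conj, amplitudeForm_finset_sum _ _ _ ha
    (fun c hc => integrable_indicator_preimage hf (Finset.mem_filter.1 hc).2)
    (fun c hc => memLp_two_indicator_preimage hf (Finset.mem_filter.1 hc).2)]
  simp only [conj_phasePow_conj]

lemma differentiable_steinFamily (ha : IsAmplitude a) (hf : Integrable f) :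
    Differentiable ℂ (steinFamily a p f) := by
  rw [funext (steinFamily_eq_sum ha hf)]
  refine Differentiable.fun_sum fun q hq => ?_
  obtain ⟨hc, hd⟩ := Finset.mem_product.1 hq
  replace hc : q.1 ≠ 0 := (Finset.mem_filter.1 hc).2
  replace hd : q.2 ≠ 0 := (Finset.mem_filter.1 hd).2
  have exponent : Differentiable ℂ fun ζ : ℂ => (p : ℂ) * ((1 + ζ) / 2) := by fun_prop
  refine (((differentiable_phasePow hc).comp exponent).mul
    ((differentiable_phasePow ((map_ne_zero _).2 hd)).comp exponent)).mul ?_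
  exact (differentiable_amplitudeForm ha (integrable_indicator_preimage hf hc)
    (memLp_two_indicator_preimage hf hc) (integrable_indicator_preimage hf hd)
    (memLp_two_indicator_preimage hf hd)).comp (differentiable_id.mul_const _)

lemma isBigO_phasePow_strip (hp : 0 < p) (c : ℂ) :
    (fun ζ : ℂ => phasePow (p * ((1 + ζ) / 2)) c) =O[𝓟 (verticalClosedStrip 0 1)]
      fun _ => (1 : ℝ) := by
  refine isBigO_principal.2 ⟨max 1 (‖c‖ ^ p), fun ζ ⟨hζ0, hζ1⟩ => ?_⟩
  have hre := re_ofReal_mul_one_add_div_two p ζ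
  rw [norm_one, mul_one]
  exact norm_phasePow_le (hre ▸ by positivity) (hre ▸ by nlinarith) c

lemma isBigO_amplitudeForm_strip (ha : IsAmplitude a) {g h : V → ℂ} (hg : Integrable g)
    (hg2 : MemLp g 2) (hh : Integrable h) (hh2 : MemLp h 2) {M : ℝ} (hM : 0 ≤ M) :
    (fun ζ : ℂ => amplitudeForm a (ζ * M) g h) =O[𝓟 (verticalClosedStrip 0 1)]
      fun _ => (1 : ℝ) := by
  obtain ⟨B, hB⟩ := exists_norm_amplitudeForm_le ha hg hg2 hh hh2 M
  refine isBigO_principal.2 ⟨B, fun ζ hζ => ?_⟩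
  rw [norm_one, mul_one]
  refine hB _ ?_
  rw [re_mul_ofReal]
  exact mul_le_of_le_one_left hM hζ.2

lemma isBigO_steinFamily (ha : IsAmplitude a) (hp : 0 < p) (hf : Integrable f) :
    steinFamily a p f =O[𝓟 (verticalClosedStrip 0 1)] fun _ => (1 : ℝ) := by
  rw [funext (steinFamily_eq_sum ha hf)]
  refine IsBigO.fun_sum fun q hq => ?_
  obtain ⟨hc, hd⟩ := Finset.mem_product.1 hq
  replace hc : q.1 ≠ 0 := (Finset.mem_filter.1 hc).2
  replace hd : q.2 ≠ 0 := (Finset.mem_filter.1 hd).2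
  have form_bdd := isBigO_amplitudeForm_strip ha (integrable_indicator_preimage hf hc)
    (memLp_two_indicator_preimage hf hc) (integrable_indicator_preimage hf hd)
    (memLp_two_indicator_preimage hf hd)
    (by positivity : (0 : ℝ) ≤ (Module.finrank ℝ V + 1) / 2)
  simpa using ((isBigO_phasePow_strip hp q.1).mul (isBigO_phasePow_strip hp (conj q.2))).mul
    form_bdd

lemma abs_mul_norm_steinFamily_le_of_re_eq_zero (ha : IsAmplitude a) (hp : 0 < p)
    (hf : Integrable f) {ζ : ℂ} (hζ : ζ.re = 0) {τ : ℝ}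
    (hτ : τ = ζ.im * ((Module.finrank ℝ V + 1) / 2)) :
    |τ| * ‖steinFamily a p f ζ‖ ≤ (3 + |τ| * (3 + |τ|)) * ∫ x, ‖f x‖ ^ p := by
  have endpoint := abs_mul_norm_amplitudeForm_mul_I_le ha (integrable_analyticFamily (p := p) hf ζ)
    (memLp_two_analyticFamily hf ζ) (integrable_analyticFamily (p := p) hf (conj ζ))
    (memLp_two_analyticFamily hf (conj ζ)) τ
  have exponent_eq : (τ : ℂ) * I = ζ * ((Module.finrank ℝ V + 1) / 2 : ℝ) := by
    conv_rhs => rw [← re_add_im ζ, hζ]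
    rw [hτ]
    push_cast
    ring
  rwa [integral_norm_sq_analyticFamily hp hζ,
    integral_norm_sq_analyticFamily hp ((conj_re ζ).trans hζ), add_self_div_two, exponent_eq]
    at endpoint

lemma norm_steinFamily_le_of_re_eq_one (ha : IsAmplitude a) (hp : 0 < p)
    (hf : Integrable f) {ζ : ℂ} (hζ : ζ.re = 1) {τ : ℝ}
    (hτ : τ = ζ.im * ((Module.finrank ℝ V + 1) / 2)) :
    ‖steinFamily a p f ζ‖ ≤ (12 + 8 * |τ|) * (∫ x, ‖f x‖ ^ p) ^ 2 := by
  have endpoint := norm_amplitudeForm_le_integral_norm_mul ha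
    (integrable_analyticFamily (p := p) hf ζ) (memLp_two_analyticFamily hf ζ)
    (integrable_analyticFamily (p := p) hf (conj ζ)) (memLp_two_analyticFamily hf (conj ζ)) τ
  have exponent_eq : ((Module.finrank ℝ V + 1) / 2 + τ * I : ℂ) =
      ζ * ((Module.finrank ℝ V + 1) / 2 : ℝ) := by
    conv_rhs => rw [← re_add_im ζ, hζ]
    rw [hτ]
    push_cast
    ring
  rwa [integral_norm_analyticFamily hp hζ,
    integral_norm_analyticFamily hp ((conj_re ζ).trans hζ), exponent_eq, ← sq] at endpoint

lemma norm_mul_steinFamily_le_of_re_eq_zero (ha : IsAmplitude a) (hp : 0 < p) (hf : Integrable f)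
    {ζ : ℂ} (hζ : ζ.re = 0) :
    ‖ζ‖ * ‖steinFamily a p f ζ‖ ≤
      12 * (Module.finrank ℝ V + 1) ^ 2 * (∫ x, ‖f x‖ ^ p) * ‖ζ + 2‖ ^ 2 := by
  have endpoint := abs_mul_norm_steinFamily_le_of_re_eq_zero ha hp hf hζ rfl
  set M : ℝ := Module.finrank ℝ V + 1
  set P := ∫ x, ‖f x‖ ^ p
  set r := ‖ζ + 2‖
  set τ : ℝ := ζ.im * (M / 2)
  have hP : 0 ≤ P := integral_nonneg fun x => by positivity
  have hM1 : 1 ≤ M := le_add_of_nonneg_left (Nat.cast_nonneg _)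
  have hr : 2 ≤ r := two_le_norm_add_two hζ.ge
  have hMr : 2 ≤ M * r := by nlinarith
  have abs_τ : |τ| = ‖ζ‖ * (M / 2) := by
    rw [abs_mul, abs_im_eq_norm.2 hζ, abs_of_nonneg (div_nonneg (by linarith) two_pos.le)]
  have hτ : |τ| ≤ M * r := by
    have := norm_le_norm_add_two hζ.ge
    rw [abs_τ]
    nlinarith [norm_nonneg ζ]
  calc ‖ζ‖ * ‖steinFamily a p f ζ‖ ≤ 2 * (|τ| * ‖steinFamily a p f ζ‖) := by
        rw [abs_τ, ← mul_assoc]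
        gcongr
        nlinarith [norm_nonneg ζ]
    _ ≤ 2 * ((3 + |τ| * (3 + |τ|)) * P) := by gcongr
    _ ≤ 2 * ((3 + M * r * (3 + M * r)) * P) := by gcongr
    _ ≤ 12 * (M * r) ^ 2 * P := by
        rw [← mul_assoc]
        exact mul_le_mul_of_nonneg_right (by nlinarith) hP
    _ = 12 * M ^ 2 * P * r ^ 2 := by ring

lemma norm_mul_steinFamily_le_of_re_eq_one (ha : IsAmplitude a) (hp : 0 < p) (hf : Integrable f)
    {ζ : ℂ} (hζ : ζ.re = 1) :
    ‖ζ‖ * ‖steinFamily a p f ζ‖ ≤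
      12 * (Module.finrank ℝ V + 1) ^ 2 * (∫ x, ‖f x‖ ^ p) ^ 2 * ‖ζ + 2‖ ^ 2 := by
  have endpoint := norm_steinFamily_le_of_re_eq_one ha hp hf hζ rfl
  set M : ℝ := Module.finrank ℝ V + 1
  set P := ∫ x, ‖f x‖ ^ p
  set r := ‖ζ + 2‖
  set τ : ℝ := ζ.im * (M / 2)
  have hre : 0 ≤ ζ.re := hζ ▸ zero_le_one
  have hM1 : 1 ≤ M := le_add_of_nonneg_left (Nat.cast_nonneg _)
  have hr : 2 ≤ r := two_le_norm_add_two hre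
  have hζr : ‖ζ‖ ≤ r := norm_le_norm_add_two hre
  have hτ : |τ| ≤ M * r / 2 := by
    have := (abs_im_le_norm ζ).trans hζr
    rw [abs_mul, abs_of_nonneg (by linarith : 0 ≤ M / 2)]
    nlinarith
  calc ‖ζ‖ * ‖steinFamily a p f ζ‖ ≤ r * ((12 + 8 * |τ|) * P ^ 2) := by gcongr
    _ ≤ r * (12 * (M * r) * P ^ 2) := by
        gcongr
        nlinarith
    _ = 12 * M * P ^ 2 * r ^ 2 := by ring
    _ ≤ 12 * M ^ 2 * P ^ 2 * r ^ 2 := by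
        gcongr
        nlinarith

lemma norm_amplitudeForm_simpleFunc_le (ha : IsAmplitude a) (hf : Integrable f) {θ : ℝ}
    (hθ0 : 0 < θ) (hθ1 : θ ≤ 1) (hp : p * (1 + θ) = 2) :
    ‖amplitudeForm a (θ * ((Module.finrank ℝ V + 1) / 2 : ℝ)) f f‖ ≤
      108 * (Module.finrank ℝ V + 1) ^ 2 / θ * (∫ x, ‖f x‖ ^ p) ^ (2 / p) := by
  have hp0 : 0 < p := pos_of_mul_pos_left (hp ▸ two_pos) (by positivity)
  have steinFamily_θ : steinFamily a p f θ =
      amplitudeForm a (θ * ((Module.finrank ℝ V + 1) / 2 : ℝ)) f f := by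
    rw [steinFamily, conj_ofReal, analyticFamily_eq_self hp]
  set L : ℝ := 12 * (Module.finrank ℝ V + 1) ^ 2
  set P := ∫ x, ‖f x‖ ^ p
  have hP : 0 ≤ P := integral_nonneg fun x => by positivity
  have hL : 0 ≤ L := by positivity
  have interpolation := norm_le_of_norm_mul_le_on_strip_boundary (differentiable_steinFamily ha hf)
    (isBigO_steinFamily ha hp0 hf) (fun ζ => norm_mul_steinFamily_le_of_re_eq_zero ha hp0 hf)
    (fun ζ => norm_mul_steinFamily_le_of_re_eq_one ha hp0 hf) hθ0 hθ1
  have exponents : P ^ (1 - θ) * (P ^ 2) ^ θ = P ^ (2 / p) := by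
    rw [← Real.rpow_natCast_mul hP, ← Real.rpow_add' hP (by push_cast; linarith),
      ← hp, mul_div_cancel_left₀ _ hp0.ne']
    congr 1
    push_cast
    ring
  have constants : L ^ (1 - θ) * L ^ θ = L := by
    rw [← Real.rpow_add' hL (by simp), sub_add_cancel, Real.rpow_one]
  calc ‖amplitudeForm a (θ * ((Module.finrank ℝ V + 1) / 2 : ℝ)) f f‖
      ≤ 9 / θ * ((L * P) ^ (1 - θ) * (L * P ^ 2) ^ θ) := steinFamily_θ ▸ interpolation
    _ = 9 / θ * (L ^ (1 - θ) * L ^ θ * (P ^ (1 - θ) * (P ^ 2) ^ θ)) := by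
        rw [Real.mul_rpow hL hP, Real.mul_rpow hL (by positivity)]
        ring
    _ = 108 * (Module.finrank ℝ V + 1) ^ 2 / θ * P ^ (2 / p) := by
        rw [exponents, constants]
        ring

end SteinFamily

section InterpolatedEstimate

open Complex
open scoped ComplexConjugate

variable {V : Type*} [NormedAddCommGroup V] [InnerProductSpace ℝ V] [FiniteDimensional ℝ V]
  [MeasurableSpace V] [BorelSpace V] {a : ℝ → ℝ} {F : ℕ → V → ℂ} {f : V → ℂ} {b : V → ℝ}

lemma tendsto_schrodingerForm (hF : ∀ k, Integrable (F k)) (hF2 : ∀ k, MemLp (F k) 2)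
    (hf : Integrable f) (hf2 : MemLp f 2) (hb : Integrable b) (hFb : ∀ k x, ‖F k x‖ ≤ b x)
    (hlim : ∀ x, Tendsto (fun k => F k x) atTop (𝓝 (f x))) {s : ℝ} (hs : 0 < s) :
    Tendsto (fun k => schrodingerForm s (F k) (F k)) atTop (𝓝 (schrodingerForm s f f)) := by
  simp only [fun k => schrodingerForm_eq_kernel (hF k) (hF2 k) (hF k) (hF2 k) hs,
    schrodingerForm_eq_kernel hf hf2 hf hf2 hs]
  refine Tendsto.const_mul _ (tendsto_integral_of_dominated_convergence
    (fun q => b q.1 * b q.2) (fun k => ?_) (hb.mul_prod hb) (fun k => .of_forall fun q => ?_)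
    (.of_forall fun q => ?_))
  · exact (integrable_mul_conj_prod (hF k) (hF k)).aestronglyMeasurable.mul
      (by fun_prop : Continuous fun q : V × V =>
        exp (I * (s + (‖q.2 - q.1‖ / 2) ^ 2 / s : ℝ))).aestronglyMeasurable
  · rw [norm_mul, norm_mul, norm_exp_I_mul_ofReal, mul_one, RCLike.norm_conj]
    exact mul_le_mul (hFb k _) (hFb k _) (norm_nonneg _) ((norm_nonneg _).trans (hFb k _))
  · exact ((hlim q.1).mul ((continuous_conj.tendsto _).comp (hlim q.2))).mul_const _

lemma tendsto_amplitudeForm (ha : IsAmplitude a) (hF : ∀ k, Integrable (F k))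
    (hF2 : ∀ k, MemLp (F k) 2) (hf : Integrable f) (hf2 : MemLp f 2) (hb : Integrable b)
    (hb2 : MemLp b 2) (hFb : ∀ k x, ‖F k x‖ ≤ b x)
    (hlim : ∀ x, Tendsto (fun k => F k x) atTop (𝓝 (f x))) (z : ℂ) :
    Tendsto (fun k => amplitudeForm a z (F k) (F k)) atTop (𝓝 (amplitudeForm a z f f)) := by
  have norm_form_le : ∀ k s, ‖schrodingerForm s (F k) (F k)‖ ≤ ∫ x, b x ^ 2 := fun k s => by
    have energy := norm_schrodingerForm_le (hF k) (hF2 k) (hF k) (hF2 k) s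
    rw [add_self_div_two] at energy
    exact energy.trans (integral_mono ((hF2 k).integrable_norm_pow two_ne_zero) hb2.integrable_sq
      fun x => pow_le_pow_left₀ (norm_nonneg _) (hFb k x) 2)
  refine tendsto_integral_of_dominated_convergence
    (fun s => ‖a s • (s : ℂ) ^ (z - 1)‖ * ∫ x, b x ^ 2) (fun k => ?_) ?_
    (fun k => .of_forall fun s => ?_) ?_
  · exact (integrableOn_smul_cpow_mul_schrodingerForm ha (hF k) (hF2 k) (hF k) (hF2 k)
      (z - 1)).aestronglyMeasurable
  · exact (ha.integrableOn_smul_cpow (z - 1)).norm.mul_const _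
  · rw [← smul_mul_assoc, norm_mul]
    gcongr
    exact norm_form_le k s
  · filter_upwards [ae_restrict_mem measurableSet_Ioi] with s (hs : 1 < s)
    exact ((tendsto_schrodingerForm hF hF2 hf hf2 hb hFb hlim
      (zero_lt_one.trans hs)).const_mul _).const_smul _

lemma norm_amplitudeForm_le_integral_norm_rpow (ha : IsAmplitude a) (hfm : Measurable f)
    (hf : Integrable f) (hf2 : MemLp f 2) {p θ : ℝ} (hfp : Integrable fun x => ‖f x‖ ^ p)
    (hθ0 : 0 < θ) (hθ1 : θ ≤ 1) (hp : p * (1 + θ) = 2) :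
    ‖amplitudeForm a (θ * ((Module.finrank ℝ V + 1) / 2 : ℝ)) f f‖ ≤
      108 * (Module.finrank ℝ V + 1) ^ 2 / θ * (∫ x, ‖f x‖ ^ p) ^ (2 / p) := by
  have hp0 : 0 < p := pos_of_mul_pos_left (hp ▸ two_pos) (by positivity)
  set F : ℕ → SimpleFunc V ℂ := SimpleFunc.approxOn f hfm Set.univ 0 (Set.mem_univ _)
  have hFb : ∀ k x, ‖F k x‖ ≤ 2 * ‖f x‖ := fun k x =>
    (SimpleFunc.norm_approxOn_zero_le hfm (s := Set.univ) (Set.mem_univ _) x k).trans (two_mul _).ge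
  have hlim : ∀ x, Tendsto (fun k => F k x) atTop (𝓝 (f x)) := fun x =>
    SimpleFunc.tendsto_approxOn hfm (Set.mem_univ _) (subset_closure (Set.mem_univ _))
  have hF : ∀ k, Integrable (F k) := fun k =>
    (hf.norm.const_mul 2).mono' (F k).aestronglyMeasurable (.of_forall (hFb k))
  have hF2 : ∀ k, MemLp (F k) 2 := fun k =>
    (SimpleFunc.memLp_iff_integrable two_ne_zero ENNReal.ofNat_ne_top).2 (hF k)
  have forms_tendsto := tendsto_amplitudeForm ha hF hF2 hf hf2 (hf.norm.const_mul 2)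
    (hf2.norm.const_mul 2) hFb hlim (θ * ((Module.finrank ℝ V + 1) / 2 : ℝ))
  have norms_tendsto : Tendsto (fun k => ∫ x, ‖F k x‖ ^ p) atTop (𝓝 (∫ x, ‖f x‖ ^ p)) := by
    refine tendsto_integral_of_dominated_convergence (fun x => 2 ^ p * ‖f x‖ ^ p)
      (fun k => ((F k).measurable.norm.pow_const p).aestronglyMeasurable) (hfp.const_mul _)
      (fun k => .of_forall fun x => ?_)
      (.of_forall fun x => (hlim x).norm.rpow_const (Or.inr hp0.le))
    rw [Real.norm_of_nonneg (by positivity), ← Real.mul_rpow two_pos.le (norm_nonneg _)]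
    exact Real.rpow_le_rpow (norm_nonneg _) (hFb k x) hp0.le
  exact le_of_tendsto_of_tendsto' forms_tendsto.norm
    ((norms_tendsto.rpow_const (Or.inr (by positivity))).const_mul _)
    fun k => norm_amplitudeForm_simpleFunc_le ha (hF k) hθ0 hθ1 hp

end InterpolatedEstimate

section ResolventWeight

open Set

variable {α ε s t u : ℝ}

/-- The weight `(ε² + u²)^{-α}`, to be evaluated at `u = 1 - |ξ|²`. -/
noncomputable def resolventWeight (α ε u : ℝ) : ℝ := (ε ^ 2 + u ^ 2) ^ (-α)

lemma resolventWeight_nonneg (α ε u : ℝ) : 0 ≤ resolventWeight α ε u :=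
  Real.rpow_nonneg (by positivity) _

lemma resolventWeight_neg (α ε u : ℝ) : resolventWeight α ε (-u) = resolventWeight α ε u := by
  rw [resolventWeight, neg_sq, resolventWeight]

lemma norm_resolventWeight_le (hα : 0 ≤ α) (hε : ε ≠ 0) (u : ℝ) :
    ‖resolventWeight α ε u‖ ≤ (ε ^ 2) ^ (-α) := by
  rw [Real.norm_of_nonneg (resolventWeight_nonneg _ _ _)]
  exact Real.rpow_le_rpow_of_nonpos (by positivity) (by linarith [sq_nonneg u]) (by linarith)

lemma resolventWeight_anti (hα : 0 ≤ α) (hs : 0 ≤ s) (hst : s ≤ t) (hu : u ≠ 0) :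
    resolventWeight α t u ≤ resolventWeight α s u :=
  Real.rpow_le_rpow_of_nonpos (by positivity) (by gcongr) (by linarith)

lemma continuous_resolventWeight (hε : ε ≠ 0) : Continuous (resolventWeight α ε) :=
  Continuous.rpow_const (by fun_prop) fun u => Or.inl (by positivity)

lemma measurable_resolventWeight (α ε : ℝ) : Measurable (resolventWeight α ε) := by
  unfold resolventWeight
  fun_prop

lemma resolventWeight_zero (hu : 0 < u) : resolventWeight α 0 u = u ^ (-(2 * α)) := by
  rw [resolventWeight, zero_pow two_ne_zero, zero_add, ← Real.rpow_two, ← Real.rpow_mul hu.le,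
    mul_neg]

lemma resolventWeight_mul_mul (α ε : ℝ) (hs : 0 < s) (u : ℝ) :
    resolventWeight α (ε * s) (s * u) = s ^ (-(2 * α)) * resolventWeight α ε u := by
  rw [resolventWeight, resolventWeight,
    show (ε * s) ^ 2 + (s * u) ^ 2 = s ^ 2 * (ε ^ 2 + u ^ 2) by ring,
    Real.mul_rpow (by positivity) (by positivity), ← Real.rpow_two, ← Real.rpow_mul hs.le, mul_neg]

lemma integrable_one_add_sq_rpow (hα : 1 / 2 < α) :
    Integrable fun u : ℝ => (1 + u ^ 2) ^ (-α) := by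
  have h := integrable_rpow_neg_one_add_norm_sq (E := ℝ) (μ := volume) (r := 2 * α)
    (by rw [Module.finrank_self]; push_cast; linarith)
  simpa only [Real.norm_eq_abs, sq_abs, neg_div, mul_div_cancel_left₀ α two_ne_zero] using h

lemma resolventWeight_eq_mul_comp_inv_mul (hε : 0 < ε) (u : ℝ) :
    resolventWeight α ε u = ε ^ (-(2 * α)) * (1 + (ε⁻¹ * u) ^ 2) ^ (-α) := by
  have h := resolventWeight_mul_mul α 1 hε (ε⁻¹ * u)
  rwa [one_mul, mul_inv_cancel_left₀ hε.ne', resolventWeight.eq_1 α 1, one_pow] at h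

lemma integrable_resolventWeight (hα : 1 / 2 < α) (hε : 0 < ε) :
    Integrable (resolventWeight α ε) := by
  simp only [funext (resolventWeight_eq_mul_comp_inv_mul hε)]
  exact ((integrable_one_add_sq_rpow hα).comp_mul_left' (inv_ne_zero hε.ne')).const_mul _

lemma integral_resolventWeight (hε : 0 < ε) :
    ∫ u, resolventWeight α ε u = (∫ u : ℝ, (1 + u ^ 2) ^ (-α)) / ε ^ (2 * α - 1) := by
  simp only [resolventWeight_eq_mul_comp_inv_mul hε]
  rw [integral_const_mul, Measure.integral_comp_mul_left (fun u : ℝ => (1 + u ^ 2) ^ (-α)),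
    inv_inv, abs_of_pos hε, smul_eq_mul, ← mul_assoc, ← Real.rpow_add_one hε.ne',
    div_eq_inv_mul, ← Real.rpow_neg hε.le]
  congr 2
  ring

end ResolventWeight

section CosDefect

open Set

variable {w : ℝ → ℝ}

/-- The defect `ŵ(0) - ŵ(s)` of the cosine transform of the weight `w`. The two halves are kept
under one integral, which may converge although `w` itself is not integrable at the origin. -/
noncomputable def cosDefect (w : ℝ → ℝ) (s : ℝ) : ℝ := ∫ u, (1 - Real.cos (s * u)) * w u

lemma one_sub_cos_nonneg (x : ℝ) : 0 ≤ 1 - Real.cos x := sub_nonneg.2 (Real.cos_le_one x)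

lemma one_sub_cos_le_two (x : ℝ) : 1 - Real.cos x ≤ 2 := by linarith [Real.neg_one_le_cos x]

lemma cosDefect_nonneg (hw : ∀ u, 0 ≤ w u) (s : ℝ) : 0 ≤ cosDefect w s :=
  integral_nonneg fun u => mul_nonneg (one_sub_cos_nonneg _) (hw u)

lemma norm_one_sub_cos_mul_le (x y : ℝ) : ‖(1 - Real.cos x) * y‖ ≤ 2 * ‖y‖ := by
  rw [norm_mul, Real.norm_of_nonneg (one_sub_cos_nonneg _)]
  gcongr
  exact one_sub_cos_le_two _

lemma norm_cosDefect_le (hw : Integrable w) (s : ℝ) : ‖cosDefect w s‖ ≤ 2 * ∫ u, ‖w u‖ := by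
  rw [← integral_const_mul]
  exact norm_integral_le_of_norm_le (hw.norm.const_mul 2)
    (.of_forall fun u => norm_one_sub_cos_mul_le _ _)

lemma continuous_cosDefect (hw : Integrable w) : Continuous (cosDefect w) :=
  continuous_of_dominated
    (fun s =>
      (by fun_prop : Continuous fun u => 1 - Real.cos (s * u)).aestronglyMeasurable.mul hw.1)
    (fun s => .of_forall fun u => norm_one_sub_cos_mul_le _ _) (hw.norm.const_mul 2)
    (.of_forall fun u => by fun_prop)

variable {α ε s t : ℝ}

lemma integrableOn_Ioc_one_sub_cos_mul_resolventWeight (hα : α < 3 / 2) :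
    IntegrableOn (fun u => (1 - Real.cos u) * resolventWeight α 0 u) (Ioc 0 1) := by
  have dominant : IntegrableOn (fun u : ℝ => u ^ (2 - 2 * α)) (Ioc 0 1) :=
    (intervalIntegrable_iff_integrableOn_Ioc_of_le zero_le_one).1
      (intervalIntegral.intervalIntegrable_rpow' (by linarith))
  refine dominant.mono' ((by fun_prop : Measurable fun u => 1 - Real.cos u).mul
    (measurable_resolventWeight α 0)).aestronglyMeasurable ?_
  filter_upwards [ae_restrict_mem measurableSet_Ioc] with u hu
  rw [Real.norm_of_nonneg (mul_nonneg (one_sub_cos_nonneg u) (resolventWeight_nonneg _ _ _)),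
    resolventWeight_zero hu.1, sub_eq_add_neg 2, Real.rpow_add hu.1, Real.rpow_two]
  gcongr
  · exact Real.rpow_nonneg hu.1.le _
  · linarith [Real.one_sub_sq_div_two_le_cos (x := u), sq_nonneg u]

lemma integrableOn_Ioi_one_sub_cos_mul_resolventWeight (hα : 1 / 2 < α) :
    IntegrableOn (fun u => (1 - Real.cos u) * resolventWeight α 0 u) (Ioi 1) := by
  have dominant : IntegrableOn (fun u : ℝ => 2 * u ^ (-(2 * α))) (Ioi 1) :=
    (integrableOn_Ioi_rpow_of_lt (by linarith) one_pos).const_mul 2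
  refine dominant.mono' ((by fun_prop : Measurable fun u => 1 - Real.cos u).mul
    (measurable_resolventWeight α 0)).aestronglyMeasurable ?_
  filter_upwards [ae_restrict_mem measurableSet_Ioi] with u hu
  have hu0 : 0 < u := zero_lt_one.trans hu
  rw [← resolventWeight_zero hu0, ← Real.norm_of_nonneg (resolventWeight_nonneg α 0 u)]
  convert norm_one_sub_cos_mul_le u (resolventWeight α 0 u) using 1
  simp only [norm_norm, norm_mul]

lemma integrable_of_even_of_integrableOn_Ioi {f : ℝ → ℝ} (hf : ∀ u, f (-u) = f u)
    (h : IntegrableOn f (Ioi 0)) : Integrable f := by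
  have left : IntegrableOn f (Iic 0) := by
    rw [integrableOn_Iic_iff_integrableOn_Iio, ← neg_zero, ← neg_Ioi]
    exact ((Measure.measurePreserving_neg (volume : Measure ℝ)).integrableOn_comp_preimage
      (Homeomorph.neg ℝ).measurableEmbedding).2 h |>.congr_fun (fun u _ => hf u)
      measurableSet_Ioi.neg
  rw [← integrableOn_univ, ← Iic_union_Ioi (a := (0 : ℝ))]
  exact left.union h

lemma integrable_one_sub_cos_mul_resolventWeight (hα₁ : 1 / 2 < α) (hα₂ : α < 3 / 2)
    (hs : 0 ≤ s) : Integrable fun u => (1 - Real.cos u) * resolventWeight α s u := by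
  have at_zero : Integrable fun u => (1 - Real.cos u) * resolventWeight α 0 u := by
    refine integrable_of_even_of_integrableOn_Ioi
      (fun u => by rw [Real.cos_neg, resolventWeight_neg]) ?_
    rw [← Ioc_union_Ioi_eq_Ioi zero_le_one]
    exact (integrableOn_Ioc_one_sub_cos_mul_resolventWeight hα₂).union
      (integrableOn_Ioi_one_sub_cos_mul_resolventWeight hα₁)
  refine at_zero.mono' ((by fun_prop : Measurable fun u => 1 - Real.cos u).mul
    (measurable_resolventWeight α s)).aestronglyMeasurable ?_
  filter_upwards [Measure.ae_ne volume 0] with u hu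
  rw [Real.norm_of_nonneg (mul_nonneg (one_sub_cos_nonneg u) (resolventWeight_nonneg _ _ _))]
  exact mul_le_mul_of_nonneg_left (resolventWeight_anti (by linarith) le_rfl hs hu)
    (one_sub_cos_nonneg u)

lemma cosDefect_resolventWeight_anti (hα₁ : 1 / 2 < α) (hα₂ : α < 3 / 2) (hs : 0 ≤ s)
    (hst : s ≤ t) : cosDefect (resolventWeight α t) 1 ≤ cosDefect (resolventWeight α s) 1 := by
  simp only [cosDefect, one_mul]
  refine integral_mono_ae (integrable_one_sub_cos_mul_resolventWeight hα₁ hα₂ (hs.trans hst))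
    (integrable_one_sub_cos_mul_resolventWeight hα₁ hα₂ hs) ?_
  filter_upwards [Measure.ae_ne volume 0] with u hu
  exact mul_le_mul_of_nonneg_left (resolventWeight_anti (by linarith) hs hst hu)
    (one_sub_cos_nonneg u)

lemma cosDefect_resolventWeight (α ε : ℝ) (hs : 0 < s) :
    cosDefect (resolventWeight α ε) s =
      s ^ (2 * α - 1) * cosDefect (resolventWeight α (ε * s)) 1 := by
  have rescale (u : ℝ) : (1 - Real.cos (s * u)) * resolventWeight α ε u =
      s ^ (2 * α) * ((1 - Real.cos (1 * (s * u))) * resolventWeight α (ε * s) (s * u)) := by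
    rw [resolventWeight_mul_mul α ε hs, one_mul, mul_left_comm (1 - _), ← mul_assoc (s ^ _),
      ← Real.rpow_add hs, add_neg_cancel, Real.rpow_zero, one_mul]
  simp only [cosDefect, rescale]
  rw [integral_const_mul, Measure.integral_comp_mul_left
    (fun u => (1 - Real.cos (1 * u)) * resolventWeight α (ε * s) u), abs_of_pos (inv_pos.2 hs),
    smul_eq_mul, ← mul_assoc, Real.rpow_sub_one hs.ne', div_eq_mul_inv]

lemma isAmplitude_exp_mul_cosDefect (hα₁ : 1 / 2 < α) (hα₂ : α < 3 / 2) {δ : ℝ} (hε : 0 < ε)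
    (hδ : 0 < δ) :
    IsAmplitude fun s => Real.exp (-δ * s) *
      (cosDefect (resolventWeight α (ε * s)) 1 / cosDefect (resolventWeight α 0) 1) := by
  have defect_nonneg : ∀ s, 0 ≤ cosDefect (resolventWeight α s) 1 := fun s =>
    cosDefect_nonneg (resolventWeight_nonneg α s) 1
  have quotient_nonneg : ∀ s,
      0 ≤ cosDefect (resolventWeight α (ε * s)) 1 / cosDefect (resolventWeight α 0) 1 := fun s =>
    div_nonneg (defect_nonneg _) (defect_nonneg _)
  have quotient_le_one : ∀ s, 1 ≤ s →
      cosDefect (resolventWeight α (ε * s)) 1 / cosDefect (resolventWeight α 0) 1 ≤ 1 :=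
    fun s hs => div_le_one_of_le₀
      (cosDefect_resolventWeight_anti hα₁ hα₂ le_rfl (by positivity)) (defect_nonneg _)
  refine ⟨fun s hs t _ hst => ?_, ?_, δ, hδ, ?_⟩
  · have hs0 : (0 : ℝ) ≤ s := zero_le_one.trans hs
    gcongr ?_ * (?_ / _)
    · exact quotient_nonneg _
    · rw [Real.exp_le_exp]
      nlinarith
    · exact defect_nonneg _
    · exact cosDefect_resolventWeight_anti hα₁ hα₂ (by positivity) (by gcongr)
  · exact mul_le_one₀ (Real.exp_le_one_iff.2 (by linarith)) (quotient_nonneg _)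
      (quotient_le_one 1 le_rfl)
  · refine .of_bound 1 ?_
    filter_upwards [eventually_ge_atTop 1] with s hs
    rw [norm_mul, Real.norm_of_nonneg (quotient_nonneg s), one_mul]
    exact mul_le_of_le_one_right (norm_nonneg _) (quotient_le_one s hs)

end CosDefect

section PoissonKernel

open Set
open scoped Real

variable {δ : ℝ}

/-- The Poisson kernel of the upper half-plane at height `δ`, without the normalising factor
`1 / π`; it is the cosine transform of `s ↦ exp (-δ s)` on the half-line. -/
noncomputable def poissonKernelReal (δ l : ℝ) : ℝ := δ / (δ ^ 2 + l ^ 2)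

lemma poissonKernelReal_eq (hδ : 0 < δ) (l : ℝ) :
    poissonKernelReal δ l = δ⁻¹ * (1 + (δ⁻¹ * l) ^ 2)⁻¹ := by
  rw [poissonKernelReal]
  field_simp

lemma norm_poissonKernelReal_le (hδ : 0 < δ) (l : ℝ) : ‖poissonKernelReal δ l‖ ≤ δ⁻¹ := by
  rw [poissonKernelReal_eq hδ, Real.norm_of_nonneg (by positivity)]
  exact mul_le_of_le_one_right (by positivity) (inv_le_one_of_one_le₀ (by nlinarith))

lemma continuous_poissonKernelReal (hδ : 0 < δ) : Continuous (poissonKernelReal δ) :=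
  continuous_const.div (by fun_prop) fun l => by positivity

lemma integrableOn_exp_neg_mul (hδ : 0 < δ) :
    IntegrableOn (fun s => Real.exp (-δ * s)) (Ioi 0) :=
  integrableOn_exp_mul_Ioi (neg_lt_zero.2 hδ) 0

lemma integrableOn_exp_mul_cos (hδ : 0 < δ) (l : ℝ) :
    IntegrableOn (fun s => Real.exp (-δ * s) * Real.cos (l * s)) (Ioi 0) :=
  (integrableOn_exp_neg_mul hδ).mul_bdd (c := 1) (by fun_prop)
    (.of_forall fun s => Real.abs_cos_le_one _)

lemma integral_exp_mul_cos (hδ : 0 < δ) (l : ℝ) :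
    ∫ s in Ioi 0, Real.exp (-δ * s) * Real.cos (l * s) = poissonKernelReal δ l := by
  have hre : (-δ + l * Complex.I : ℂ).re < 0 := by simpa using hδ
  have as_re : ∀ s : ℝ, Real.exp (-δ * s) * Real.cos (l * s) =
      RCLike.re (Complex.exp ((-δ + l * Complex.I) * s)) := fun s => by
    simp [Complex.exp_re]
  simp only [as_re]
  rw [integral_re (integrableOn_exp_mul_complex_Ioi hre 0), integral_exp_mul_complex_Ioi hre 0]
  simp [Complex.div_re, Complex.normSq_apply, poissonKernelReal, sq]

variable {g k : ℝ → ℝ} {l M : ℝ}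

lemma integral_mul_poissonKernelReal_comp (g k : ℝ → ℝ) (l : ℝ) (hδ : 0 < δ) :
    ∫ u, g u * poissonKernelReal δ (k u) =
      ∫ t, g (l + δ * t) * (1 + (δ⁻¹ * k (l + δ * t)) ^ 2)⁻¹ := by
  rw [← integral_add_left_eq_self _ l]
  have scale := Measure.integral_comp_mul_left
    (fun u => g (l + u) * poissonKernelReal δ (k (l + u))) δ
  rw [abs_of_pos (inv_pos.2 hδ), smul_eq_mul, eq_inv_mul_iff_mul_eq₀ hδ.ne',
    ← integral_const_mul] at scale
  rw [← scale]
  congr 1 with t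
  rw [poissonKernelReal_eq hδ, mul_left_comm (g _), mul_inv_cancel_left₀ hδ.ne']

lemma norm_mul_inv_one_add_sq_le (hgM : ∀ u, ‖g u‖ ≤ M)
    (hgk : ∀ u, g u ≠ 0 → |u - l| ≤ |k u|) (hδ : 0 < δ) (t : ℝ) :
    ‖g (l + δ * t) * (1 + (δ⁻¹ * k (l + δ * t)) ^ 2)⁻¹‖ ≤ M * (1 + t ^ 2)⁻¹ := by
  have hM : 0 ≤ M := (norm_nonneg _).trans (hgM 0)
  by_cases hg : g (l + δ * t) = 0
  · rw [hg, zero_mul, norm_zero]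
    positivity
  · have ht : |t| ≤ |δ⁻¹ * k (l + δ * t)| := by
      rw [abs_mul, abs_of_pos (inv_pos.2 hδ), le_inv_mul_iff₀ hδ, ← abs_of_pos hδ, ← abs_mul,
        abs_of_pos hδ]
      simpa only [add_sub_cancel_left] using hgk _ hg
    rw [norm_mul, norm_inv, Real.norm_of_nonneg (by positivity : (0 : ℝ) ≤ 1 + _ ^ 2)]
    gcongr ?_ * (1 + ?_)⁻¹
    · exact hgM _
    · exact sq_le_sq.2 ht

lemma norm_integral_mul_poissonKernelReal_comp_le (hgM : ∀ u, ‖g u‖ ≤ M)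
    (hgk : ∀ u, g u ≠ 0 → |u - l| ≤ |k u|) (hδ : 0 < δ) :
    ‖∫ u, g u * poissonKernelReal δ (k u)‖ ≤ M * π := by
  rw [integral_mul_poissonKernelReal_comp g k l hδ, ← integral_univ_inv_one_add_sq,
    ← integral_const_mul]
  exact norm_integral_le_of_norm_le (integrable_inv_one_add_sq.const_mul M)
    (.of_forall (norm_mul_inv_one_add_sq_le hgM hgk hδ))

lemma tendsto_integral_mul_poissonKernelReal_comp {c : ℝ} (hg : Measurable g)
    (hgM : ∀ u, ‖g u‖ ≤ M) (hgl : ContinuousAt g l) (hk : Measurable k) (hkl : k l = 0)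
    (hk' : HasDerivAt k c l) (hgk : ∀ u, g u ≠ 0 → |u - l| ≤ |k u|) :
    Tendsto (fun δ => ∫ u, g u * poissonKernelReal δ (k u)) (𝓝[>] 0) (𝓝 (g l * (|c⁻¹| * π))) := by
  have arg_tendsto : ∀ t, Tendsto (fun δ : ℝ => l + δ * t) (𝓝[>] 0) (𝓝 l) := fun t => by
    have h : Continuous fun δ : ℝ => l + δ * t := by fun_prop
    simpa only [zero_mul, add_zero] using (h.tendsto 0).mono_left nhdsWithin_le_nhds
  have slope_tendsto : ∀ t, Tendsto (fun δ => δ⁻¹ * k (l + δ * t)) (𝓝[>] 0) (𝓝 (c * t)) :=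
    fun t => by
    have deriv_zero : HasDerivAt (fun δ => k (l + δ * t)) (c * t) 0 := by
      have inner : HasDerivAt (fun δ : ℝ => l + δ * t) t 0 := by
        simpa only [id, one_mul] using ((hasDerivAt_id (0 : ℝ)).mul_const t).const_add l
      exact HasDerivAt.comp 0 (by rwa [zero_mul, add_zero]) inner
    simpa only [zero_add, zero_mul, add_zero, hkl, sub_zero, smul_eq_mul] using
      deriv_zero.tendsto_slope_zero_right
  have limit : Tendsto (fun δ => ∫ t, g (l + δ * t) * (1 + (δ⁻¹ * k (l + δ * t)) ^ 2)⁻¹) (𝓝[>] 0)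
      (𝓝 (∫ t, g l * (1 + (c * t) ^ 2)⁻¹)) := by
    refine tendsto_integral_filter_of_dominated_convergence (fun t => M * (1 + t ^ 2)⁻¹)
      (.of_forall fun δ => (by fun_prop : Measurable _).aestronglyMeasurable) ?_
      (integrable_inv_one_add_sq.const_mul M) (.of_forall fun t => ?_)
    · filter_upwards [self_mem_nhdsWithin] with δ hδ
      exact .of_forall (norm_mul_inv_one_add_sq_le hgM hgk hδ)
    · exact (hgl.tendsto.comp (arg_tendsto t)).mul
        ((((slope_tendsto t).pow 2).const_add 1).inv₀ (by positivity))
  rw [integral_const_mul, Measure.integral_comp_mul_left (fun t : ℝ => (1 + t ^ 2)⁻¹),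
    integral_univ_inv_one_add_sq, smul_eq_mul] at limit
  refine limit.congr' ?_
  filter_upwards [self_mem_nhdsWithin] with δ hδ
  exact (integral_mul_poissonKernelReal_comp g k l hδ).symm

end PoissonKernel

section PoissonIntegral

open Set
open scoped Real

variable {w : ℝ → ℝ} {δ M : ℝ}

/-- The Poisson extension of `w` to height `δ`, multiplied by `π`. -/
noncomputable def poissonIntegral (w : ℝ → ℝ) (δ l : ℝ) : ℝ :=
  ∫ u, w u * poissonKernelReal δ (l - u)

lemma integrable_mul_poissonKernelReal (hw : Integrable w) (hδ : 0 < δ) (l : ℝ) :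
    Integrable fun u => w u * poissonKernelReal δ (l - u) :=
  hw.mul_bdd (c := δ⁻¹)
    ((continuous_poissonKernelReal hδ).comp (by fun_prop)).aestronglyMeasurable
    (.of_forall fun _ => norm_poissonKernelReal_le hδ _)

lemma continuous_poissonIntegral (hw : Integrable w) (hδ : 0 < δ) :
    Continuous (poissonIntegral w δ) := by
  refine continuous_of_dominated (bound := fun u => ‖w u‖ * δ⁻¹)
    (fun l => (integrable_mul_poissonKernelReal hw hδ l).1) (fun l => .of_forall fun u => ?_)
    (hw.norm.mul_const _)
    (.of_forall fun u => continuous_const.mul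
      ((continuous_poissonKernelReal hδ).comp (by fun_prop)))
  rw [norm_mul]
  gcongr
  exact norm_poissonKernelReal_le hδ _

lemma norm_poissonIntegral_le (hwM : ∀ u, ‖w u‖ ≤ M) (hδ : 0 < δ) (l : ℝ) :
    ‖poissonIntegral w δ l‖ ≤ M * π :=
  norm_integral_mul_poissonKernelReal_comp_le (l := l) hwM
    (fun u _ => (abs_sub_comm u l).le) hδ

lemma tendsto_poissonIntegral (hw : Continuous w) (hwM : ∀ u, ‖w u‖ ≤ M) (l : ℝ) :
    Tendsto (fun δ => poissonIntegral w δ l) (𝓝[>] 0) (𝓝 (w l * π)) := by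
  have h := tendsto_integral_mul_poissonKernelReal_comp (k := fun u => l - u) hw.measurable hwM
    hw.continuousAt (by fun_prop) (sub_self l) ((hasDerivAt_id l).const_sub l)
    (fun u _ => (abs_sub_comm u l).le)
  rwa [inv_neg, inv_one, abs_neg, abs_one, one_mul] at h

lemma integral_sin_mul_eq_zero_of_even (hw : ∀ u, w (-u) = w u) (s : ℝ) :
    ∫ u, Real.sin (s * u) * w u = 0 := by
  refine self_eq_neg.1 ?_
  rw [← integral_neg]
  nth_rw 1 [← integral_neg_eq_self]
  simp only [hw, mul_neg, Real.sin_neg, neg_mul]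

lemma cosDefect_mul_cos (hw : Integrable w) (hw_even : ∀ u, w (-u) = w u) (s l : ℝ) :
    cosDefect w s * Real.cos (l * s) =
      ∫ u, (Real.cos (l * s) - Real.cos ((l - u) * s)) * w u := by
  have cos_part : Integrable fun u => (1 - Real.cos (s * u)) * w u :=
    (hw.norm.const_mul 2).mono' ((by fun_prop : Continuous _).aestronglyMeasurable.mul hw.1)
      (.of_forall fun u => norm_one_sub_cos_mul_le _ _)
  have sin_part : Integrable fun u => Real.sin (s * u) * w u :=
    hw.bdd_mul (c := 1) (by fun_prop) (.of_forall fun u => Real.abs_sin_le_one _)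
  have expand : ∀ u, (Real.cos (l * s) - Real.cos ((l - u) * s)) * w u =
      (1 - Real.cos (s * u)) * w u * Real.cos (l * s) -
        Real.sin (s * u) * w u * Real.sin (l * s) := fun u => by
    rw [sub_mul l, Real.cos_sub, mul_comm u s]
    ring
  simp only [expand]
  rw [integral_sub (cos_part.mul_const _) (sin_part.mul_const _), integral_mul_const,
    integral_mul_const, integral_sin_mul_eq_zero_of_even hw_even, zero_mul, sub_zero, cosDefect]

lemma integral_exp_mul_cosDefect_mul_cos (hw : Integrable w) (hw_even : ∀ u, w (-u) = w u)
    (hδ : 0 < δ) (l : ℝ) :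
    ∫ s in Ioi 0, Real.exp (-δ * s) * cosDefect w s * Real.cos (l * s) =
      (∫ u, w u) * poissonKernelReal δ l - poissonIntegral w δ l := by
  have hprod : Integrable (Function.uncurry fun (s u : ℝ) => Real.exp (-δ * s) * w u *
      (Real.cos (l * s) - Real.cos ((l - u) * s))) ((volume.restrict (Ioi 0)).prod volume) :=
    ((integrableOn_exp_neg_mul hδ).mul_prod hw).mul_bdd (c := 1 + 1) (by fun_prop)
      (.of_forall fun q => (norm_sub_le _ _).trans
        (add_le_add (Real.abs_cos_le_one _) (Real.abs_cos_le_one _)))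
  calc _ = ∫ s in Ioi 0, ∫ u, Real.exp (-δ * s) * w u *
        (Real.cos (l * s) - Real.cos ((l - u) * s)) := by
        simp only [mul_assoc, cosDefect_mul_cos hw hw_even, ← integral_const_mul, mul_comm (w _)]
    _ = ∫ u, ∫ s in Ioi 0, Real.exp (-δ * s) * w u *
        (Real.cos (l * s) - Real.cos ((l - u) * s)) := integral_integral_swap hprod
    _ = ∫ u, (w u * poissonKernelReal δ l - w u * poissonKernelReal δ (l - u)) := by
        congr 1 with u
        simp only [← integral_exp_mul_cos hδ, ← integral_const_mul]
        rw [← integral_sub ((integrableOn_exp_mul_cos hδ l).const_mul _)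
          ((integrableOn_exp_mul_cos hδ (l - u)).const_mul _)]
        congr 1 with s
        ring
    _ = _ := by
        rw [integral_sub (hw.mul_const _) (integrable_mul_poissonKernelReal hw hδ l),
          integral_mul_const, poissonIntegral]

end PoissonIntegral

section Polar

open Set Metric
open scoped Real

variable {V : Type*} [NormedAddCommGroup V] [InnerProductSpace ℝ V] [FiniteDimensional ℝ V]
  [MeasurableSpace V] [BorelSpace V] {h : V → ℝ}

/-- The density in the radius `r = |ξ|` of the measure `h(ξ) dξ`: the integral of `h` over the
sphere of radius `r`, extended by zero to `r ≤ 0`. -/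
noncomputable def radialDensity (h : V → ℝ) : ℝ → ℝ :=
  (Ioi 0).indicator fun r => r ^ (Module.finrank ℝ V - 1) *
    ∫ ω : sphere (0 : V) 1, h (r • (ω : V)) ∂(volume : Measure V).toSphere

lemma integral_volumeIoiPow (n : ℕ) (g : ℝ → ℝ) :
    ∫ r : Ioi (0 : ℝ), g r ∂Measure.volumeIoiPow n = ∫ r in Ioi (0 : ℝ), r ^ n * g r := by
  simp only [Measure.volumeIoiPow, ENNReal.ofReal]
  rw [integral_withDensity_eq_integral_smul (measurable_subtype_coe.pow_const _).real_toNNReal,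
    integral_subtype_comap measurableSet_Ioi fun r : ℝ => Real.toNNReal (r ^ n) • g r]
  refine setIntegral_congr_fun measurableSet_Ioi fun r hr => ?_
  rw [NNReal.smul_def, Real.coe_toNNReal _ (pow_nonneg (mem_Ioi.1 hr).le _), smul_eq_mul]

lemma integral_eq_integral_radialDensity [Nontrivial V] (hh : Integrable h) :
    ∫ ξ, h ξ = ∫ r, radialDensity h r := by
  set σ := (volume : Measure V).toSphere
  set g : sphere (0 : V) 1 × Ioi (0 : ℝ) → ℝ := fun q => h ((q.2 : ℝ) • (q.1 : V)) with hg
  have g_polar : ∀ ξ : ({0}ᶜ : Set V), g (homeomorphUnitSphereProd V ξ) = h ξ := fun ξ => by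
    simp [hg, smul_smul, norm_ne_zero_iff.2 ξ.2]
  have emb := (homeomorphUnitSphereProd V).measurableEmbedding
  have polar := (volume : Measure V).measurePreserving_homeomorphUnitSphereProd
  have hgi : Integrable g (σ.prod (.volumeIoiPow (Module.finrank ℝ V - 1))) := by
    rw [← polar.integrable_comp_emb emb]
    exact ((integrableOn_iff_comap_subtypeVal (measurableSet_singleton _).compl).1
      hh.integrableOn).congr (.of_forall fun ξ => (g_polar ξ).symm)
  calc ∫ ξ, h ξ = ∫ ξ : ({0}ᶜ : Set V), h ξ ∂((volume : Measure V).comap (↑)) := by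
        rw [integral_subtype_comap (measurableSet_singleton _).compl h, restrict_compl_singleton]
    _ = ∫ q, g q ∂σ.prod (.volumeIoiPow (Module.finrank ℝ V - 1)) := by
        rw [← polar.integral_comp emb]
        simp only [g_polar]
    _ = ∫ r : Ioi (0 : ℝ), ∫ ω, h ((r : ℝ) • (ω : V)) ∂σ
        ∂.volumeIoiPow (Module.finrank ℝ V - 1) := integral_prod_symm g hgi
    _ = _ := by
        rw [integral_volumeIoiPow _ fun r => ∫ ω : sphere (0 : V) 1, h (r • (ω : V)) ∂σ,
          ← integral_indicator measurableSet_Ioi, radialDensity]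

lemma radialDensity_mul_comp_norm (h : V → ℝ) (φ : ℝ → ℝ) (r : ℝ) :
    radialDensity (fun ξ => h ξ * φ ‖ξ‖) r = radialDensity h r * φ r := by
  by_cases hr : r ∈ Ioi (0 : ℝ)
  · simp only [radialDensity, indicator_of_mem hr, norm_smul, norm_eq_of_mem_sphere, mul_one,
      Real.norm_of_nonneg (mem_Ioi.1 hr).le, integral_mul_const, mul_assoc]
  · simp only [radialDensity, indicator_of_notMem hr, zero_mul]

lemma radialDensity_one (h : V → ℝ) :
    radialDensity h 1 = ∫ ω : sphere (0 : V) 1, h ω ∂(volume : Measure V).toSphere := by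
  simp only [radialDensity, indicator_of_mem (mem_Ioi.2 one_pos), one_pow, one_mul, one_smul]

lemma continuous_pow_mul_sphereIntegral (hc : Continuous h) (hs : HasCompactSupport h) (N : ℕ) :
    Continuous fun r : ℝ => r ^ N *
      ∫ ω : sphere (0 : V) 1, h (r • (ω : V)) ∂(volume : Measure V).toSphere := by
  obtain ⟨C, hC⟩ := hs.exists_bound_of_continuous hc
  refine (continuous_pow N).mul (continuous_of_dominated (bound := fun _ => C)
    (fun r => (by fun_prop : Continuous fun ω : sphere (0 : V) 1 =>
      h (r • (ω : V))).aestronglyMeasurable) (fun r => .of_forall fun ω => hC _)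
    (integrable_const C) (.of_forall fun ω => by fun_prop))

lemma measurable_radialDensity (hc : Continuous h) (hs : HasCompactSupport h) :
    Measurable (radialDensity h) :=
  (continuous_pow_mul_sphereIntegral hc hs _).measurable.indicator measurableSet_Ioi

lemma continuousAt_radialDensity_one (hc : Continuous h) (hs : HasCompactSupport h) :
    ContinuousAt (radialDensity h) 1 := by
  refine (continuous_pow_mul_sphereIntegral hc hs
    (Module.finrank ℝ V - 1)).continuousAt.congr ?_
  filter_upwards [Ioi_mem_nhds (zero_lt_one' ℝ)] with r hr
  rw [radialDensity, indicator_of_mem hr]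

lemma exists_norm_radialDensity_le (hc : Continuous h) (hs : HasCompactSupport h) :
    ∃ B, ∀ r, ‖radialDensity h r‖ ≤ B := by
  obtain ⟨R, hR⟩ := hs.isCompact.isBounded.exists_norm_le
  obtain ⟨B, hB⟩ := (isCompact_Icc (a := (0 : ℝ)) (b := R)).exists_bound_of_continuousOn
    (continuous_pow_mul_sphereIntegral hc hs (Module.finrank ℝ V - 1)).continuousOn
  refine ⟨max B 0, fun r => ?_⟩
  by_cases hr : r ∈ Ioi (0 : ℝ)
  · rw [radialDensity, indicator_of_mem hr]
    rcases le_or_gt r R with hrR | hrR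
    · exact (hB r ⟨(mem_Ioi.1 hr).le, hrR⟩).trans (le_max_left _ _)
    · have vanish : ∀ ω : sphere (0 : V) 1, h (r • (ω : V)) = 0 := fun ω =>
        image_eq_zero_of_notMem_tsupport fun hω => hrR.not_ge <| by
          simpa only [norm_smul, norm_eq_of_mem_sphere, mul_one,
            Real.norm_of_nonneg (mem_Ioi.1 hr).le] using hR _ hω
      simp only [vanish, integral_zero, mul_zero, norm_zero, le_max_iff, le_refl, or_true]
  · rw [radialDensity, indicator_of_notMem hr, norm_zero]
    exact le_max_right _ _

lemma tendsto_integral_mul_poissonKernelReal_one_sub_norm_sq [Nontrivial V] (hc : Continuous h)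
    (hs : HasCompactSupport h) :
    Tendsto (fun δ => ∫ ξ, h ξ * poissonKernelReal δ (1 - ‖ξ‖ ^ 2)) (𝓝[>] 0)
      (𝓝 ((∫ ω : sphere (0 : V) 1, h ω ∂(volume : Measure V).toSphere) * (π / 2))) := by
  obtain ⟨B, hB⟩ := exists_norm_radialDensity_le hc hs
  have radius_le : ∀ r, radialDensity h r ≠ 0 → |r - 1| ≤ |1 - r ^ 2| := fun r hr => by
    have hr0 : 0 < r := mem_of_indicator_ne_zero hr
    rw [show 1 - r ^ 2 = -((r - 1) * (r + 1)) by ring, abs_neg, abs_mul,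
      abs_of_pos (by linarith : 0 < r + 1)]
    exact le_mul_of_one_le_right (abs_nonneg _) (by linarith)
  have derivative : HasDerivAt (fun r : ℝ => 1 - r ^ 2) (-2) 1 := by
    simpa using (hasDerivAt_pow 2 (1 : ℝ)).const_sub 1
  have limit := tendsto_integral_mul_poissonKernelReal_comp (measurable_radialDensity hc hs) hB
    (continuousAt_radialDensity_one hc hs) (by fun_prop) (by norm_num) derivative radius_le
  rw [radialDensity_one, inv_neg, abs_neg, abs_of_pos (inv_pos.2 two_pos), ← div_eq_inv_mul]
    at limit
  refine limit.congr' ?_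
  filter_upwards [self_mem_nhdsWithin] with δ hδ
  have hint : Integrable fun ξ : V => h ξ * poissonKernelReal δ (1 - ‖ξ‖ ^ 2) :=
    (hc.mul ((continuous_poissonKernelReal hδ).comp
      (by fun_prop))).integrable_of_hasCompactSupport hs.mul_right
  rw [integral_eq_integral_radialDensity hint]
  exact integral_congr_ae (.of_forall fun r =>
    (radialDensity_mul_comp_norm h (fun r => poissonKernelReal δ (1 - r ^ 2)) r).symm)

end Polar

section AbelSummation

open Set
open scoped Real

variable {X : Type*} [MeasurableSpace X] {μ : Measure X} {h l : X → ℝ} {w : ℝ → ℝ} {δ M : ℝ}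

lemma integrableOn_exp_neg_mul_cosDefect (hw : Integrable w) (hδ : 0 < δ) :
    IntegrableOn (fun s => Real.exp (-δ * s) * cosDefect w s) (Ioi 0) :=
  (integrableOn_exp_neg_mul hδ).mul_bdd (continuous_cosDefect hw).aestronglyMeasurable
    (.of_forall (norm_cosDefect_le hw))

lemma integrable_mul_poissonIntegral_comp (hw : Integrable w) (hwM : ∀ u, ‖w u‖ ≤ M)
    (hh : Integrable h μ) (hl : Measurable l) (hδ : 0 < δ) :
    Integrable (fun x => h x * poissonIntegral w δ (l x)) μ :=
  hh.mul_bdd ((continuous_poissonIntegral hw hδ).measurable.comp hl).aestronglyMeasurable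
    (.of_forall fun _ => norm_poissonIntegral_le hwM hδ _)

lemma integral_exp_mul_cosDefect_mul_integral_cos [SFinite μ] (hw : Integrable w)
    (hwM : ∀ u, ‖w u‖ ≤ M) (hw_even : ∀ u, w (-u) = w u) (hh : Integrable h μ)
    (hl : Measurable l) (hδ : 0 < δ) :
    ∫ s in Ioi 0, Real.exp (-δ * s) * cosDefect w s * ∫ x, h x * Real.cos (l x * s) ∂μ =
      (∫ u, w u) * (∫ x, h x * poissonKernelReal δ (l x) ∂μ) -
        ∫ x, h x * poissonIntegral w δ (l x) ∂μ := by
  have hprod : Integrable (Function.uncurry fun s x => Real.exp (-δ * s) * cosDefect w s * h x *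
      Real.cos (l x * s)) ((volume.restrict (Ioi 0)).prod μ) :=
    ((integrableOn_exp_neg_mul_cosDefect hw hδ).mul_prod hh).mul_bdd (c := 1) (by fun_prop)
      (.of_forall fun q => Real.abs_cos_le_one _)
  have kernel_integrable : Integrable (fun x => h x * poissonKernelReal δ (l x)) μ :=
    hh.mul_bdd (c := δ⁻¹)
      ((continuous_poissonKernelReal hδ).measurable.comp hl).aestronglyMeasurable
      (.of_forall fun _ => norm_poissonKernelReal_le hδ _)
  calc _ = ∫ s in Ioi 0, ∫ x, Real.exp (-δ * s) * cosDefect w s * h x * Real.cos (l x * s) ∂μ := by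
        simp only [← integral_const_mul, mul_assoc]
    _ = ∫ x, (∫ s in Ioi 0, Real.exp (-δ * s) * cosDefect w s * h x * Real.cos (l x * s)) ∂μ :=
        integral_integral_swap hprod
    _ = ∫ x, ((∫ u, w u) * (h x * poissonKernelReal δ (l x)) -
          h x * poissonIntegral w δ (l x)) ∂μ := by
        congr 1 with x
        rw [mul_left_comm, ← mul_sub, ← integral_exp_mul_cosDefect_mul_cos hw hw_even hδ (l x),
          ← integral_const_mul]
        congr 1 with s
        ring
    _ = _ := by
        rw [integral_sub (kernel_integrable.const_mul _)
          (integrable_mul_poissonIntegral_comp hw hwM hh hl hδ), integral_const_mul]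

lemma tendsto_integral_mul_poissonIntegral_comp (hw : Integrable w) (hwc : Continuous w)
    (hwM : ∀ u, ‖w u‖ ≤ M) (hh : Integrable h μ) (hl : Measurable l) :
    Tendsto (fun δ => ∫ x, h x * poissonIntegral w δ (l x) ∂μ) (𝓝[>] 0)
      (𝓝 ((∫ x, h x * w (l x) ∂μ) * π)) := by
  simp only [← integral_mul_const, mul_assoc]
  refine tendsto_integral_filter_of_dominated_convergence (fun x => ‖h x‖ * (M * π)) ?_ ?_
    (hh.norm.mul_const _)
    (.of_forall fun x => (tendsto_poissonIntegral hwc hwM (l x)).const_mul (h x))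
  · filter_upwards [self_mem_nhdsWithin] with δ hδ
    exact (integrable_mul_poissonIntegral_comp hw hwM hh hl hδ).1
  · filter_upwards [self_mem_nhdsWithin] with δ hδ
    refine .of_forall fun x => ?_
    rw [norm_mul]
    gcongr
    exact norm_poissonIntegral_le hwM hδ _

variable {V : Type*} [NormedAddCommGroup V] [InnerProductSpace ℝ V] [FiniteDimensional ℝ V]
  [MeasurableSpace V] [BorelSpace V] [Nontrivial V] {h : V → ℝ}

lemma tendsto_integral_exp_mul_cosDefect_mul_integral_cos (hw : Integrable w)
    (hwc : Continuous w) (hwM : ∀ u, ‖w u‖ ≤ M) (hw_even : ∀ u, w (-u) = w u)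
    (hc : Continuous h) (hs : HasCompactSupport h) :
    Tendsto (fun δ => ∫ s in Ioi 0, Real.exp (-δ * s) * cosDefect w s *
        ∫ ξ, h ξ * Real.cos ((1 - ‖ξ‖ ^ 2) * s)) (𝓝[>] 0)
      (𝓝 (π * ((∫ u, w u) / 2 *
        (∫ ω : Metric.sphere (0 : V) 1, h ω ∂(volume : Measure V).toSphere) -
          ∫ ξ, h ξ * w (1 - ‖ξ‖ ^ 2)))) := by
  have hh : Integrable h := hc.integrable_of_hasCompactSupport hs
  have hl : Measurable fun ξ : V => 1 - ‖ξ‖ ^ 2 := by fun_prop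
  have limit := ((tendsto_integral_mul_poissonKernelReal_one_sub_norm_sq hc hs).const_mul
    (∫ u, w u)).sub (tendsto_integral_mul_poissonIntegral_comp hw hwc hwM hh hl)
  refine (limit.congr' ?_).trans (le_of_eq (congrArg 𝓝 (by ring)))
  filter_upwards [self_mem_nhdsWithin] with δ hδ
  exact (integral_exp_mul_cosDefect_mul_integral_cos hw hwM hw_even hh hl hδ).symm

lemma abs_integral_mul_sub_sphere_le {K : ℝ} (hw : Integrable w)
    (hwc : Continuous w) (hwM : ∀ u, ‖w u‖ ≤ M) (hw_even : ∀ u, w (-u) = w u)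
    (hc : Continuous h) (hs : HasCompactSupport h)
    (hK : ∀ δ, 0 < δ → |∫ s in Ioi 0, Real.exp (-δ * s) * cosDefect w s *
      ∫ ξ, h ξ * Real.cos ((1 - ‖ξ‖ ^ 2) * s)| ≤ K) :
    |(∫ ξ, h ξ * w (1 - ‖ξ‖ ^ 2)) - (∫ u, w u) / 2 *
      ∫ ω : Metric.sphere (0 : V) 1, h ω ∂(volume : Measure V).toSphere| ≤ K / π := by
  have limit := (tendsto_integral_exp_mul_cosDefect_mul_integral_cos hw hwc hwM hw_even hc hs).abs
  rw [abs_mul, abs_of_pos Real.pi_pos, abs_sub_comm] at limit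
  rw [le_div_iff₀' Real.pi_pos]
  refine le_of_tendsto limit ?_
  filter_upwards [self_mem_nhdsWithin] with δ hδ
  exact hK δ hδ

end AbelSummation

section Young

open scoped ENNReal

lemma lintegral_mul_rpow_le {X : Type*} [MeasurableSpace X] {μ : Measure X} {a k : X → ℝ≥0∞}
    (ha : Measurable a) (hk : Measurable k) {p : ℝ} (hp : 1 ≤ p) :
    (∫⁻ y, a y * k y ∂μ) ^ p ≤ (∫⁻ y, k y ∂μ) ^ (p - 1) * ∫⁻ y, a y ^ p * k y ∂μ := by
  have hp0 : 0 < p := one_pos.trans_le hp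
  have h := eLpNorm'_le_eLpNorm'_mul_rpow_measure_univ (μ := μ.withDensity k) one_pos hp
    ha.aestronglyMeasurable
  simp only [eLpNorm', enorm_eq_self, ENNReal.rpow_one, div_one] at h
  rw [withDensity_apply _ MeasurableSet.univ, Measure.restrict_univ,
    lintegral_withDensity_eq_lintegral_mul _ hk ha,
    lintegral_withDensity_eq_lintegral_mul _ hk (ha.pow_const p)] at h
  have h_pow := ENNReal.rpow_le_rpow h hp0.le
  rw [ENNReal.mul_rpow_of_nonneg _ _ hp0.le, ← ENNReal.rpow_mul, ← ENNReal.rpow_mul,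
    one_div_mul_cancel hp0.ne', ENNReal.rpow_one, sub_mul, one_mul,
    one_div_mul_cancel hp0.ne'] at h_pow
  simp only [Pi.mul_apply] at h_pow
  simpa only [mul_comm] using h_pow

variable {G : Type*} [AddCommGroup G] [MeasurableSpace G] [MeasurableAdd₂ G] [MeasurableNeg G]
  {μ : Measure G} [μ.IsAddLeftInvariant] [μ.IsNegInvariant] {a k : G → ℝ≥0∞} {p : ℝ}

lemma lintegral_mul_sub_rpow_le (ha : Measurable a) (hk : Measurable k) (hp : 1 ≤ p) (x : G) :
    (∫⁻ y, a y * k (x - y) ∂μ) ^ p ≤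
      (∫⁻ y, k y ∂μ) ^ (p - 1) * ∫⁻ y, a y ^ p * k (x - y) ∂μ := by
  have h := lintegral_mul_rpow_le (μ := μ) ha
    (hk.comp (by fun_prop : Measurable fun y => x - y)) hp
  simp only [Function.comp_def] at h
  rwa [lintegral_sub_left_eq_self k x] at h

lemma lintegral_mul_sub_rpow_le_of_le (ha : Measurable a) (hk : Measurable k) {S : ℝ≥0∞}
    (hS : ∀ y, k y ≤ S) (hp : 1 ≤ p) (x : G) :
    (∫⁻ y, a y * k (x - y) ∂μ) ^ p ≤ (∫⁻ y, k y ∂μ) ^ (p - 1) * S * ∫⁻ y, a y ^ p ∂μ := by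
  refine (lintegral_mul_sub_rpow_le ha hk hp x).trans ?_
  rw [mul_assoc, ← lintegral_const_mul _ (ha.pow_const p)]
  refine mul_le_mul_right (lintegral_mono fun y => ?_) _
  rw [mul_comm]
  exact mul_le_mul_left (hS _) _

lemma lintegral_lintegral_mul_sub_rpow_le [SFinite μ] (ha : Measurable a) (hk : Measurable k)
    (hk_fin : ∫⁻ y, k y ∂μ ≠ ⊤) (hp : 1 ≤ p) :
    ∫⁻ x, (∫⁻ y, a y * k (x - y) ∂μ) ^ p ∂μ ≤
      (∫⁻ y, k y ∂μ) ^ p * ∫⁻ y, a y ^ p ∂μ := by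
  calc ∫⁻ x, (∫⁻ y, a y * k (x - y) ∂μ) ^ p ∂μ
      ≤ ∫⁻ x, (∫⁻ y, k y ∂μ) ^ (p - 1) * ∫⁻ y, a y ^ p * k (x - y) ∂μ ∂μ :=
        lintegral_mono (lintegral_mul_sub_rpow_le ha hk hp)
    _ = (∫⁻ y, k y ∂μ) ^ (p - 1) * ∫⁻ y, ∫⁻ x, a y ^ p * k (x - y) ∂μ ∂μ := by
        rw [lintegral_const_mul' _ _ (ENNReal.rpow_ne_top_of_nonneg (by linarith) hk_fin),
          lintegral_lintegral_swap]
        exact (((ha.comp measurable_snd).pow_const p).mul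
          (hk.comp (by fun_prop : Measurable fun z : G × G => z.1 - z.2))).aemeasurable
    _ = (∫⁻ y, k y ∂μ) ^ (p - 1) * ∫⁻ y, a y ^ p * ∫⁻ x, k x ∂μ ∂μ := by
        congr 2 with y
        rw [lintegral_const_mul _ (show Measurable fun x => k (x - y) from
          hk.comp (by fun_prop : Measurable fun x => x - y)), lintegral_sub_right_eq_self k y]
    _ = (∫⁻ y, k y ∂μ) ^ p * ∫⁻ y, a y ^ p ∂μ := by
        rw [lintegral_mul_const _ (ha.pow_const p), mul_comm (∫⁻ y, a y ^ p ∂μ), ← mul_assoc]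
        congr 1
        nth_rewrite 2 [← ENNReal.rpow_one (∫⁻ y, k y ∂μ)]
        rw [← ENNReal.rpow_add_of_nonneg _ _ (by linarith) zero_le_one, sub_add_cancel]

lemma lintegral_rpow_le_of_le_lintegral_mul_sub [SFinite μ] {u : G → ℝ≥0∞} (ha : Measurable a)
    (hk : Measurable k) (hk_fin : ∫⁻ y, k y ∂μ ≠ ⊤) {S : ℝ≥0∞} (hS : ∀ y, k y ≤ S)
    (hu : ∀ x, u x ≤ ∫⁻ y, a y * k (x - y) ∂μ) {q : ℝ} (hp : 1 ≤ p) (hpq : p ≤ q) :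
    ∫⁻ x, u x ^ q ∂μ ≤ ((∫⁻ y, k y ∂μ) ^ (p - 1) * S) ^ (q / p - 1) * (∫⁻ y, k y ∂μ) ^ p *
      (∫⁻ y, a y ^ p ∂μ) ^ (q / p) := by
  have hp0 : 0 < p := one_pos.trans_le hp
  have hqp : 0 ≤ q / p - 1 := sub_nonneg.2 ((one_le_div hp0).2 hpq)
  set A := ∫⁻ y, k y ∂μ
  set N := ∫⁻ y, a y ^ p ∂μ
  set b : G → ℝ≥0∞ := fun x => ∫⁻ y, a y * k (x - y) ∂μ
  have hb : Measurable b := Measurable.lintegral_prod_right'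
    (f := fun z : G × G => a z.2 * k (z.1 - z.2)) ((ha.comp measurable_snd).mul
      (hk.comp (by fun_prop : Measurable fun z : G × G => z.1 - z.2)))
  have h_split : ∀ x, u x ^ q ≤ (A ^ (p - 1) * S * N) ^ (q / p - 1) * b x ^ p := fun x => by
    calc u x ^ q ≤ b x ^ q := ENNReal.rpow_le_rpow (hu x) (hp0.le.trans hpq)
      _ = (b x ^ p) ^ (q / p - 1) * b x ^ p := by
        nth_rewrite 2 [← ENNReal.rpow_one (b x ^ p)]
        rw [← ENNReal.rpow_add_of_nonneg _ _ hqp zero_le_one, sub_add_cancel, ← ENNReal.rpow_mul,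
          mul_div_cancel₀ _ hp0.ne']
      _ ≤ (A ^ (p - 1) * S * N) ^ (q / p - 1) * b x ^ p := by
        gcongr
        exact lintegral_mul_sub_rpow_le_of_le ha hk hS hp x
  calc ∫⁻ x, u x ^ q ∂μ ≤ ∫⁻ x, (A ^ (p - 1) * S * N) ^ (q / p - 1) * b x ^ p ∂μ :=
        lintegral_mono h_split
    _ = (A ^ (p - 1) * S * N) ^ (q / p - 1) * ∫⁻ x, b x ^ p ∂μ :=
        lintegral_const_mul _ (hb.pow_const p)
    _ ≤ (A ^ (p - 1) * S * N) ^ (q / p - 1) * (A ^ p * N) := by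
        gcongr
        exact lintegral_lintegral_mul_sub_rpow_le ha hk hk_fin hp
    _ = (A ^ (p - 1) * S) ^ (q / p - 1) * A ^ p * N ^ (q / p) := by
        rw [ENNReal.mul_rpow_of_nonneg _ N hqp, mul_mul_mul_comm]
        congr 1
        nth_rewrite 2 [← ENNReal.rpow_one N]
        rw [← ENNReal.rpow_add_of_nonneg _ _ hqp zero_le_one, sub_add_cancel]

lemma lintegral_enorm_rpow_eq {X E : Type*} [MeasurableSpace X] [NormedAddCommGroup E]
    {μ : Measure X} (f : X → E) {p : ℝ} (hp : 0 < p) :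
    ∫⁻ x, ‖f x‖ₑ ^ p ∂μ = eLpNorm f (ENNReal.ofReal p) μ ^ p := by
  rw [eLpNorm_eq_lintegral_rpow_enorm_toReal (by simpa using hp) ENNReal.ofReal_ne_top,
    ENNReal.toReal_ofReal hp.le, ← ENNReal.rpow_mul, one_div_mul_cancel hp.ne', ENNReal.rpow_one]

lemma exists_integral_norm_convolution_rpow_le [SFinite μ] {ψ : G → ℂ} (hψm : Measurable ψ)
    (hψ : Integrable ψ μ) {S : ℝ} (hS : ∀ y, ‖ψ y‖ ≤ S) {q : ℝ} (hp : 1 ≤ p) (hpq : p ≤ q) :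
    ∃ C : ℝ, 0 ≤ C ∧ ∀ φ : G → ℂ, Measurable φ → MemLp φ (ENNReal.ofReal p) μ →
      ∫ x, ‖∫ y, φ y * ψ (x - y) ∂μ‖ ^ q ∂μ ≤
        C * (eLpNorm φ (ENNReal.ofReal p) μ).toReal ^ q := by
  have hp0 : 0 < p := one_pos.trans_le hp
  have hq0 : 0 ≤ q := hp0.le.trans hpq
  have hψ_fin : ∫⁻ y, ‖ψ y‖ₑ ∂μ ≠ ⊤ := hψ.2.ne
  set c : ℝ≥0∞ := ((∫⁻ y, ‖ψ y‖ₑ ∂μ) ^ (p - 1) * ENNReal.ofReal S) ^ (q / p - 1) *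
    (∫⁻ y, ‖ψ y‖ₑ ∂μ) ^ p
  have hc_fin : c ≠ ⊤ := ENNReal.mul_ne_top
    (ENNReal.rpow_ne_top_of_nonneg (sub_nonneg.2 ((one_le_div hp0).2 hpq)) (ENNReal.mul_ne_top
      (ENNReal.rpow_ne_top_of_nonneg (sub_nonneg.2 hp) hψ_fin) ENNReal.ofReal_ne_top))
    (ENNReal.rpow_ne_top_of_nonneg hp0.le hψ_fin)
  refine ⟨c.toReal, ENNReal.toReal_nonneg, fun φ hφm hφ => ?_⟩
  have h_young : ∫⁻ x, ‖∫ y, φ y * ψ (x - y) ∂μ‖ₑ ^ q ∂μ ≤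
      c * eLpNorm φ (ENNReal.ofReal p) μ ^ q := by
    have h := lintegral_rpow_le_of_le_lintegral_mul_sub (μ := μ)
      (u := fun x => ‖∫ y, φ y * ψ (x - y) ∂μ‖ₑ) hφm.enorm hψm.enorm hψ_fin
      (S := ENNReal.ofReal S)
      (fun y => ofReal_norm (ψ y) ▸ ENNReal.ofReal_le_ofReal (hS y))
      (fun x => by simpa only [enorm_mul] using
        enorm_integral_le_lintegral_enorm (μ := μ) fun y => φ y * ψ (x - y)) hp hpq
    rwa [lintegral_enorm_rpow_eq φ hp0, ← ENNReal.rpow_mul, mul_div_cancel₀ _ hp0.ne'] at h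
  have h_toReal := norm_integral_le_lintegral_norm (μ := μ)
    fun x => ‖∫ y, φ y * ψ (x - y) ∂μ‖ ^ q
  have h_enorm : ∀ z : ℂ, ENNReal.ofReal ‖‖z‖ ^ q‖ = ‖z‖ₑ ^ q := fun z => by
    rw [Real.norm_of_nonneg (by positivity), ← ENNReal.ofReal_rpow_of_nonneg (norm_nonneg _) hq0,
      ofReal_norm]
  simp only [h_enorm] at h_toReal
  rw [ENNReal.toReal_rpow, ← ENNReal.toReal_mul]
  exact (le_abs_self _).trans (h_toReal.trans (ENNReal.toReal_mono (ENNReal.mul_ne_top hc_fin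
    (ENNReal.rpow_ne_top_of_nonneg hq0 hφ.eLpNorm_ne_top)) h_young))

end Young

section DampedForm

open Set

variable {V : Type*} [NormedAddCommGroup V] [InnerProductSpace ℝ V] [FiniteDimensional ℝ V]
  [MeasurableSpace V] [BorelSpace V] {f : V → ℂ} {α ε δ : ℝ}

lemma norm_re_schrodingerForm_self_le (hf : Integrable f) (hf2 : MemLp f 2) (s : ℝ) :
    ‖(schrodingerForm s f f).re‖ ≤ ∫ x, ‖f x‖ ^ 2 := by
  have h := norm_schrodingerForm_le hf hf2 hf hf2 s
  rw [add_self_div_two] at h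
  exact (Complex.abs_re_le_norm _).trans h

lemma cosDefect_resolventWeight_le (hα₁ : 1 / 2 < α) (hα₂ : α < 3 / 2) (hε : 0 ≤ ε) {s : ℝ}
    (hs : 0 < s) :
    cosDefect (resolventWeight α ε) s ≤ s ^ (2 * α - 1) * cosDefect (resolventWeight α 0) 1 := by
  rw [cosDefect_resolventWeight α ε hs]
  gcongr
  exact cosDefect_resolventWeight_anti hα₁ hα₂ le_rfl (by positivity)

lemma abs_setIntegral_Ioc_mul_schrodingerForm_le (hα₁ : 1 / 2 < α) (hα₂ : α < 3 / 2)
    (hf : Integrable f) (hf2 : MemLp f 2) (hε : 0 ≤ ε) (hδ : 0 ≤ δ) :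
    |∫ s in Ioc 0 1, Real.exp (-δ * s) * cosDefect (resolventWeight α ε) s *
      (schrodingerForm s f f).re| ≤ cosDefect (resolventWeight α 0) 1 * ∫ x, ‖f x‖ ^ 2 := by
  have defect_nonneg := cosDefect_nonneg (resolventWeight_nonneg α ε)
  have bound : ∀ s ∈ Ioc (0 : ℝ) 1, ‖Real.exp (-δ * s) * cosDefect (resolventWeight α ε) s *
      (schrodingerForm s f f).re‖ ≤ cosDefect (resolventWeight α 0) 1 * ∫ x, ‖f x‖ ^ 2 := by
    intro s hs
    have exp_le : Real.exp (-δ * s) ≤ 1 := Real.exp_le_one_iff.2 (by nlinarith [hs.1])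
    have pow_le : s ^ (2 * α - 1) ≤ 1 := Real.rpow_le_one hs.1.le hs.2 (by linarith)
    have defect_le : cosDefect (resolventWeight α ε) s ≤ cosDefect (resolventWeight α 0) 1 :=
      (cosDefect_resolventWeight_le hα₁ hα₂ hε hs.1).trans
        (mul_le_of_le_one_left (cosDefect_nonneg (resolventWeight_nonneg α 0) 1) pow_le)
    rw [norm_mul, Real.norm_of_nonneg (mul_nonneg (Real.exp_pos _).le (defect_nonneg s))]
    exact mul_le_mul
      ((mul_le_of_le_one_left (defect_nonneg s) exp_le).trans defect_le)
      (norm_re_schrodingerForm_self_le hf hf2 s) (norm_nonneg _)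
      (cosDefect_nonneg (resolventWeight_nonneg α 0) 1)
  simpa using norm_setIntegral_le_of_norm_le_const (μ := volume) (by simp) bound

/- For `2 * z = θ * (dim V + 1)` the weight `s ^ (z - 1)` of the amplitude form is the factor
`s ^ (2 * α - 1)` of the cosine defect when `θ * (dim V + 1) = 4 * α`. -/
lemma setIntegral_Ioi_mul_schrodingerForm_eq (hα₁ : 1 / 2 < α) (hα₂ : α < 3 / 2)
    (hf : Integrable f) (hf2 : MemLp f 2) (hε : 0 < ε) (hδ : 0 < δ) {θ : ℝ}
    (hθ : θ * (Module.finrank ℝ V + 1) = 4 * α) :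
    ∫ s in Ioi 1, Real.exp (-δ * s) * cosDefect (resolventWeight α ε) s *
        (schrodingerForm s f f).re =
      cosDefect (resolventWeight α 0) 1 *
        (amplitudeForm (fun s => Real.exp (-δ * s) * (cosDefect (resolventWeight α (ε * s)) 1 /
          cosDefect (resolventWeight α 0) 1)) (θ * ((Module.finrank ℝ V + 1) / 2 : ℝ)) f f).re := by
  have ha := isAmplitude_exp_mul_cosDefect hα₁ hα₂ hε hδ
  have exponent : (θ : ℂ) * ((Module.finrank ℝ V + 1) / 2 : ℝ) - 1 = ((2 * α - 1 : ℝ) : ℂ) := by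
    rw [← Complex.ofReal_mul, ← Complex.ofReal_one, ← Complex.ofReal_sub, Complex.ofReal_inj]
    linarith
  have h_integrable := integrableOn_smul_cpow_mul_schrodingerForm ha hf hf2 hf hf2
    (θ * ((Module.finrank ℝ V + 1) / 2 : ℝ) - 1)
  rw [exponent] at h_integrable
  rw [amplitudeForm, exponent, ← RCLike.re_eq_complex_re, ← integral_re h_integrable,
    ← integral_const_mul]
  refine setIntegral_congr_fun measurableSet_Ioi fun s hs => ?_
  have hs0 : (0 : ℝ) < s := zero_lt_one.trans hs
  have defect_eq : cosDefect (resolventWeight α (ε * s)) 1 =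
      cosDefect (resolventWeight α 0) 1 * (cosDefect (resolventWeight α (ε * s)) 1 /
        cosDefect (resolventWeight α 0) 1) :=
    (mul_div_cancel_of_imp' fun hM => le_antisymm
      ((cosDefect_resolventWeight_anti hα₁ hα₂ le_rfl (by positivity)).trans hM.le)
      (cosDefect_nonneg (resolventWeight_nonneg _ _) _)).symm
  simp only [← Complex.ofReal_cpow hs0.le, RCLike.re_eq_complex_re, Complex.smul_re,
    Complex.re_ofReal_mul, smul_eq_mul]
  rw [cosDefect_resolventWeight α ε hs0]
  nth_rewrite 1 [defect_eq]
  ring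

lemma abs_integral_exp_mul_cosDefect_mul_schrodingerForm_le (hα₁ : 1 / 2 < α) (hα₂ : α < 3 / 2)
    (hfm : Measurable f) (hf : Integrable f) (hf2 : MemLp f 2) {p θ : ℝ}
    (hfp : Integrable fun x => ‖f x‖ ^ p) (hθ : θ * (Module.finrank ℝ V + 1) = 4 * α)
    (hθ1 : θ ≤ 1) (hp : p * (1 + θ) = 2) (hε : 0 < ε) (hδ : 0 < δ) :
    |∫ s in Ioi 0, Real.exp (-δ * s) * cosDefect (resolventWeight α ε) s *
      (schrodingerForm s f f).re| ≤ cosDefect (resolventWeight α 0) 1 * ((∫ x, ‖f x‖ ^ 2) +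
        108 * (Module.finrank ℝ V + 1) ^ 2 / θ * (∫ x, ‖f x‖ ^ p) ^ (2 / p)) := by
  have hθ0 : 0 < θ := pos_of_mul_pos_left (by rw [hθ]; linarith) (by positivity)
  have h_integrable : IntegrableOn (fun s => Real.exp (-δ * s) *
      cosDefect (resolventWeight α ε) s * (schrodingerForm s f f).re) (Ioi 0) :=
    (integrableOn_exp_neg_mul_cosDefect (integrable_resolventWeight hα₁ hε) hδ).mul_bdd
      (Complex.continuous_re.comp
        (continuous_schrodingerForm hf hf2 hf hf2)).aestronglyMeasurable
      (.of_forall (norm_re_schrodingerForm_self_le hf hf2))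
  rw [← Ioc_union_Ioi_eq_Ioi (zero_le_one' ℝ), setIntegral_union Ioc_disjoint_Ioi_same
    measurableSet_Ioi (h_integrable.mono_set Ioc_subset_Ioi_self)
    (h_integrable.mono_set (Ioi_subset_Ioi zero_le_one)), mul_add]
  refine (abs_add_le _ _).trans (add_le_add
    (abs_setIntegral_Ioc_mul_schrodingerForm_le hα₁ hα₂ hf hf2 hε.le hδ.le) ?_)
  have defect_nonneg := cosDefect_nonneg (resolventWeight_nonneg α 0) 1
  rw [setIntegral_Ioi_mul_schrodingerForm_eq hα₁ hα₂ hf hf2 hε hδ hθ, abs_mul,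
    abs_of_nonneg defect_nonneg]
  gcongr
  exact (Complex.abs_re_le_norm _).trans (norm_amplitudeForm_le_integral_norm_rpow
    (isAmplitude_exp_mul_cosDefect hα₁ hα₂ hε hδ) hfm hf hf2 hfp hθ0 hθ1 hp)

end DampedForm

section FourierHat

variable {n : ℕ} {f : EuclideanSpace ℝ (Fin n) → ℂ}

lemma fourierHat_eq_fourier (f : EuclideanSpace ℝ (Fin n) → ℂ) (ξ : EuclideanSpace ℝ (Fin n)) :
    fourierHat f ξ = 𝓕 f ((2 * Real.pi)⁻¹ • ξ) := by
  rw [fourierHat, Real.fourier_eq']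
  congr 1 with x
  rw [smul_eq_mul, inner_smul_right, real_inner_comm]
  congr 2
  have pi_ne : (Real.pi : ℂ) ≠ 0 := by exact_mod_cast Real.pi_ne_zero
  push_cast
  field_simp

lemma continuous_fourierHat (hf : Integrable f) : Continuous (fourierHat f) := by
  simp only [funext (fourierHat_eq_fourier f)]
  exact (continuous_fourier_of_integrable hf).comp (by fun_prop)

lemma integral_comp_two_pi_inv_smul {G : Type*} [NormedAddCommGroup G] [NormedSpace ℝ G]
    (k : EuclideanSpace ℝ (Fin n) → G) :
    ∫ ξ, k ((2 * Real.pi)⁻¹ • ξ) = (2 * Real.pi) ^ n • ∫ v, k v := by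
  have := Real.pi_pos
  rw [Measure.integral_comp_smul, finrank_euclideanSpace_fin, abs_of_pos (by positivity),
    inv_pow, inv_inv]

lemma integral_norm_sq_fourierHat (hf : Integrable f) (hf2 : MemLp f 2) :
    ∫ ξ, ‖fourierHat f ξ‖ ^ 2 = (2 * Real.pi) ^ n * ∫ x, ‖f x‖ ^ 2 := by
  simp only [fourierHat_eq_fourier]
  rw [integral_comp_two_pi_inv_smul fun v => ‖𝓕 f v‖ ^ 2, integral_norm_sq_fourier hf hf2,
    smul_eq_mul]

lemma integral_norm_sq_fourierHat_mul_cos (hf : Integrable f) (hf2 : MemLp f 2) (s : ℝ) :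
    ∫ ξ, ‖fourierHat f ξ‖ ^ 2 * Real.cos ((1 - ‖ξ‖ ^ 2) * s) =
      (2 * Real.pi) ^ n * (schrodingerForm s f f).re := by
  set k : EuclideanSpace ℝ (Fin n) → ℂ := fun v => 𝓕 f v * (starRingEnd ℂ) (𝓕 f v) *
    Complex.exp (Complex.I * (1 - 4 * Real.pi ^ 2 * ‖v‖ ^ 2 : ℝ) * s)
  have h_sq := integrable_fourier_mul_conj hf hf2 hf hf2
  have hk : Integrable k := h_sq.congr' (h_sq.1.mul (by fun_prop))
    (.of_forall fun v => (norm_mul_cexp_I_mul_mul _ _ _).symm)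
  have integrand_eq : ∀ ξ : EuclideanSpace ℝ (Fin n), ‖fourierHat f ξ‖ ^ 2 *
      Real.cos ((1 - ‖ξ‖ ^ 2) * s) = (k ((2 * Real.pi)⁻¹ • ξ)).re := fun ξ => by
    have norm_scaled : 4 * Real.pi ^ 2 * ‖(2 * Real.pi)⁻¹ • ξ‖ ^ 2 = ‖ξ‖ ^ 2 := by
      rw [norm_smul, Real.norm_of_nonneg (by positivity)]
      field_simp
      ring
    have phase_eq : Complex.I * ((1 - ‖ξ‖ ^ 2 : ℝ) : ℂ) * s =
        (((1 - ‖ξ‖ ^ 2) * s : ℝ) : ℂ) * Complex.I := by push_cast; ring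
    simp only [k, norm_scaled, phase_eq, Complex.mul_conj, fourierHat_eq_fourier,
      Complex.re_ofReal_mul, Complex.normSq_eq_norm_sq, Complex.exp_ofReal_mul_I_re]
  simp only [integrand_eq]
  rw [integral_comp_two_pi_inv_smul fun v => (k v).re, smul_eq_mul]
  congr 1
  exact integral_re hk

lemma abs_integral_fourierHat_sub_sphere_le {α : ℝ} (hα₁ : 1 / 2 < α) (hα₂ : α < 3 / 2)
    (hn : n ≠ 0) {p θ : ℝ} (hθ : θ * (n + 1) = 4 * α) (hθ1 : θ ≤ 1) (hp : p * (1 + θ) = 2)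
    (hfm : Measurable f) (hf : Integrable f) (hf2 : MemLp f 2)
    (hfp : Integrable fun x => ‖f x‖ ^ p) (hs : HasCompactSupport (fourierHat f)) {ε : ℝ}
    (hε : 0 < ε) :
    |(∫ ξ, ‖fourierHat f ξ‖ ^ 2 * resolventWeight α ε (1 - ‖ξ‖ ^ 2)) -
      (∫ u, resolventWeight α ε u) / 2 * ∫ ω, ‖fourierHat f ω‖ ^ 2 ∂(surfaceMeasure n)| ≤
      (2 * Real.pi) ^ n * (cosDefect (resolventWeight α 0) 1 * ((∫ x, ‖f x‖ ^ 2) +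
        108 * ((n : ℝ) + 1) ^ 2 / θ * (∫ x, ‖f x‖ ^ p) ^ (2 / p))) / Real.pi := by
  have : NeZero n := ⟨hn⟩
  refine abs_integral_mul_sub_sphere_le (integrable_resolventWeight hα₁ hε)
    (continuous_resolventWeight hε.ne') (norm_resolventWeight_le (by linarith) hε.ne')
    (resolventWeight_neg α ε) ((continuous_fourierHat hf).norm.pow 2)
    (hs.comp_left (g := fun z : ℂ => ‖z‖ ^ 2) (by simp)) fun δ hδ => ?_
  simp only [integral_norm_sq_fourierHat_mul_cos hf hf2, mul_left_comm _ ((2 * Real.pi) ^ n)]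
  rw [integral_const_mul, abs_mul, abs_of_nonneg (by have := Real.pi_pos; positivity)]
  gcongr
  simpa only [finrank_euclideanSpace_fin] using
    abs_integral_exp_mul_cosDefect_mul_schrodingerForm_le hα₁ hα₂ hfm hf hf2 hfp
      (by rwa [finrank_euclideanSpace_fin]) hθ1 hp hε hδ

end FourierHat

section FrequencyLocalization

variable {n : ℕ}

lemma exists_schwartz_eq_ofReal {η : EuclideanSpace ℝ (Fin n) → ℝ}
    (hη : ContDiff ℝ ((⊤ : ℕ∞) : WithTop ℕ∞) η) (hηc : HasCompactSupport η) :
    ∃ θ : SchwartzMap (EuclideanSpace ℝ (Fin n)) ℂ, ∀ x, θ x = (η x : ℂ) :=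
  ⟨(hηc.comp_left (g := ((↑) : ℝ → ℂ)) Complex.ofReal_zero).toSchwartzMap
    (Complex.ofRealCLM.contDiff.comp hη), fun _ => rfl⟩

lemma exists_frequency_cutoff (n : ℕ) {R : ℝ} (hR : 0 < R) :
    ∃ ψ : SchwartzMap (EuclideanSpace ℝ (Fin n)) ℂ,
      ∀ φ : SchwartzMap (EuclideanSpace ℝ (Fin n)) ℂ,
        ∃ F : SchwartzMap (EuclideanSpace ℝ (Fin n)) ℂ,
          (∀ x, F x = ∫ y, φ y * ψ (x - y)) ∧
          (∀ ξ, ‖ξ‖ ≤ R → fourierHat F ξ = fourierHat φ ξ) ∧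
          HasCompactSupport (fourierHat F) := by
  let b : ContDiffBump (0 : EuclideanSpace ℝ (Fin n)) :=
    ⟨(2 * Real.pi)⁻¹ * R, (2 * Real.pi)⁻¹ * (2 * R), by positivity, by gcongr; linarith⟩
  obtain ⟨B, hB⟩ := exists_schwartz_eq_ofReal b.contDiff b.hasCompactSupport
  refine ⟨𝓕⁻ B, fun φ => ⟨SchwartzMap.convolution (ContinuousLinearMap.mul ℂ ℂ) φ (𝓕⁻ B), ?_⟩⟩
  have fourierHat_convolution : ∀ ξ,
      fourierHat (SchwartzMap.convolution (ContinuousLinearMap.mul ℂ ℂ) φ (𝓕⁻ B)) ξ =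
        fourierHat φ ξ * (b ((2 * Real.pi)⁻¹ • ξ) : ℂ) := fun ξ => by
    rw [fourierHat_eq_fourier, fourierHat_eq_fourier, ← SchwartzMap.fourier_coe,
      SchwartzMap.fourier_convolution, ← SchwartzMap.fourier_coe, ← hB]
    simp
  refine ⟨fun x => ?_, fun ξ hξ => ?_, ?_⟩
  · rw [SchwartzMap.convolution_apply]
    rfl
  · rw [fourierHat_convolution, b.one_of_mem_closedBall, Complex.ofReal_one, mul_one]
    rw [mem_closedBall_zero_iff, norm_smul, Real.norm_of_nonneg (by positivity)]
    exact mul_le_mul_of_nonneg_left hξ (by positivity)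
  · have h_bump : HasCompactSupport fun x => (b x : ℂ) :=
      b.hasCompactSupport.comp_left (g := ((↑) : ℝ → ℂ)) Complex.ofReal_zero
    have h_scaled : HasCompactSupport
        fun ξ : EuclideanSpace ℝ (Fin n) => (b ((2 * Real.pi)⁻¹ • ξ) : ℂ) :=
      h_bump.comp_homeomorph (Homeomorph.smulOfNeZero (2 * Real.pi)⁻¹ (by positivity))
    rw [funext fourierHat_convolution]
    exact h_scaled.mul_left

lemma exists_frequency_localization (n : ℕ) {R p : ℝ} (hR : 0 < R) (hp : 1 ≤ p) :
    ∃ C : ℝ → ℝ, (∀ q, 0 ≤ C q) ∧ ∀ φ : SchwartzMap (EuclideanSpace ℝ (Fin n)) ℂ,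
      ∃ F : SchwartzMap (EuclideanSpace ℝ (Fin n)) ℂ,
        (∀ ξ, ‖ξ‖ ≤ R → fourierHat F ξ = fourierHat φ ξ) ∧ HasCompactSupport (fourierHat F) ∧
        ∀ q, p ≤ q → ∫ x, ‖F x‖ ^ q ≤ C q * (eLpNorm φ (ENNReal.ofReal p)).toReal ^ q := by
  obtain ⟨ψ, hψ⟩ := exists_frequency_cutoff n hR
  have young : ∀ q, ∃ C : ℝ, 0 ≤ C ∧ (p ≤ q → ∀ φ : EuclideanSpace ℝ (Fin n) → ℂ,
      Measurable φ → MemLp φ (ENNReal.ofReal p) → ∫ x, ‖∫ y, φ y * ψ (x - y)‖ ^ q ≤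
        C * (eLpNorm φ (ENNReal.ofReal p)).toReal ^ q) := fun q => by
    by_cases hpq : p ≤ q
    · obtain ⟨C, hC, h⟩ := exists_integral_norm_convolution_rpow_le (μ := volume)
        ψ.continuous.measurable ψ.integrable (fun y => ψ.norm_le_seminorm ℝ y) hp hpq
      exact ⟨C, hC, fun _ => h⟩
    · exact ⟨0, le_rfl, fun h => absurd h hpq⟩
  choose C hC hCq using young
  refine ⟨C, hC, fun φ => ?_⟩
  obtain ⟨F, hF, hFφ, hFs⟩ := hψ φ
  refine ⟨F, hFφ, hFs, fun q hpq => ?_⟩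
  simp only [hF]
  exact hCq q hpq φ φ.continuous.measurable (φ.memLp _ _)

end FrequencyLocalization

section Annulus

variable {n : ℕ} {α : ℝ}

lemma isOpen_annulus (n : ℕ) : IsOpen (annulus n) :=
  isOpen_Ioo.preimage continuous_norm

lemma measurableSet_annulus (n : ℕ) : MeasurableSet (annulus n) :=
  (isOpen_annulus n).measurableSet

lemma div_rpow_eq_mul_resolventWeight (α ε a u : ℝ) :
    a / (u ^ 2 + ε ^ 2) ^ α = a * resolventWeight α ε u := by
  rw [resolventWeight, add_comm, Real.rpow_neg (by positivity), div_eq_mul_inv]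

lemma integrable_norm_sq_mul_resolventWeight (hα : 0 ≤ α) {ε : ℝ} (hε : ε ≠ 0)
    {μ : Measure (EuclideanSpace ℝ (Fin n))} {g : EuclideanSpace ℝ (Fin n) → ℂ} (hg : MemLp g 2 μ) :
    Integrable (fun ξ => ‖g ξ‖ ^ 2 * resolventWeight α ε (1 - ‖ξ‖ ^ 2)) μ := by
  have h_weight : Continuous fun ξ : EuclideanSpace ℝ (Fin n) =>
      resolventWeight α ε (1 - ‖ξ‖ ^ 2) := (continuous_resolventWeight hε).comp (by fun_prop)
  exact (hg.integrable_norm_pow two_ne_zero).mul_bdd h_weight.aestronglyMeasurable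
    (.of_forall fun ξ => norm_resolventWeight_le hα hε _)

lemma resolventWeight_le_of_notMem_annulus (hα : 0 ≤ α) (ε : ℝ)
    {ξ : EuclideanSpace ℝ (Fin n)} (hξ : ξ ∉ annulus n) :
    resolventWeight α ε (1 - ‖ξ‖ ^ 2) ≤ (9 / 16) ^ (-α) := by
  refine Real.rpow_le_rpow_of_nonpos (by norm_num) ?_ (by linarith)
  have distance_from_sphere : 9 / 16 ≤ (1 - ‖ξ‖ ^ 2) ^ 2 := by
    have h0 := norm_nonneg ξ
    rcases le_or_gt ‖ξ‖ (1 / 2) with h_inner | h_inner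
    · have : 3 / 4 ≤ 1 - ‖ξ‖ ^ 2 := by nlinarith
      nlinarith
    · have h_outer : 3 / 2 ≤ ‖ξ‖ := not_lt.1 fun h => hξ ⟨h_inner, h⟩
      have : 3 / 4 ≤ ‖ξ‖ ^ 2 - 1 := by nlinarith
      nlinarith
  nlinarith [sq_nonneg ε]

lemma abs_setIntegral_compl_annulus_mul_resolventWeight_le (hα : 0 ≤ α) (ε : ℝ)
    {h : EuclideanSpace ℝ (Fin n) → ℝ} (hh : Integrable h) (hh0 : ∀ ξ, 0 ≤ h ξ) :
    |∫ ξ in (annulus n)ᶜ, h ξ * resolventWeight α ε (1 - ‖ξ‖ ^ 2)| ≤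
      (9 / 16) ^ (-α) * ∫ ξ, h ξ := by
  have h_major : Integrable fun ξ => (9 / 16) ^ (-α) * h ξ := hh.const_mul _
  have pointwise_le : ∀ ξ ∈ (annulus n)ᶜ, ‖h ξ * resolventWeight α ε (1 - ‖ξ‖ ^ 2)‖ ≤
      (9 / 16) ^ (-α) * h ξ := fun ξ hξ => by
    rw [Real.norm_of_nonneg (mul_nonneg (hh0 ξ) (resolventWeight_nonneg _ _ _)), mul_comm]
    exact mul_le_mul_of_nonneg_right (resolventWeight_le_of_notMem_annulus hα ε hξ) (hh0 ξ)
  calc |∫ ξ in (annulus n)ᶜ, h ξ * resolventWeight α ε (1 - ‖ξ‖ ^ 2)|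
      ≤ ∫ ξ in (annulus n)ᶜ, (9 / 16) ^ (-α) * h ξ :=
        norm_integral_le_of_norm_le h_major.integrableOn
          (ae_restrict_of_forall_mem (measurableSet_annulus n).compl pointwise_le)
    _ ≤ ∫ ξ, (9 / 16) ^ (-α) * h ξ :=
        setIntegral_le_integral h_major (.of_forall fun ξ => mul_nonneg (by positivity) (hh0 ξ))
    _ = (9 / 16) ^ (-α) * ∫ ξ, h ξ := integral_const_mul _ _

end Annulus

section APriori

variable {n : ℕ} {α p : ℝ}

lemma integrable_norm_rpow_of_memLp_ofReal {X E : Type*} [MeasurableSpace X]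
    [NormedAddCommGroup E] {μ : Measure X} {p : ℝ} (hp : 0 < p) {f : X → E}
    (hf : MemLp f (ENNReal.ofReal p) μ) : Integrable (fun x => ‖f x‖ ^ p) μ := by
  simpa only [ENNReal.toReal_ofReal hp.le] using
    hf.integrable_norm_rpow (by simpa using hp) ENNReal.ofReal_ne_top

lemma memLp_two_fourierHat {f : EuclideanSpace ℝ (Fin n) → ℂ} (hf : Integrable f)
    (hf2 : MemLp f 2) : MemLp (fourierHat f) 2 := by
  rw [memLp_two_iff_integrable_sq_norm (continuous_fourierHat hf).aestronglyMeasurable,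
    funext (fourierHat_eq_fourier f)]
  exact ((memLp_fourier hf hf2).integrable_norm_pow two_ne_zero).comp_smul
    (inv_ne_zero (by positivity))

lemma exists_setIntegral_annulus_norm_sq_fourierHat_le (n : ℕ) (hp1 : 1 ≤ p) (hp2 : p ≤ 2) :
    ∃ C : ℝ, ∀ φ : SchwartzMap (EuclideanSpace ℝ (Fin n)) ℂ,
      ∫ ξ in annulus n, ‖fourierHat φ ξ‖ ^ 2 ≤
        C * (eLpNorm φ (ENNReal.ofReal p) volume).toReal ^ 2 := by
  obtain ⟨C, -, hloc⟩ := exists_frequency_localization n (R := 3 / 2) (by norm_num) hp1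
  refine ⟨(2 * Real.pi) ^ n * C 2, fun φ => ?_⟩
  obtain ⟨F, hFφ, -, hF⟩ := hloc φ
  have hF2 : ∫ x, ‖F x‖ ^ 2 ≤ C 2 * (eLpNorm φ (ENNReal.ofReal p) volume).toReal ^ 2 := by
    simpa only [Real.rpow_two] using hF 2 hp2
  have h_sq : Integrable fun ξ => ‖fourierHat F ξ‖ ^ 2 :=
    (memLp_two_fourierHat F.integrable (F.memLp 2 volume)).integrable_norm_pow two_ne_zero
  calc ∫ ξ in annulus n, ‖fourierHat φ ξ‖ ^ 2 = ∫ ξ in annulus n, ‖fourierHat F ξ‖ ^ 2 :=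
        setIntegral_congr_fun (measurableSet_annulus n) fun ξ hξ => by simp only [hFφ ξ hξ.2.le]
    _ ≤ ∫ ξ, ‖fourierHat F ξ‖ ^ 2 :=
        setIntegral_le_integral h_sq (.of_forall fun ξ => sq_nonneg _)
    _ = (2 * Real.pi) ^ n * ∫ x, ‖F x‖ ^ 2 :=
        integral_norm_sq_fourierHat F.integrable (F.memLp 2 volume)
    _ ≤ (2 * Real.pi) ^ n * (C 2 * (eLpNorm φ (ENNReal.ofReal p) volume).toReal ^ 2) := by gcongr
    _ = _ := (mul_assoc _ _ _).symm

lemma abs_setIntegral_annulus_fourierHat_sub_sphere_le (hα₁ : 1 / 2 < α) (hα₂ : α < 3 / 2)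
    (hn : n ≠ 0) {θ : ℝ} (hθ : θ * (n + 1) = 4 * α) (hθ1 : θ ≤ 1) (hp : p * (1 + θ) = 2)
    {f : EuclideanSpace ℝ (Fin n) → ℂ} (hfm : Measurable f) (hf : Integrable f) (hf2 : MemLp f 2)
    (hfp : Integrable fun x => ‖f x‖ ^ p) (hs : HasCompactSupport (fourierHat f)) {ε : ℝ}
    (hε : 0 < ε) :
    |(∫ ξ in annulus n, ‖fourierHat f ξ‖ ^ 2 * resolventWeight α ε (1 - ‖ξ‖ ^ 2)) -
      (∫ u, resolventWeight α ε u) / 2 * ∫ ω, ‖fourierHat f ω‖ ^ 2 ∂(surfaceMeasure n)| ≤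
      (2 * Real.pi) ^ n * (cosDefect (resolventWeight α 0) 1 * ((∫ x, ‖f x‖ ^ 2) +
        108 * ((n : ℝ) + 1) ^ 2 / θ * (∫ x, ‖f x‖ ^ p) ^ (2 / p))) / Real.pi +
      (9 / 16) ^ (-α) * ((2 * Real.pi) ^ n * ∫ x, ‖f x‖ ^ 2) := by
  have h_memLp := memLp_two_fourierHat hf hf2
  have h_weighted := integrable_norm_sq_mul_resolventWeight (α := α) (by linarith) hε.ne' h_memLp
  have h_whole := abs_integral_fourierHat_sub_sphere_le hα₁ hα₂ hn hθ hθ1 hp hfm hf hf2 hfp hs hε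
  have h_compl := abs_setIntegral_compl_annulus_mul_resolventWeight_le (α := α) (by linarith) ε
    (h_memLp.integrable_norm_pow two_ne_zero) fun ξ => sq_nonneg _
  rw [integral_norm_sq_fourierHat hf hf2] at h_compl
  rw [← integral_add_compl (measurableSet_annulus n) h_weighted] at h_whole
  rw [abs_le] at h_whole h_compl ⊢
  constructor <;> linarith

lemma exists_critical_exponent (hα : 0 < α) (n : ℕ)
    (hp : 1 ≤ (2 * (n : ℝ) + 2) / ((n : ℝ) + 1 + 4 * α)) :
    ∃ θ : ℝ, θ * (n + 1) = 4 * α ∧ 0 < θ ∧ θ ≤ 1 ∧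
      (2 * (n : ℝ) + 2) / ((n : ℝ) + 1 + 4 * α) * (1 + θ) = 2 := by
  rw [one_le_div (by positivity)] at hp
  refine ⟨4 * α / (n + 1), by field_simp, by positivity, ?_, by field_simp⟩
  rw [div_le_one (by positivity)]
  linarith

lemma le_two_of_le_critical_exponent (hα : 0 ≤ α)
    (hp : p ≤ (2 * (n : ℝ) + 2) / ((n : ℝ) + 1 + 4 * α)) : p ≤ 2 :=
  hp.trans (by rw [div_le_iff₀ (by positivity)]; linarith)

lemma rpow_two_div_le_of_le_mul_rpow {I C N : ℝ} (hI : 0 ≤ I) (hC : 0 ≤ C) (hN : 0 ≤ N)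
    (hp : 0 < p) (h : I ≤ C * N ^ p) : I ^ (2 / p) ≤ C ^ (2 / p) * N ^ 2 :=
  calc I ^ (2 / p) ≤ (C * N ^ p) ^ (2 / p) := Real.rpow_le_rpow hI h (by positivity)
    _ = C ^ (2 / p) * N ^ 2 := by
      rw [Real.mul_rpow hC (by positivity), ← Real.rpow_mul hN, mul_div_cancel₀ _ hp.ne',
        Real.rpow_two]

/- Only the critical exponent `2 / (1 + θ)` is treated by interpolation; for smaller `p`, replacing
`φ` by a frequency localisation raises the exponent at no cost, by Young's inequality. -/
lemma exists_abs_setIntegral_annulus_sub_sphere_le (hα₁ : 1 / 2 < α) (hα₂ : α < 3 / 2)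
    (hn : n ≠ 0) (hp1 : 1 ≤ p) (hp : p ≤ (2 * (n : ℝ) + 2) / ((n : ℝ) + 1 + 4 * α)) :
    ∃ K : ℝ, ∀ φ : SchwartzMap (EuclideanSpace ℝ (Fin n)) ℂ, ∀ ε : ℝ, 0 < ε →
      |(∫ ξ in annulus n, ‖fourierHat φ ξ‖ ^ 2 * resolventWeight α ε (1 - ‖ξ‖ ^ 2)) -
        (∫ u, resolventWeight α ε u) / 2 * ∫ ω, ‖fourierHat φ ω‖ ^ 2 ∂(surfaceMeasure n)| ≤
      K * (eLpNorm φ (ENNReal.ofReal p) volume).toReal ^ 2 := by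
  obtain ⟨θ, hθ, hθ0, hθ1, hpθ⟩ := exists_critical_exponent (by linarith) n (hp1.trans hp)
  set p₀ : ℝ := (2 * (n : ℝ) + 2) / ((n : ℝ) + 1 + 4 * α)
  obtain ⟨C, hC, hloc⟩ := exists_frequency_localization n (R := 3 / 2) (by norm_num) hp1
  have hCp := hC p₀
  have hp₀ : 0 < p₀ := by linarith
  have h_defect := cosDefect_nonneg (resolventWeight_nonneg α 0) 1
  refine ⟨(2 * Real.pi) ^ n * (cosDefect (resolventWeight α 0) 1 * (C 2 +
    108 * ((n : ℝ) + 1) ^ 2 / θ * C p₀ ^ (2 / p₀))) / Real.pi +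
    (9 / 16) ^ (-α) * ((2 * Real.pi) ^ n * C 2), fun φ ε hε => ?_⟩
  obtain ⟨F, hFφ, hFs, hF⟩ := hloc φ
  set N := (eLpNorm φ (ENNReal.ofReal p) volume).toReal
  have hF2 : ∫ x, ‖F x‖ ^ 2 ≤ C 2 * N ^ 2 := by
    simpa only [Real.rpow_two] using hF 2 (by nlinarith)
  have hFp : (∫ x, ‖F x‖ ^ p₀) ^ (2 / p₀) ≤ C p₀ ^ (2 / p₀) * N ^ 2 :=
    rpow_two_div_le_of_le_mul_rpow (integral_nonneg fun x => by positivity) hCp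
      ENNReal.toReal_nonneg hp₀ (hF p₀ hp)
  have hFpi : Integrable fun x => ‖F x‖ ^ p₀ :=
    integrable_norm_rpow_of_memLp_ofReal hp₀ (F.memLp _ _)
  have annulus_eq : ∫ ξ in annulus n, ‖fourierHat φ ξ‖ ^ 2 * resolventWeight α ε (1 - ‖ξ‖ ^ 2) =
      ∫ ξ in annulus n, ‖fourierHat F ξ‖ ^ 2 * resolventWeight α ε (1 - ‖ξ‖ ^ 2) :=
    setIntegral_congr_fun (measurableSet_annulus n) fun ξ hξ => by simp only [hFφ ξ hξ.2.le]
  have sphere_eq : ∫ ω, ‖fourierHat φ ω‖ ^ 2 ∂(surfaceMeasure n) =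
      ∫ ω, ‖fourierHat F ω‖ ^ 2 ∂(surfaceMeasure n) :=
    integral_congr_ae <| .of_forall fun ω => by
      simp only [hFφ ω (by rw [norm_eq_of_mem_sphere]; norm_num)]
  rw [annulus_eq, sphere_eq]
  calc _ ≤ (2 * Real.pi) ^ n * (cosDefect (resolventWeight α 0) 1 * ((∫ x, ‖F x‖ ^ 2) +
          108 * ((n : ℝ) + 1) ^ 2 / θ * (∫ x, ‖F x‖ ^ p₀) ^ (2 / p₀))) / Real.pi +
          (9 / 16) ^ (-α) * ((2 * Real.pi) ^ n * ∫ x, ‖F x‖ ^ 2) :=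
        abs_setIntegral_annulus_fourierHat_sub_sphere_le hα₁ hα₂ hn hθ hθ1 hpθ
          F.continuous.measurable F.integrable (F.memLp 2 volume) hFpi hFs hε
    _ ≤ (2 * Real.pi) ^ n * (cosDefect (resolventWeight α 0) 1 * (C 2 * N ^ 2 +
          108 * ((n : ℝ) + 1) ^ 2 / θ * (C p₀ ^ (2 / p₀) * N ^ 2))) / Real.pi +
          (9 / 16) ^ (-α) * ((2 * Real.pi) ^ n * (C 2 * N ^ 2)) := by gcongr
    _ = _ := by ring

lemma integral_resolventWeight_pos (hα : 1 / 2 < α) {ε : ℝ} (hε : 0 < ε) :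
    0 < ∫ u, resolventWeight α ε u := by
  have support_eq : Function.support (resolventWeight α ε) = Set.univ :=
    Function.support_eq_univ fun u => (Real.rpow_pos_of_pos (by positivity) _).ne'
  rw [integral_pos_iff_support_of_nonneg (resolventWeight_nonneg α ε)
    (integrable_resolventWeight hα hε), support_eq]
  simp

lemma setIntegral_annulus_mul_resolventWeight_le (hα : 0 ≤ α)
    {g : EuclideanSpace ℝ (Fin n) → ℂ} (hg : MemLp g 2 (volume.restrict (annulus n))) :
    ∫ ξ in annulus n, ‖g ξ‖ ^ 2 * resolventWeight α 1 (1 - ‖ξ‖ ^ 2) ≤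
      ∫ ξ in annulus n, ‖g ξ‖ ^ 2 := by
  have weight_le_one : ∀ u, ‖resolventWeight α 1 u‖ ≤ 1 := fun u => by
    simpa using norm_resolventWeight_le hα one_ne_zero u
  exact integral_mono (integrable_norm_sq_mul_resolventWeight hα one_ne_zero hg)
    (hg.integrable_norm_pow two_ne_zero) fun ξ =>
      mul_le_of_le_one_right (sq_nonneg _) ((le_abs_self _).trans (weight_le_one _))

lemma exists_restriction_estimate (hα₁ : 1 / 2 < α) (hα₂ : α < 3 / 2) (hn : n ≠ 0)
    (hp1 : 1 ≤ p) (hp : p ≤ (2 * (n : ℝ) + 2) / ((n : ℝ) + 1 + 4 * α)) :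
    ∃ C : ℝ, ∀ φ : SchwartzMap (EuclideanSpace ℝ (Fin n)) ℂ,
      ∫ ω, ‖fourierHat φ ω‖ ^ 2 ∂(surfaceMeasure n) ≤
        C * (eLpNorm φ (ENNReal.ofReal p) volume).toReal ^ 2 := by
  obtain ⟨C, h_annulus⟩ := exists_setIntegral_annulus_norm_sq_fourierHat_le n hp1
    (le_two_of_le_critical_exponent (by linarith) hp)
  obtain ⟨K, h_diff⟩ := exists_abs_setIntegral_annulus_sub_sphere_le hα₁ hα₂ hn hp1 hp
  have hW := half_pos (integral_resolventWeight_pos hα₁ one_pos)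
  refine ⟨((∫ u, resolventWeight α 1 u) / 2)⁻¹ * (C + K), fun φ => ?_⟩
  have h_lower := (abs_le.1 (h_diff φ 1 one_pos)).1
  have h_weight := setIntegral_annulus_mul_resolventWeight_le (α := α) (by linarith)
    ((memLp_two_fourierHat φ.integrable (φ.memLp 2 volume)).restrict (annulus n))
  have h_upper := h_annulus φ
  rw [mul_assoc, inv_mul_eq_div, le_div_iff₀ hW, mul_comm, add_mul]
  linarith

end APriori

section LpLimits

open scoped ENNReal

variable {X Y E : Type*} [MeasurableSpace X] [MeasurableSpace Y] [NormedAddCommGroup E]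
  {μ : Measure X} {ν : Measure Y} {p q : ℝ≥0∞}

lemma tendsto_toReal_eLpNorm (hp : 1 ≤ p) {u : ℕ → X → E} {v : X → E}
    (hu : ∀ k, MemLp (u k) p μ) (hv : MemLp v p μ)
    (h : Tendsto (fun k => eLpNorm (u k - v) p μ) atTop (𝓝 0)) :
    Tendsto (fun k => (eLpNorm (u k) p μ).toReal) atTop (𝓝 (eLpNorm v p μ).toReal) := by
  have : Fact (1 ≤ p) := ⟨hp⟩
  simpa only [Lp.norm_toLp] using ((Lp.tendsto_Lp_iff_tendsto_eLpNorm'' u hu v hv).2 h).norm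

lemma integral_norm_sq_eq_toReal_eLpNorm_sq {w : X → ℂ} (hw : MemLp w 2 μ) :
    ∫ x, ‖w x‖ ^ 2 ∂μ = (eLpNorm w 2 μ).toReal ^ 2 := by
  rw [integral_norm_sq_eq_norm_toLp_sq hw, Lp.norm_toLp]

lemma eLpNorm_two_le_of_integral_norm_sq_le {u : X → ℂ} (hu : MemLp u 2 μ) {C : ℝ} {N : ℝ≥0∞}
    (hN : N ≠ ⊤) (h : ∫ x, ‖u x‖ ^ 2 ∂μ ≤ C * N.toReal ^ 2) :
    eLpNorm u 2 μ ≤ ENNReal.ofReal (Real.sqrt C) * N := by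
  rw [integral_norm_sq_eq_toReal_eLpNorm_sq hu] at h
  rw [← ENNReal.ofReal_toReal hu.eLpNorm_ne_top, ← ENNReal.ofReal_toReal hN,
    ← ENNReal.ofReal_mul (Real.sqrt_nonneg C)]
  refine ENNReal.ofReal_le_ofReal ?_
  simpa only [Real.sqrt_sq ENNReal.toReal_nonneg, Real.sqrt_mul' C (sq_nonneg N.toReal)] using
    Real.sqrt_le_sqrt h

lemma tendsto_integral_norm_sq {u : ℕ → X → ℂ} {v : X → ℂ} (hu : ∀ k, MemLp (u k) 2 μ)
    (hv : MemLp v 2 μ) (h : Tendsto (fun k => eLpNorm (u k - v) 2 μ) atTop (𝓝 0)) :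
    Tendsto (fun k => ∫ x, ‖u k x‖ ^ 2 ∂μ) atTop (𝓝 (∫ x, ‖v x‖ ^ 2 ∂μ)) := by
  simp only [integral_norm_sq_eq_toReal_eLpNorm_sq hv,
    fun k => integral_norm_sq_eq_toReal_eLpNorm_sq (hu k)]
  exact (tendsto_toReal_eLpNorm one_le_two hu hv h).pow 2

/- Multiplication by the bounded function `√w` is continuous on `L²`. -/
lemma tendsto_integral_norm_sq_mul {u : ℕ → X → ℂ} {v : X → ℂ} (hu : ∀ k, MemLp (u k) 2 μ)
    (hv : MemLp v 2 μ) (h : Tendsto (fun k => eLpNorm (u k - v) 2 μ) atTop (𝓝 0)) {w : X → ℝ}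
    (hw : Measurable w) (hw0 : ∀ x, 0 ≤ w x) {B : ℝ} (hB : ∀ x, w x ≤ B) :
    Tendsto (fun k => ∫ x, ‖u k x‖ ^ 2 * w x ∂μ) atTop (𝓝 (∫ x, ‖v x‖ ^ 2 * w x ∂μ)) := by
  have norm_sqrt : ∀ x, ‖(Real.sqrt (w x) : ℂ)‖ = Real.sqrt (w x) := fun x => by
    rw [Complex.norm_real, Real.norm_of_nonneg (Real.sqrt_nonneg _)]
  have norm_mul_le : ∀ (r : X → ℂ) (x : X),
      ‖(Real.sqrt (w x) : ℂ) * r x‖ ≤ Real.sqrt B * ‖r x‖ := fun r x => by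
    rw [norm_mul, norm_sqrt]
    gcongr
    exact hB x
  have memLp_mul : ∀ r : X → ℂ, MemLp r 2 μ → MemLp (fun x => (Real.sqrt (w x) : ℂ) * r x) 2 μ :=
    fun r hr => hr.of_le_mul
      ((Complex.measurable_ofReal.comp hw.sqrt).aestronglyMeasurable.mul hr.1)
      (.of_forall (norm_mul_le r))
  have sq_mul : ∀ (r : X → ℂ) (x : X), ‖r x‖ ^ 2 * w x = ‖(Real.sqrt (w x) : ℂ) * r x‖ ^ 2 :=
    fun r x => by rw [norm_mul, norm_sqrt, mul_pow, Real.sq_sqrt (hw0 x), mul_comm]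
  simp only [sq_mul]
  refine tendsto_integral_norm_sq (fun k => memLp_mul _ (hu k)) (memLp_mul v hv) ?_
  have h_major : Tendsto (fun k => ENNReal.ofReal (Real.sqrt B) * eLpNorm (u k - v) 2 μ)
      atTop (𝓝 0) := by
    simpa using ENNReal.Tendsto.const_mul h (Or.inr ENNReal.ofReal_ne_top)
  refine tendsto_of_tendsto_of_tendsto_of_le_of_le tendsto_const_nhds h_major (fun _ => zero_le)
    fun k => eLpNorm_le_mul_eLpNorm_of_ae_le_mul (.of_forall fun x => ?_) 2
  simpa [mul_sub] using norm_mul_le (u k - v) x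

lemma tendsto_integral_mul_of_tendsto_eLpNorm [p.HolderConjugate q] {u : ℕ → X → ℂ}
    {v η : X → ℂ} (hu : ∀ k, MemLp (u k) p μ) (hv : MemLp v p μ) (hη : MemLp η q μ)
    (h : Tendsto (fun k => eLpNorm (u k - v) p μ) atTop (𝓝 0)) :
    Tendsto (fun k => ∫ x, u k x * η x ∂μ) atTop (𝓝 (∫ x, v x * η x ∂μ)) := by
  refine tendsto_integral_of_L1' _ (hv.1.mul hη.1)
    (.of_forall fun k => (hu k).integrable_mul hη) ?_
  have h_major : Tendsto (fun k => eLpNorm (u k - v) p μ * eLpNorm η q μ) atTop (𝓝 0) := by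
    simpa using ENNReal.Tendsto.mul_const h (Or.inr hη.eLpNorm_ne_top)
  refine tendsto_of_tendsto_of_tendsto_of_le_of_le tendsto_const_nhds h_major (fun _ => zero_le)
    fun k => ?_
  have sub_eq : (fun x => u k x * η x) - v * η = (u k - v) • η := by
    ext x
    simp [sub_mul]
  rw [sub_eq]
  exact eLpNorm_smul_le_mul_eLpNorm hη.1 ((hu k).1.sub hv.1)

lemma exists_tendsto_eLpNorm_of_le {c : ℝ≥0∞} (hp : 1 ≤ p) [Fact (1 ≤ q)] [CompleteSpace E]
    (hc : c ≠ ⊤) {u : ℕ → X → E} (hu : ∀ k, MemLp (u k) q μ) {φ : ℕ → Y → E}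
    (hφ : ∀ k, AEStronglyMeasurable (φ k) ν) {f : Y → E} (hf : AEStronglyMeasurable f ν)
    (hφf : Tendsto (fun k => eLpNorm (φ k - f) p ν) atTop (𝓝 0))
    (hle : ∀ j k, eLpNorm (u j - u k) q μ ≤ c * eLpNorm (φ j - φ k) p ν) :
    ∃ v, MemLp v q μ ∧ Tendsto (fun k => eLpNorm (u k - v) q μ) atTop (𝓝 0) := by
  have h_major : Tendsto (fun k => c * eLpNorm (φ k - f) p ν) atTop (𝓝 0) := by
    simpa using ENNReal.Tendsto.const_mul hφf (Or.inr hc)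
  have h_cauchy : CauchySeq fun k => (hu k).toLp (u k) := by
    rw [EMetric.cauchySeq_iff]
    intro ε hε
    obtain ⟨N, hN⟩ := eventually_atTop.1 (h_major.eventually_lt_const (ENNReal.half_pos hε.ne'))
    refine ⟨N, fun j hj k hk => ?_⟩
    rw [Lp.edist_toLp_toLp]
    calc eLpNorm (u j - u k) q μ ≤ c * eLpNorm (φ j - φ k) p ν := hle j k
      _ ≤ c * (eLpNorm (φ j - f) p ν + eLpNorm (φ k - f) p ν) := by
          rw [← sub_sub_sub_cancel_right (φ j) (φ k) f]
          gcongr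
          exact eLpNorm_sub_le ((hφ j).sub hf) ((hφ k).sub hf) hp
      _ < ε / 2 + ε / 2 := by
          rw [mul_add]
          exact ENNReal.add_lt_add (hN j hj) (hN k hk)
      _ = ε := ENNReal.add_halves ε
  obtain ⟨L, hL⟩ := cauchySeq_tendsto_of_complete h_cauchy
  refine ⟨L, Lp.memLp L, ?_⟩
  rwa [← Lp.tendsto_Lp_iff_tendsto_eLpNorm'' u hu L (Lp.memLp L), Lp.toLp_coeFn]

end LpLimits

section FourierRepresentation

open scoped ENNReal

/- Split `f` according to whether `1 < ‖f x‖`. -/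
lemma exists_integrable_memLp_two_add_eq {X E : Type*} [MeasurableSpace X]
    [NormedAddCommGroup E] {μ : Measure X} {p : ℝ} (hp1 : 1 ≤ p) (hp2 : p ≤ 2) {f : X → E}
    (hf : MemLp f (ENNReal.ofReal p) μ) :
    ∃ f₁ f₂ : X → E, Integrable f₁ μ ∧ MemLp f₂ 2 μ ∧ f₁ + f₂ = f := by
  have hfp := integrable_norm_rpow_of_memLp_ofReal (by linarith) hf
  set A : Set X := {x | 1 < ‖f x‖}
  have hA : NullMeasurableSet A μ :=
    aestronglyMeasurable_const.nullMeasurableSet_lt hf.1.norm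
  refine ⟨A.indicator f, Aᶜ.indicator f, ?_, ?_, Set.indicator_self_add_compl A f⟩
  · refine hfp.mono' (hf.1.indicator₀ hA) (.of_forall fun x => ?_)
    by_cases hx : x ∈ A
    · rw [Set.indicator_of_mem hx]
      exact Real.self_le_rpow_of_one_le hx.le hp1
    · rw [Set.indicator_of_notMem hx, norm_zero]
      positivity
  · rw [memLp_two_iff_integrable_sq_norm (hf.1.indicator₀ hA.compl)]
    refine hfp.mono' ((hf.1.indicator₀ hA.compl).norm.pow 2) (.of_forall fun x => ?_)
    rw [Real.norm_of_nonneg (sq_nonneg _)]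
    by_cases hx : x ∈ A
    · rw [Set.indicator_of_notMem (by simpa using hx), norm_zero, zero_pow two_ne_zero]
      positivity
    · rw [Set.indicator_of_mem (by exact hx), ← Real.rpow_two]
      exact Real.rpow_le_rpow_of_exponent_ge' (norm_nonneg _) (not_lt.1 hx) (by linarith) hp2

variable {n : ℕ}

lemma fourier_comp_two_pi_smul (φ : EuclideanSpace ℝ (Fin n) → ℂ)
    (x : EuclideanSpace ℝ (Fin n)) :
    𝓕 (fun v => φ ((2 * Real.pi) • v)) x = ((2 * Real.pi : ℝ) ^ n)⁻¹ • fourierHat φ x := by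
  have change_of_variables := Measure.integral_comp_smul
    (volume : Measure (EuclideanSpace ℝ (Fin n)))
    (fun y => Complex.exp (-(Complex.I * ((inner ℝ x y : ℝ) : ℂ))) * φ y) (2 * Real.pi)
  rw [finrank_euclideanSpace_fin, abs_of_pos (by positivity)] at change_of_variables
  rw [Real.fourier_eq', fourierHat, ← change_of_variables]
  congr 1 with v
  rw [smul_eq_mul, inner_smul_right, real_inner_comm]
  congr 2
  push_cast
  ring

lemma isFourierTransform_of_fourier {f G : EuclideanSpace ℝ (Fin n) → ℂ}
    (h : ∀ φ : SchwartzMap (EuclideanSpace ℝ (Fin n)) ℂ, Integrable (fun v => G v * φ v) ∧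
      ∫ v, G v * φ v = ∫ x, f x * 𝓕 (φ : EuclideanSpace ℝ (Fin n) → ℂ) x) :
    IsFourierTransform f fun ξ => G ((2 * Real.pi)⁻¹ • ξ) := by
  intro φ
  have two_pi_ne : 2 * Real.pi ≠ 0 := by positivity
  let Φ : SchwartzMap (EuclideanSpace ℝ (Fin n)) ℂ :=
    SchwartzMap.compCLMOfContinuousLinearEquiv ℂ (LinearEquiv.smulOfNeZero ℝ
      (EuclideanSpace ℝ (Fin n)) (2 * Real.pi) two_pi_ne).toContinuousLinearEquiv φ
  have hΦ : (Φ : EuclideanSpace ℝ (Fin n) → ℂ) = fun v => φ ((2 * Real.pi) • v) := rfl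
  have integrand_eq : (fun ξ => G ((2 * Real.pi)⁻¹ • ξ) * φ ξ) = fun ξ =>
      (fun v => G v * Φ v) ((2 * Real.pi)⁻¹ • ξ) := by
    ext ξ
    simp only [hΦ, smul_inv_smul₀ two_pi_ne]
  rw [integrand_eq]
  refine ⟨(h Φ).1.comp_smul (inv_ne_zero two_pi_ne), ?_⟩
  rw [integral_comp_two_pi_inv_smul fun v => G v * Φ v, (h Φ).2, hΦ, ← integral_smul]
  congr 1 with x
  rw [fourier_comp_two_pi_smul, mul_smul_comm, smul_smul, mul_inv_cancel₀ (by positivity),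
    one_smul]

lemma integrable_mul_fourier {f g : EuclideanSpace ℝ (Fin n) → ℂ} (hf : Integrable f)
    (hg : Integrable g) : Integrable fun v => f v * 𝓕 g v :=
  hf.mul_bdd (continuous_fourier_of_integrable hg).aestronglyMeasurable
    (.of_forall (norm_fourier_le_integral_norm g))

lemma integrable_fourier_mul {f g : EuclideanSpace ℝ (Fin n) → ℂ} (hf : Integrable f)
    (hg : Integrable g) : Integrable fun v => 𝓕 f v * g v := by
  simpa only [mul_comm] using integrable_mul_fourier hg hf

lemma isFourierTransform_fourierHat {f : EuclideanSpace ℝ (Fin n) → ℂ} (hf : Integrable f) :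
    IsFourierTransform f (fourierHat f) := by
  rw [funext (fourierHat_eq_fourier f)]
  exact isFourierTransform_of_fourier fun φ =>
    ⟨integrable_fourier_mul hf φ.integrable, integral_fourier_mul_eq hf φ.integrable⟩

lemma integral_fourier_toLp_mul_eq {f : EuclideanSpace ℝ (Fin n) → ℂ} (hf : MemLp f 2)
    (φ : SchwartzMap (EuclideanSpace ℝ (Fin n)) ℂ) :
    ∫ v, (𝓕 (hf.toLp f) : Lp ℂ 2 (volume : Measure (EuclideanSpace ℝ (Fin n)))) v * φ v =
      ∫ x, f x * 𝓕 (φ : EuclideanSpace ℝ (Fin n) → ℂ) x := by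
  have pairing := DFunLike.congr_fun (Lp.fourier_toTemperedDistribution_eq (hf.toLp f)) φ
  simp only [TemperedDistribution.fourier_apply, Lp.toTemperedDistribution_apply,
    smul_eq_mul] at pairing
  simp only [mul_comm _ (φ _)]
  rw [← pairing]
  refine integral_congr_ae ?_
  filter_upwards [hf.coeFn_toLp] with x hx
  rw [hx, mul_comm]
  rfl

lemma exists_isFourierTransform {p : ℝ} (hp1 : 1 ≤ p) (hp2 : p ≤ 2)
    {f : EuclideanSpace ℝ (Fin n) → ℂ} (hf : MemLp f (ENNReal.ofReal p)) :
    ∃ g, IsFourierTransform f g := by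
  obtain ⟨f₁, f₂, hf₁, hf₂, rfl⟩ := exists_integrable_memLp_two_add_eq hp1 hp2 hf
  refine ⟨_, isFourierTransform_of_fourier (G := fun v => 𝓕 f₁ v +
    (𝓕 (hf₂.toLp f₂) : Lp ℂ 2 (volume : Measure (EuclideanSpace ℝ (Fin n)))) v) fun φ => ?_⟩
  have h_one := integrable_fourier_mul hf₁ φ.integrable
  have h_two : Integrable fun v =>
      (𝓕 (hf₂.toLp f₂) : Lp ℂ 2 (volume : Measure (EuclideanSpace ℝ (Fin n)))) v * φ v :=
    (Lp.memLp _).integrable_mul (φ.memLp 2 volume)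
  have h_two_dual : Integrable fun x => f₂ x * 𝓕 (φ : EuclideanSpace ℝ (Fin n) → ℂ) x :=
    hf₂.integrable_mul ((𝓕 φ).memLp 2 volume)
  simp only [add_mul, Pi.add_apply]
  refine ⟨h_one.add h_two, ?_⟩
  rw [integral_add h_one h_two, integral_fourier_mul_eq hf₁ φ.integrable,
    integral_fourier_toLp_mul_eq hf₂, ← integral_add (integrable_mul_fourier hf₁ φ.integrable)
      h_two_dual]

end FourierRepresentation

section Extension

open scoped ENNReal

variable {n : ℕ}

lemma memLp_fourierHat_sphere {f : EuclideanSpace ℝ (Fin n) → ℂ} (hf : Integrable f)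
    (p : ℝ≥0∞) :
    MemLp (fun ω : Metric.sphere (0 : EuclideanSpace ℝ (Fin n)) 1 => fourierHat f ω) p
      (surfaceMeasure n) := by
  have finite_measure : IsFiniteMeasure (surfaceMeasure n) := by
    unfold surfaceMeasure
    infer_instance
  have h_cont : Continuous fun ω : Metric.sphere (0 : EuclideanSpace ℝ (Fin n)) 1 =>
      fourierHat f ω := (continuous_fourierHat hf).comp continuous_subtype_val
  obtain ⟨C, hC⟩ := isCompact_univ.exists_bound_of_continuousOn h_cont.continuousOn
  exact .of_bound h_cont.aestronglyMeasurable C (.of_forall fun ω => hC ω trivial)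

lemma fourierHat_sub (φ ψ : SchwartzMap (EuclideanSpace ℝ (Fin n)) ℂ) :
    fourierHat (φ - ψ : SchwartzMap (EuclideanSpace ℝ (Fin n)) ℂ) =
      fourierHat φ - fourierHat ψ := by
  ext ξ
  have fourier_sub : 𝓕 (φ - ψ) = 𝓕 φ - 𝓕 ψ := map_sub (SchwartzMap.fourierTransformCLM ℂ) φ ψ
  simp only [Pi.sub_apply, fourierHat_eq_fourier, ← SchwartzMap.fourier_coe, fourier_sub]
  rfl

lemma exists_schwartz_eq_fourierHat (θ : SchwartzMap (EuclideanSpace ℝ (Fin n)) ℂ) :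
    ∃ H : SchwartzMap (EuclideanSpace ℝ (Fin n)) ℂ,
      (H : EuclideanSpace ℝ (Fin n) → ℂ) = fourierHat θ :=
  ⟨SchwartzMap.compCLMOfContinuousLinearEquiv ℂ (LinearEquiv.smulOfNeZero ℝ
    (EuclideanSpace ℝ (Fin n)) (2 * Real.pi)⁻¹ (by positivity)).toContinuousLinearEquiv (𝓕 θ),
    funext fun ξ => (fourierHat_eq_fourier θ ξ).symm⟩

lemma exists_schwartz_tendsto_eLpNorm {p : ℝ≥0∞} (hp1 : 1 ≤ p) (hp : p ≠ ⊤)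
    {f : EuclideanSpace ℝ (Fin n) → ℂ} (hf : MemLp f p) :
    ∃ φ : ℕ → SchwartzMap (EuclideanSpace ℝ (Fin n)) ℂ,
      Tendsto (fun k => eLpNorm (⇑(φ k) - f) p volume) atTop (𝓝 0) := by
  have : Fact (1 ≤ p) := ⟨hp1⟩
  obtain ⟨u, hu, hu_tendsto⟩ := mem_closure_iff_seq_limit.1
    (SchwartzMap.denseRange_toLpCLM (E := EuclideanSpace ℝ (Fin n)) (F := ℂ) (μ := volume) hp
      (hf.toLp f))
  choose φ hφ using hu
  refine ⟨φ, (Lp.tendsto_Lp_iff_tendsto_eLpNorm'' _ (fun k => (φ k).memLp p volume) f hf).1 ?_⟩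
  exact hu_tendsto.congr fun k => (hφ k).symm

/- With `ι` the inclusion of the sphere this is the restriction operator; with `ι` the identity
and `μ` supported on the annulus it is the Fourier transform there. -/
lemma exists_tendsto_eLpNorm_fourierHat_comp {Y : Type*} [MeasurableSpace Y] {μ : Measure Y}
    {ι : Y → EuclideanSpace ℝ (Fin n)} {p : ℝ≥0∞} (hp : 1 ≤ p) {C : ℝ}
    (h_memLp : ∀ φ : SchwartzMap (EuclideanSpace ℝ (Fin n)) ℂ,
      MemLp (fun y => fourierHat φ (ι y)) 2 μ)
    (h_bound : ∀ φ : SchwartzMap (EuclideanSpace ℝ (Fin n)) ℂ,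
      ∫ y, ‖fourierHat φ (ι y)‖ ^ 2 ∂μ ≤ C * (eLpNorm φ p volume).toReal ^ 2)
    {f : EuclideanSpace ℝ (Fin n) → ℂ} (hf : MemLp f p)
    {φ : ℕ → SchwartzMap (EuclideanSpace ℝ (Fin n)) ℂ}
    (hφ : Tendsto (fun k => eLpNorm (⇑(φ k) - f) p volume) atTop (𝓝 0)) :
    ∃ v, MemLp v 2 μ ∧
      Tendsto (fun k => eLpNorm ((fun y => fourierHat (φ k) (ι y)) - v) 2 μ) atTop (𝓝 0) := by
  refine exists_tendsto_eLpNorm_of_le hp (c := ENNReal.ofReal (Real.sqrt C)) ENNReal.ofReal_ne_top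
    (fun k => h_memLp (φ k)) (fun k => ((φ k).memLp p volume).1) hf.1 hφ fun j k => ?_
  have difference_bound := eLpNorm_two_le_of_integral_norm_sq_le (h_memLp (φ j - φ k))
    ((φ j - φ k).memLp p volume).eLpNorm_ne_top (h_bound (φ j - φ k))
  rw [fourierHat_sub] at difference_bound
  exact difference_bound

lemma IsFourierTransform.locallyIntegrable {f g : EuclideanSpace ℝ (Fin n) → ℂ}
    (hg : IsFourierTransform f g) : LocallyIntegrable g := by
  refine locallyIntegrable_iff.2 fun k hk => ?_
  obtain ⟨R, hR, hkR⟩ := hk.isBounded.subset_closedBall_lt 0 0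
  let b : ContDiffBump (0 : EuclideanSpace ℝ (Fin n)) := ⟨R, R + 1, hR, by linarith⟩
  obtain ⟨B, hB⟩ := exists_schwartz_eq_ofReal b.contDiff b.hasCompactSupport
  refine (hg B).1.integrableOn.congr_fun (fun ξ hξ => ?_) hk.measurableSet
  simp only [hB, b.one_of_mem_closedBall (hkR hξ), Complex.ofReal_one, mul_one]

lemma IsFourierTransform.tendsto_integral_fourierHat_mul {p : ℝ≥0∞} (hp : 1 ≤ p)
    {f g : EuclideanSpace ℝ (Fin n) → ℂ} (hf : MemLp f p) (hg : IsFourierTransform f g)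
    {φ : ℕ → SchwartzMap (EuclideanSpace ℝ (Fin n)) ℂ}
    (hφ : Tendsto (fun k => eLpNorm (⇑(φ k) - f) p volume) atTop (𝓝 0))
    (θ : SchwartzMap (EuclideanSpace ℝ (Fin n)) ℂ) :
    Tendsto (fun k => ∫ ξ, fourierHat (φ k) ξ * θ ξ) atTop (𝓝 (∫ ξ, g ξ * θ ξ)) := by
  have : p.HolderConjugate p.conjExponent := ENNReal.HolderConjugate.conjExponent hp
  obtain ⟨H, hH⟩ := exists_schwartz_eq_fourierHat θ
  simp only [(hg θ).2, fun k => (isFourierTransform_fourierHat (φ k).integrable θ).2, ← hH]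
  exact tendsto_integral_mul_of_tendsto_eLpNorm (q := p.conjExponent)
    (fun k => (φ k).memLp p volume) hf (H.memLp _ volume) hφ

/- Both `g` and `v` represent, on `U`, the distributional limit of the `fourierHat (φ k)`. -/
lemma IsFourierTransform.ae_eq_of_tendsto {p : ℝ≥0∞} (hp : 1 ≤ p)
    {f g v : EuclideanSpace ℝ (Fin n) → ℂ} (hf : MemLp f p) (hg : IsFourierTransform f g)
    {φ : ℕ → SchwartzMap (EuclideanSpace ℝ (Fin n)) ℂ}
    (hφ : Tendsto (fun k => eLpNorm (⇑(φ k) - f) p volume) atTop (𝓝 0))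
    {U : Set (EuclideanSpace ℝ (Fin n))} (hU : IsOpen U) (hv : MemLp v 2 (volume.restrict U))
    (hφv : Tendsto (fun k => eLpNorm (fourierHat (φ k) - v) 2 (volume.restrict U)) atTop (𝓝 0)) :
    g =ᵐ[volume.restrict U] v := by
  have h_loc : LocallyIntegrableOn (fun ξ => g ξ - v ξ) U :=
    (hg.locallyIntegrable.locallyIntegrableOn U).sub
      (locallyIntegrableOn_of_locallyIntegrable_restrict (hv.locallyIntegrable one_le_two))
  rw [EventuallyEq, ae_restrict_iff' hU.measurableSet]
  suffices h_test : ∀ η : EuclideanSpace ℝ (Fin n) → ℝ, ContDiff ℝ ((⊤ : ℕ∞) : WithTop ℕ∞) η →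
      HasCompactSupport η → tsupport η ⊆ U → ∫ ξ, η ξ • (g ξ - v ξ) = 0 by
    filter_upwards [hU.ae_eq_zero_of_integral_contDiff_smul_eq_zero h_loc h_test] with ξ hξ hξU
    exact sub_eq_zero.1 (hξ hξU)
  intro η hη hηc hηU
  obtain ⟨θ, hθ⟩ := exists_schwartz_eq_ofReal hη hηc
  have setIntegral_eq : ∀ r : EuclideanSpace ℝ (Fin n) → ℂ,
      ∫ ξ in U, r ξ * θ ξ = ∫ ξ, r ξ * θ ξ := fun r =>
    setIntegral_eq_integral_of_forall_compl_eq_zero fun ξ hξ => by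
      rw [hθ, image_eq_zero_of_notMem_tsupport fun h => hξ (hηU h), Complex.ofReal_zero, mul_zero]
  have limit_g := hg.tendsto_integral_fourierHat_mul hp hf hφ θ
  have limit_v : Tendsto (fun k => ∫ ξ in U, fourierHat (φ k) ξ * θ ξ) atTop
      (𝓝 (∫ ξ in U, v ξ * θ ξ)) :=
    tendsto_integral_mul_of_tendsto_eLpNorm (p := 2) (q := 2)
      (fun k => (memLp_two_fourierHat (φ k).integrable ((φ k).memLp 2 volume)).restrict U) hv
      ((θ.memLp 2 volume).restrict U) hφv
  simp only [setIntegral_eq fun ξ => fourierHat _ ξ] at limit_v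
  calc ∫ ξ, η ξ • (g ξ - v ξ) = ∫ ξ, (g ξ - v ξ) * θ ξ := by
        simp only [hθ, Complex.real_smul, mul_comm]
    _ = ∫ ξ in U, (g ξ * θ ξ - v ξ * θ ξ) := by
        simp only [← sub_mul]
        exact (setIntegral_eq fun ξ => g ξ - v ξ).symm
    _ = (∫ ξ in U, g ξ * θ ξ) - ∫ ξ in U, v ξ * θ ξ :=
        integral_sub (hg θ).1.integrableOn (hv.integrable_mul ((θ.memLp 2 volume).restrict U))
    _ = 0 := by rw [setIntegral_eq g, tendsto_nhds_unique limit_g limit_v, sub_self]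

lemma IsFourierTransform.memLp_annulus_and_tendsto {p : ℝ} (hp1 : 1 ≤ p) (hp2 : p ≤ 2)
    {f g : EuclideanSpace ℝ (Fin n) → ℂ} (hf : MemLp f (ENNReal.ofReal p))
    (hg : IsFourierTransform f g) {φ : ℕ → SchwartzMap (EuclideanSpace ℝ (Fin n)) ℂ}
    (hφ : Tendsto (fun k => eLpNorm (⇑(φ k) - f) (ENNReal.ofReal p) volume) atTop (𝓝 0)) :
    MemLp g 2 (volume.restrict (annulus n)) ∧
      Tendsto (fun k => eLpNorm (fourierHat (φ k) - g) 2 (volume.restrict (annulus n)))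
        atTop (𝓝 0) := by
  have hP : 1 ≤ ENNReal.ofReal p := ENNReal.one_le_ofReal.2 hp1
  obtain ⟨C, hC⟩ := exists_setIntegral_annulus_norm_sq_fourierHat_le n hp1 hp2
  obtain ⟨v, hv, hφv⟩ := exists_tendsto_eLpNorm_fourierHat_comp (ι := id) hP
    (fun ψ => (memLp_two_fourierHat ψ.integrable (ψ.memLp 2 volume)).restrict (annulus n))
    hC hf hφ
  have hgv := hg.ae_eq_of_tendsto hP hf hφ (isOpen_annulus n) hv hφv
  exact ⟨(memLp_congr_ae hgv).2 hv, hφv.congr fun k =>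
    eLpNorm_congr_ae ((EventuallyEq.refl _ _).sub hgv.symm)⟩

lemma exists_isSphereRestriction {α p : ℝ} (hα₁ : 1 / 2 < α) (hα₂ : α < 3 / 2) (hn : n ≠ 0)
    (hp1 : 1 ≤ p) (hp : p ≤ (2 * (n : ℝ) + 2) / ((n : ℝ) + 1 + 4 * α))
    {f : EuclideanSpace ℝ (Fin n) → ℂ} (hf : MemLp f (ENNReal.ofReal p)) :
    ∃ h, IsSphereRestriction p f h := by
  have hP : 1 ≤ ENNReal.ofReal p := ENNReal.one_le_ofReal.2 hp1
  obtain ⟨C, hC⟩ := exists_restriction_estimate hα₁ hα₂ hn hp1 hp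
  obtain ⟨φ, hφ⟩ := exists_schwartz_tendsto_eLpNorm hP ENNReal.ofReal_ne_top hf
  obtain ⟨h, hh, hφh⟩ := exists_tendsto_eLpNorm_fourierHat_comp (ι := Subtype.val) hP
    (fun ψ => memLp_fourierHat_sphere ψ.integrable 2) hC hf hφ
  exact ⟨h, hh, φ, hφ, hφh⟩

end Extension

theorem mainTheorem2 (α : ℝ) (hα₁ : 1 / 2 < α) (hα₂ : α < 3 / 2) :
    ∃ Cα : ℝ, ∀ n : ℕ, 2 ≤ n → ∀ p : ℝ, 1 ≤ p →
      p ≤ (2 * (n : ℝ) + 2) / ((n : ℝ) + 1 + 4 * α) →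
      ∃ K : ℝ, ∀ f : EuclideanSpace ℝ (Fin n) → ℂ, MemLp f (ENNReal.ofReal p) volume →
        (∃ g, IsFourierTransform f g) ∧ (∃ h, IsSphereRestriction p f h) ∧
        ∀ g h, IsFourierTransform f g → IsSphereRestriction p f h → ∀ ε : ℝ, 0 < ε →
          IntegrableOn (fun ξ => ‖g ξ‖ ^ 2 / ((1 - ‖ξ‖ ^ 2) ^ 2 + ε ^ 2) ^ α) (annulus n) volume ∧
          |(∫ ξ in annulus n, ‖g ξ‖ ^ 2 / ((1 - ‖ξ‖ ^ 2) ^ 2 + ε ^ 2) ^ α) -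
              Cα / ε ^ (2 * α - 1) * ∫ ω, ‖h ω‖ ^ 2 ∂(surfaceMeasure n)| ≤
            K * (eLpNorm f (ENNReal.ofReal p) volume).toReal ^ 2 := by
  refine ⟨(∫ u : ℝ, (1 + u ^ 2) ^ (-α)) / 2, fun n hn p hp1 hp => ?_⟩
  have hα : 0 ≤ α := by linarith
  have hn0 : n ≠ 0 := by omega
  have hp2 : p ≤ 2 := le_two_of_le_critical_exponent hα hp
  obtain ⟨K, hK⟩ := exists_abs_setIntegral_annulus_sub_sphere_le hα₁ hα₂ hn0 hp1 hp
  refine ⟨K, fun f hf => ⟨exists_isFourierTransform hp1 hp2 hf,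
    exists_isSphereRestriction hα₁ hα₂ hn0 hp1 hp hf, ?_⟩⟩
  rintro g h hg ⟨hh, φ, hφ, hφh⟩ ε hε
  obtain ⟨hg2, hφg⟩ := hg.memLp_annulus_and_tendsto hp1 hp2 hf hφ
  simp only [div_rpow_eq_mul_resolventWeight]
  refine ⟨integrable_norm_sq_mul_resolventWeight hα hε.ne' hg2, ?_⟩
  rw [div_right_comm, ← integral_resolventWeight hε]
  have annulus_limit := tendsto_integral_norm_sq_mul
    (fun k => (memLp_two_fourierHat (φ k).integrable ((φ k).memLp 2 volume)).restrict _) hg2 hφg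
    ((measurable_resolventWeight α ε).comp (by fun_prop)) (fun _ => resolventWeight_nonneg _ _ _)
    fun ξ => (le_abs_self _).trans (norm_resolventWeight_le hα hε.ne' (1 - ‖ξ‖ ^ 2))
  have sphere_limit := tendsto_integral_norm_sq
    (fun k => memLp_fourierHat_sphere (φ k).integrable 2) hh hφh
  have norm_limit := tendsto_toReal_eLpNorm (ENNReal.one_le_ofReal.2 hp1)
    (fun k => (φ k).memLp (ENNReal.ofReal p) volume) hf hφ
  exact le_of_tendsto_of_tendsto (annulus_limit.sub (sphere_limit.const_mul _)).abs
    ((norm_limit.pow 2).const_mul K) (.of_forall fun k => hK (φ k) ε hε)
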